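/- Let $m>0$ and, on $\mathbb R^4$ with values in $\mathbb C^4$, let $D_m=-i\sum_{k=1}^4\alpha_k\partial_{x_k}+m\beta$, where $\beta=\begin{pmatrix}I&0\\0&-I\end{pmatrix}$, $\alpha_j=\begin{pmatrix}0&\sigma_j\\ \sigma_j&0\end{pmatrix}$ for $1\le j\le 3$ with $\sigma_1=\begin{pmatrix}0&-i\\i&0\end{pmatrix}$, $\sigma_2=\begin{pmatrix}0&1\\1&0\end{pmatrix}$, $\sigma_3=\begin{pmatrix}1&0\\0&-1\end{pmatrix}$, and $\alpha_4=i\begin{pmatrix}0&I\\-I&0\end{pmatrix}$. Let $V:\mathbb R^4\to\mathbb C^{4\times4}$ be self-adjoint-valued, and let $V(x)=B(x)^*\Lambda(x)B(x)$ be a measurable spectral decomposition, with $B(x)$ unitary and $\Lambda=\mathrm{diag}(\lambda_1,\dots,\lambda_4)$ real. Put $v=|\Lambda|^{1/2}B$ and $U=\mathrm{diag}(\operatorname{sign}\lambda_1,\dots,\operatorname{sign}\lambda_4)$ with the convention $\operatorname{sign}0=1$, so that $V=v^*Uv$ and $U^2=I$. Write $\langle x\rangle=(1+|x|^2)^{1/2}$,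 and let $L^{2,s}$ be the space of $f:\mathbb R^4\to\mathbb C^4$ with $\langle x\rangle^{s}f\in L^2$. Let $\mathcal G_0=(D_m+m)(-\Delta)^{-1}$ be the integral operator with kernel $$\mathcal G_0(x,y)=\frac{i\,\alpha\cdot(x-y)}{2\pi^2|x-y|^4}+\frac{m\,I_{uc}}{2\pi^2|x-y|^2},\qquad I_{uc}=\tfrac12(\beta+I),$$ let $T_0=U+v\mathcal G_0v^*$ on $L^2=L^2(\mathbb R^4;\mathbb C^4)$, and let $S_1$ be the orthogonal projection of $L^2$ onto the kernel of $T_0$. Assume that for some $\varepsilon>0$ and $C$ all entries satisfy $|v_{ij}(x)|\le C\langle x\rangle^{-2-\varepsilon}$. Let $0<\sigma<2$ (in particular, $\sigma$ may be arbitrarily small) and $\phi\in L^2$. Then $\phi\in S_1L^2\setminus\{0\}$ if and only if $\phi=Uv\psi$ almost everywhere for some $\psi\in L^{2,-\sigma}\setminus\{0\}$ that is a distributional solution of $(D_m+V-m)\psi=0$. Moreover, for every such $\psi$, the integral defining $\mathcal G_0v^*\phi$ converges absolutely almost everywhere, $\psi=-\mathcal G_0v^*\phi$ almost everywhere, and $\psi$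 is (essentially) bounded. -/

import Mathlib

open MeasureTheory Matrix
open scoped Distributions LineDeriv

noncomputable section

namespace Dirac4

/-- Physical space `ℝ⁴` with its Euclidean norm. -/
abbrev R4 : Type := EuclideanSpace ℝ (Fin 4)

/-- Spinor space `ℂ⁴`. -/
abbrev C4 : Type := EuclideanSpace ℂ (Fin 4)

/-- Complex `4 × 4` matrices. -/
abbrev M4 : Type := Matrix (Fin 4) (Fin 4) ℂ

/-- The Hilbert space `L²(ℝ⁴; ℂ⁴)`. -/
abbrev L2 : Type := Lp C4 2 (volume : Measure R4)

/-- The Dirac matrices `α₁, …, α₄` (indexed by `0, …, 3`): for `i ≤ 3` the off-diagonal blocks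
of `αᵢ` are `σᵢ, σᵢ` with `σ₁ = [0, -i; i, 0]`, `σ₂ = [0, 1; 1, 0]`, `σ₃ = [1, 0; 0, -1]`, and the
off-diagonal blocks of `α₄` are `i I, -i I`. -/
def alpha : Fin 4 → M4 := ![
  !![0, 0, 0, -Complex.I; 0, 0, Complex.I, 0; 0, -Complex.I, 0, 0; Complex.I, 0, 0, 0],
  !![0, 0, 0, 1; 0, 0, 1, 0; 0, 1, 0, 0; 1, 0, 0, 0],
  !![0, 0, 1, 0; 0, 0, 0, -1; 1, 0, 0, 0; 0, -1, 0, 0],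
  !![0, 0, Complex.I, 0; 0, 0, 0, Complex.I; -Complex.I, 0, 0, 0; 0, -Complex.I, 0, 0]]

/-- The matrix `β = diag(1, 1, -1, -1)`. -/
def beta : M4 := !![1, 0, 0, 0; 0, 1, 0, 0; 0, 0, -1, 0; 0, 0, 0, -1]

/-- The projection `I_uc = (β + I) / 2 = diag(1, 1, 0, 0)` onto the upper components. -/
def Iuc : M4 := !![1, 0, 0, 0; 0, 1, 0, 0; 0, 0, 0, 0; 0, 0, 0, 0]

/-- A matrix acting on a spinor. -/
def act (A : M4) (w : C4) : C4 := Matrix.toEuclideanLin A w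

/-- The Japanese bracket `⟨x⟩ = (1 + |x|²)^{1/2}`. -/
def bracket (x : R4) : ℝ := Real.sqrt (1 + ‖x‖ ^ 2)

/-- Membership in the weighted space `L^{2,s}(ℝ⁴; ℂ⁴)`: `⟨x⟩^s f ∈ L²`. -/
def MemWeightedL2 (s : ℝ) (f : R4 → C4) : Prop :=
  MemLp (fun x => (bracket x ^ s) • f x) 2 volume

/-! ### The factorization `V = v* U v` -/

/-- The sign, with `sign 0 = 1`, so that `U² = I`. -/
def sgn (t : ℝ) : ℝ := if 0 ≤ t then 1 else -1

/-- `U(x) = diag(sign λ₁(x), …, sign λ₄(x))`. -/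
def Umat (lam : R4 → Fin 4 → ℝ) (x : R4) : M4 :=
  Matrix.diagonal fun i => ((sgn (lam x i) : ℝ) : ℂ)

/-- `v(x) = |Λ(x)|^{1/2} B(x)` with `Λ(x) = diag(λ₁(x), …, λ₄(x))`. -/
def vmat (B : R4 → M4) (lam : R4 → Fin 4 → ℝ) (x : R4) : M4 :=
  (Matrix.diagonal fun i => ((Real.sqrt |lam x i| : ℝ) : ℂ)) * B x

/-- A (Lebesgue measurable) spectral decomposition `V(x) = B(x)* Λ(x) B(x)` with `B(x)` unitary and
`Λ(x) = diag(λ₁(x), …, λ₄(x))` real. -/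
structure IsDiagonalization (V : R4 → M4) (B : R4 → M4) (lam : R4 → Fin 4 → ℝ) : Prop where
  aemeasurable_B : ∀ i j, AEMeasurable (fun x => B x i j) volume
  aemeasurable_lam : ∀ i, AEMeasurable (fun x => lam x i) volume
  unitary : ∀ x, B x ∈ Matrix.unitaryGroup (Fin 4) ℂ
  eq : ∀ x, V x = (B x)ᴴ * (Matrix.diagonal fun i => ((lam x i : ℝ) : ℂ)) * B x

/-! ### The operators `𝒢₀`, `T₀` and `S₁` -/

/-- The integral kernel of `𝒢₀ = (D_m + m) (-Δ)⁻¹`, that is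
`(-i α·∇ + 2 m I_uc) (1 / (4π²|x-y|²))
  = i α·(x-y) / (2π²|x-y|⁴) + m I_uc / (2π²|x-y|²)`. -/
def G0kernel (m : ℝ) (x y : R4) : M4 :=
  (Complex.I / ((2 * Real.pi ^ 2 * ‖x - y‖ ^ 4 : ℝ) : ℂ)) •
      (∑ k : Fin 4, (((x - y) k : ℝ) : ℂ) • alpha k)
    + ((m / (2 * Real.pi ^ 2 * ‖x - y‖ ^ 2) : ℝ) : ℂ) • Iuc

/-- The integral defining `𝒢₀ f` converges absolutely at almost every point. -/
def G0Converges (m : ℝ) (f : R4 → C4) : Prop :=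
  ∀ᵐ x ∂(volume : Measure R4), Integrable (fun y => act (G0kernel m x y) (f y)) volume

/-- `(𝒢₀ f)(x) = ∫ 𝒢₀(x, y) f(y) dy`. -/
def G0 (m : ℝ) (f : R4 → C4) (x : R4) : C4 := ∫ y, act (G0kernel m x y) (f y)

/-- The function `v* f`. -/
def vstar (v : R4 → M4) (f : R4 → C4) (x : R4) : C4 := act (v x)ᴴ (f x)

/-- The function `T₀ f = U f + v 𝒢₀ v* f`. -/
def T0fun (m : ℝ) (U v : R4 → M4) (f : R4 → C4) (x : R4) : C4 :=
  act (U x) (f x) + act (v x) (G0 m (vstar v f) x)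

lemma act_add (A : M4) (w z : C4) : act A (w + z) = act A w + act A z := map_add _ _ _

lemma act_smul (A : M4) (c : ℂ) (w : C4) : act A (c • w) = c • act A w := map_smul _ _ _

lemma act_zero (A : M4) : act A 0 = 0 := map_zero _

lemma G0_add_ae {m : ℝ} {U v : R4 → M4} {f g h : R4 → C4}
    (hh : h =ᵐ[volume] fun x => f x + g x)
    (hf : G0Converges m (vstar v f)) (hg : G0Converges m (vstar v g)) :
    G0Converges m (vstar v h) ∧
      T0fun m U v h =ᵐ[volume] fun x => T0fun m U v f x + T0fun m U v g x := by
  have key : ∀ x, (fun y => act (G0kernel m x y) (vstar v h y)) =ᵐ[volume]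
      fun y => act (G0kernel m x y) (vstar v f y) + act (G0kernel m x y) (vstar v g y) := by
    intro x
    filter_upwards [hh] with y hy
    simp only [vstar, hy, act_add]
  refine ⟨?_, ?_⟩
  · filter_upwards [hf, hg] with x h1 h2
    exact (h1.add h2).congr (key x).symm
  · filter_upwards [hf, hg, hh] with x h1 h2 h3
    simp only [T0fun, G0]
    rw [integral_congr_ae (key x), integral_add h1 h2, h3, act_add, act_add]
    abel

lemma G0_smul_ae {m : ℝ} {U v : R4 → M4} {f h : R4 → C4} {c : ℂ}
    (hh : h =ᵐ[volume] fun x => c • f x)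
    (hf : G0Converges m (vstar v f)) :
    G0Converges m (vstar v h) ∧
      T0fun m U v h =ᵐ[volume] fun x => c • T0fun m U v f x := by
  have key : ∀ x, (fun y => act (G0kernel m x y) (vstar v h y)) =ᵐ[volume]
      fun y => c • act (G0kernel m x y) (vstar v f y) := by
    intro x
    filter_upwards [hh] with y hy
    simp only [vstar, hy, act_smul]
  refine ⟨?_, ?_⟩
  · filter_upwards [hf] with x h1
    exact (h1.smul c).congr (key x).symm
  · filter_upwards [hf, hh] with x h1 h3
    simp only [T0fun, G0]
    rw [integral_congr_ae (key x), integral_smul, h3, act_smul, act_smul, smul_add]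

/-- The natural domain of `T₀` in `L²`: the integral converges absolutely almost everywhere and
`T₀ φ` is in `L²`. (For `|v| ≲ ⟨x⟩^{-2-ε}` this is all of `L²`.) -/
def T0domain (m : ℝ) (U v : R4 → M4) : Submodule ℂ L2 where
  carrier := {φ | G0Converges m (vstar v φ) ∧ MemLp (T0fun m U v φ) 2 volume}
  add_mem' := by
    rintro φ χ ⟨h1, h2⟩ ⟨h3, h4⟩
    obtain ⟨h5, h6⟩ := G0_add_ae (U := U) (Lp.coeFn_add φ χ) h1 h3
    exact ⟨h5, (h2.add h4).ae_eq h6.symm⟩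
  zero_mem' := by
    have h0 : (((0 : L2) : R4 → C4)) =ᵐ[volume] fun x => (0 : ℂ) • (0 : R4 → C4) x := by
      filter_upwards [Lp.coeFn_zero C4 2 (volume : Measure R4)] with x hx
      rw [hx, zero_smul]
      rfl
    have hz : G0Converges m (vstar v (0 : R4 → C4)) := by
      refine Filter.Eventually.of_forall fun x => ?_
      simp [vstar, act_zero]
    obtain ⟨h5, h6⟩ := G0_smul_ae (U := U) h0 hz
    refine ⟨h5, ?_⟩
    have h7 : MemLp (fun _ : R4 => (0 : C4)) 2 volume := MemLp.zero'
    refine h7.ae_eq ?_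
    filter_upwards [h6] with x hx
    rw [hx, zero_smul]
  smul_mem' := by
    rintro c φ ⟨h1, h2⟩
    obtain ⟨h5, h6⟩ := G0_smul_ae (U := U) (Lp.coeFn_smul c φ) h1
    exact ⟨h5, (h2.const_smul c).ae_eq h6.symm⟩

/-- The operator `T₀ = U + v 𝒢₀ v*` on `L²(ℝ⁴; ℂ⁴)`. -/
def T0 (m : ℝ) (U v : R4 → M4) : L2 →ₗ.[ℂ] L2 where
  domain := T0domain m U v
  toFun :=
    { toFun := fun φ => φ.2.2.toLp (T0fun m U v φ.1)
      map_add' := by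
        intro φ χ
        rw [← MemLp.toLp_add φ.2.2 χ.2.2]
        refine MemLp.toLp_congr _ _ ?_
        exact (G0_add_ae (U := U) (Lp.coeFn_add φ.1 χ.1) φ.2.1 χ.2.1).2
      map_smul' := by
        intro c φ
        rw [RingHom.id_apply, ← MemLp.toLp_const_smul c φ.2.2]
        refine MemLp.toLp_congr _ _ ?_
        exact (G0_smul_ae (U := U) (Lp.coeFn_smul c φ.1) φ.2.1).2 }

/-- The kernel of `T₀`, a linear subspace of `L²`. -/
def kerT0 (m : ℝ) (U v : R4 → M4) : Submodule ℂ L2 :=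
  (LinearMap.ker (T0 m U v).toFun).map (T0 m U v).domain.subtype

/-- `S₁`, the orthogonal projection of `L²` onto the kernel of `T₀`. (That kernel is closed if
`|v| ≲ ⟨x⟩^{-2-ε}`; the closure is written only so that `S₁` makes sense for every `v`.) -/
def S1 (m : ℝ) (U v : R4 → M4) : L2 →L[ℂ] L2 :=
  (kerT0 m U v).topologicalClosure.starProjection

/-! ### Distributional solutions -/

/-- `ℂ⁴`-valued distributions on `ℝ⁴`. -/
abbrev Distr : Type := 𝓓'((⊤ : TopologicalSpace.Opens R4), C4)

/-- The distribution `η ↦ ∫ η f` of a locally integrable `f`. -/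
def toDistr (f : R4 → C4) : Distr :=
  (TestFunction.integralAgainstBilinCLM (ContinuousLinearMap.lsmul ℝ ℝ) volume f :
    𝓓((⊤ : TopologicalSpace.Opens R4), ℝ) →L[ℝ] C4)

/-- A constant matrix acting on a distribution. -/
def actDistr (A : M4) (T : Distr) : Distr :=
  Distribution.mapCLM
    (((Matrix.toEuclideanLin A).toContinuousLinearMap).restrictScalars ℝ) T

/-- The free Dirac operator `D_m = -i ∑ₖ αₖ ∂ₖ + m β` on distributions. -/
def freeDirac (m : ℝ) (T : Distr) : Distr :=
  (∑ k : Fin 4, actDistr ((-Complex.I) • alpha k) (∂_{(EuclideanSpace.single k (1 : ℝ) : R4)} T))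
    + actDistr ((m : ℂ) • beta) T

/-- `ψ` is a distributional solution of `(D_m + V - m) ψ = 0`. -/
def IsDistributionalSolution (m : ℝ) (V : R4 → M4) (ψ : R4 → C4) : Prop :=
  LocallyIntegrable ψ volume ∧ LocallyIntegrable (fun x => act (V x) (ψ x)) volume ∧
    freeDirac m (toDistr ψ) + toDistr (fun x => act (V x) (ψ x)) - m • toDistr ψ = 0

/-- `ψ ∈ L^{2,-σ} ∖ {0}` is a distributional solution of `(D_m + V - m) ψ = 0`. -/
def IsThresholdSolution (m σ : ℝ) (V : R4 → M4) (ψ : R4 → C4) : Prop :=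
  MemWeightedL2 (-σ) ψ ∧ ¬ (ψ =ᵐ[volume] 0) ∧ IsDistributionalSolution m V ψ

end Dirac4

end

/-! The correspondence is φ = Uvψ in one direction and ψ = -𝒢₀v*φ in the other. Since V = v*Uv, the
relation φ = Uvψ gives Vψ = v*φ, so the eigenvalue equation becomes (D_m - m)ψ = -f with f = v*φ.
Since U² = I, the equation T₀φ = 0 says exactly that φ = Uvψ for ψ = -𝒢₀f. Everything therefore
rests on 𝒢₀ inverting D_m - m on both sides, for a source f that is integrable because v decays
faster than ⟨x⟩⁻².

At the threshold the Clifford relations give (D_m + m)(D_m - m) = D_m² - m² = -Δ, with no mass term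
left. That 𝒢₀ is a right inverse (`diracWeak_neg_G0`) then follows from the fundamental solution of
-Δ (`integral_newt_mul_lap`) by moving 𝒢₀ onto the test function (`integral_smul_G0`).

The converse is a Liouville argument (`DiracWeak.ae_eq_neg_G0`): the equation is tested with a
cut-off at radius R of the Newtonian potential of a test function. The commutator with the cut-off
is O(R⁻⁴) on a ball of radius 2R, where ψ ∈ L^{2,-σ} has L¹ norm O(R^{σ+2}); the error vanishes
because σ < 2.

Boundedness, and membership of -𝒢₀v*φ in L^{2,-σ}, come from a bootstrap
(`exists_le_om_sq_of_le_majPot`). Here |f| ≲ ⟨x⟩^{-2s}|ψ| with s > 2, while |ψ| is dominated by a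
potential of |f|. Each substitution of these bounds into each other lowers the order of the
singularity by one, until L¹ and L² control of f gives a supremum bound. The outcome |ψ| ≲ ⟨x⟩⁻²
suffices for every σ > 0.

Finally, Schur's test (`exists_lintegral_om_majPot_sq_le`) makes T₀ bounded on all of L², so its
kernel is closed and equals the range of S₁. -/

noncomputable section

namespace Dirac4
open scoped ENNReal NNReal
open Metric

/-! ### Power weights on ℝ⁴: integrability and scaling. -/

/-- `|z|⁻¹`, with value `∞` at the origin. -/
def kap (z : R4) : ℝ≥0∞ := ‖z‖ₑ⁻¹

/-- The weight `(1 + |y|)⁻¹`. -/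
def om (y : R4) : ℝ≥0∞ := (1 + ‖y‖ₑ)⁻¹

/-- The majorant `|z|⁻³ + |z|⁻²` of the kernel of `𝒢₀`. -/
def kerMaj (z : R4) : ℝ≥0∞ := kap z ^ 3 + kap z ^ 2

@[fun_prop] lemma measurable_kap : Measurable kap := by unfold kap; fun_prop
@[fun_prop] lemma measurable_om : Measurable om := by unfold om; fun_prop
@[fun_prop] lemma measurable_kerMaj : Measurable kerMaj := by unfold kerMaj; fun_prop

lemma kap_neg (z : R4) : kap (-z) = kap z := by simp [kap]
lemma kap_sub_comm (x y : R4) : kap (x - y) = kap (y - x) := by rw [← kap_neg, neg_sub]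
lemma kerMaj_sub_comm (x y : R4) : kerMaj (x - y) = kerMaj (y - x) := by
  simp only [kerMaj, kap_sub_comm x y]

lemma om_le_one (y : R4) : om y ≤ 1 := by
  unfold om; exact ENNReal.inv_le_one.2 le_self_add

lemma om_ne_top (y : R4) : om y ≠ ∞ := ((om_le_one y).trans_lt ENNReal.one_lt_top).ne

lemma om_ne_zero (y : R4) : om y ≠ 0 := by simp [om]

lemma one_le_kap {z : R4} (hz : ‖z‖ ≤ 1) : 1 ≤ kap z := by
  rw [kap, ENNReal.one_le_inv, ← ofReal_norm]
  exact ENNReal.ofReal_le_one.2 hz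

lemma kap_le_one {z : R4} (hz : 1 ≤ ‖z‖) : kap z ≤ 1 := by
  rw [kap, ENNReal.inv_le_one, ← ofReal_norm]
  exact ENNReal.one_le_ofReal.2 hz

lemma om_eq_ofReal (y : R4) : om y = ENNReal.ofReal ((1 + ‖y‖)⁻¹) := by
  rw [om, ENNReal.ofReal_inv_of_pos (by positivity),
    ENNReal.ofReal_add zero_le_one (norm_nonneg _), ofReal_norm, ENNReal.ofReal_one]

lemma om_rpow_eq_ofReal (y : R4) (s : ℝ) : om y ^ s = ENNReal.ofReal ((1 + ‖y‖) ^ (-s)) := by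
  rw [om_eq_ofReal, ENNReal.ofReal_rpow_of_pos (by positivity), Real.inv_rpow (by positivity),
    Real.rpow_neg (by positivity)]

lemma lintegral_om_lt_top {s : ℝ} (hs : 4 < s) : ∫⁻ y, om y ^ s < ∞ := by
  simp only [om_rpow_eq_ofReal]
  exact finite_integral_one_add_norm (by simpa using hs)

lemma kap_le_om {z : R4} (hz : 1 ≤ ‖z‖) : kap z ≤ 2 * om z := by
  have hz0 : 0 < ‖z‖ := by linarith
  rw [kap, om_eq_ofReal, ← ofReal_norm, ← ENNReal.ofReal_inv_of_pos hz0]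
  calc ENNReal.ofReal ‖z‖⁻¹ ≤ ENNReal.ofReal (2 * (1 + ‖z‖)⁻¹) := by
        refine ENNReal.ofReal_le_ofReal ?_
        rw [← div_eq_mul_inv, inv_eq_one_div, div_le_div_iff₀ hz0 (by positivity)]
        linarith
    _ = 2 * ENNReal.ofReal (1 + ‖z‖)⁻¹ := by
        rw [ENNReal.ofReal_mul (by simp), ENNReal.ofReal_ofNat]

lemma setLIntegral_kap_far_lt_top {s : ℝ} (hs : 4 < s) :
    ∫⁻ z in (ball (0 : R4) 1)ᶜ, kap z ^ s < ∞ := by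
  calc ∫⁻ z in (ball (0 : R4) 1)ᶜ, kap z ^ s
      ≤ ∫⁻ z in (ball (0 : R4) 1)ᶜ, 2 ^ s * om z ^ s := by
        refine setLIntegral_mono' measurableSet_ball.compl fun z hz => ?_
        rw [← ENNReal.mul_rpow_of_nonneg _ _ (by linarith)]
        refine ENNReal.rpow_le_rpow (kap_le_om (by simpa using hz)) (by linarith)
    _ ≤ ∫⁻ z, 2 ^ s * om z ^ s := setLIntegral_le_lintegral _ _
    _ = 2 ^ s * ∫⁻ z, om z ^ s := lintegral_const_mul _ (by fun_prop)
    _ < ∞ := ENNReal.mul_lt_top (ENNReal.rpow_lt_top_of_nonneg (by linarith) (by simp))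
        (lintegral_om_lt_top hs)

/-- In polar coordinates the density r³ cancels the singularity r⁻³, leaving the integral of 1 over
(0, 1). -/
lemma setLIntegral_kap_three_lt_top : ∫⁻ z in ball (0 : R4) 1, kap z ^ 3 < ∞ := by
  have h : IntegrableOn (fun z : R4 => (‖z‖⁻¹) ^ 3) (ball (0 : R4) 1) volume := by
    rw [← integrable_indicator_iff measurableSet_ball]
    have := (integrable_fun_norm_addHaar (volume : Measure R4)
      (f := (Set.Iio (1 : ℝ)).indicator (fun r => r⁻¹ ^ 3))).2 ?_
    · refine this.congr (Filter.Eventually.of_forall fun z => ?_)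
      simp [Set.indicator]
    · have h1 : IntegrableOn ((Set.Ioo (0 : ℝ) 1).indicator fun _ => (1 : ℝ)) (Set.Ioi 0) := by
        refine Integrable.integrableOn ?_
        rw [integrable_indicator_iff measurableSet_Ioo]
        exact integrableOn_const (by simp)
      refine h1.congr_fun (fun r hr => ?_) measurableSet_Ioi
      have hr' : (0 : ℝ) < r := hr
      by_cases h : r < 1
      · have : r ^ 3 * (r ^ 3)⁻¹ = 1 := mul_inv_cancel₀ (by positivity)
        simp [Set.indicator, h, hr', this]
      · simp [Set.indicator, h]
  have h2 := h.2
  rw [hasFiniteIntegral_iff_enorm] at h2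
  refine lt_of_eq_of_lt ?_ h2
  refine lintegral_congr_ae ?_
  -- The real inverse is 0 at the origin whereas `kap` is ∞ there, so the integrands agree only off
  -- a null set.
  have : ∀ᵐ z ∂(volume.restrict (ball (0 : R4) 1)), z ≠ 0 :=
    ae_restrict_of_ae (by simp [ae_iff])
  filter_upwards [this] with z hz
  rw [enorm_pow, enorm_inv (by simpa using hz), enorm_norm, kap]

lemma lintegral_smul_scale {r : ℝ} (hr : 0 < r) {F : R4 → ℝ≥0∞} (hF : Measurable F) :
    ∫⁻ z, F z = ENNReal.ofReal (r ^ 4) * ∫⁻ z, F (r • z) := by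
  have h := Measure.map_addHaar_smul (volume : Measure R4) hr.ne'
  have h2 : ∫⁻ z, F (r • z) = ENNReal.ofReal ((r ^ 4)⁻¹) * ∫⁻ z, F z := by
    rw [← lintegral_map (g := fun z : R4 => r • z) hF (by fun_prop), h, lintegral_smul_measure]
    simp [abs_of_pos hr]
  rw [h2, ← mul_assoc, ← ENNReal.ofReal_mul (by positivity), mul_inv_cancel₀ (by positivity)]
  simp

lemma kap_smul {r : ℝ} (hr : 0 < r) (z : R4) : kap (r • z) = ENNReal.ofReal r⁻¹ * kap z := by
  rw [kap, kap, enorm_smul, ENNReal.mul_inv (by simp) (by simp), ENNReal.ofReal_inv_of_pos hr,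
    Real.enorm_of_nonneg hr.le]

/-- A dilation reduces to the unit ball, whose integral is the constant. It is finite because `kap ≥
1` there, so the cubic singularity dominates. -/
lemma exists_setLIntegral_kap_near {a : ℕ} (ha : a ≤ 3) :
    ∃ C : ℝ≥0∞, C ≠ ∞ ∧ ∀ r : ℝ, 0 < r →
      ∫⁻ z in ball (0 : R4) r, kap z ^ a ≤ C * ENNReal.ofReal (r ^ (4 - a)) := by
  refine ⟨∫⁻ z in ball (0 : R4) 1, kap z ^ a, ?_, fun r hr => ?_⟩
  · refine (lt_of_le_of_lt ?_ setLIntegral_kap_three_lt_top).ne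
    refine setLIntegral_mono' measurableSet_ball fun z hz => ?_
    exact pow_le_pow_right₀ (one_le_kap (by simpa using (mem_ball_zero_iff.1 hz).le)) ha
  · rw [← lintegral_indicator measurableSet_ball, ← lintegral_indicator measurableSet_ball,
      lintegral_smul_scale hr ((by fun_prop : Measurable fun z => kap z ^ a).indicator
        measurableSet_ball)]
    have : ∀ z : R4, (ball (0 : R4) r).indicator (fun z => kap z ^ a) (r • z) =
        ENNReal.ofReal (r⁻¹ ^ a) * (ball (0 : R4) 1).indicator (fun z => kap z ^ a) z := by
      intro z
      have : r • z ∈ ball (0 : R4) r ↔ z ∈ ball (0 : R4) 1 := by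
        simp only [mem_ball_zero_iff, norm_smul, Real.norm_eq_abs, abs_of_pos hr]
        constructor <;> intro h <;> nlinarith
      by_cases h : z ∈ ball (0 : R4) 1
      · rw [Set.indicator_of_mem (this.2 h), Set.indicator_of_mem h, kap_smul hr, mul_pow,
          ENNReal.ofReal_pow (by positivity)]
      · rw [Set.indicator_of_notMem (mt this.1 h), Set.indicator_of_notMem h, mul_zero]
    simp only [this]
    rw [lintegral_const_mul _ ((by fun_prop : Measurable fun z => kap z ^ a).indicator
        measurableSet_ball), ← mul_assoc, ← ENNReal.ofReal_mul (by positivity), mul_comm]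
    refine le_of_eq ?_
    congr 2
    rw [inv_pow, pow_sub₀ _ hr.ne' (by omega)]

/-- The same dilation outside the ball; exponents above the dimension 4 are summable at infinity. -/
lemma exists_setLIntegral_kap_far {p : ℕ} (hp : 5 ≤ p) :
    ∃ C : ℝ≥0∞, C ≠ ∞ ∧ ∀ r : ℝ, 0 < r →
      ∫⁻ z in (ball (0 : R4) r)ᶜ, kap z ^ p ≤ C * ENNReal.ofReal (r⁻¹ ^ (p - 4)) := by
  refine ⟨∫⁻ z in (ball (0 : R4) 1)ᶜ, kap z ^ p, ?_, fun r hr => ?_⟩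
  · have := setLIntegral_kap_far_lt_top (s := p) (by exact_mod_cast (by omega : 4 < p))
    simpa only [ENNReal.rpow_natCast] using this.ne
  · rw [← lintegral_indicator measurableSet_ball.compl, ← lintegral_indicator
      measurableSet_ball.compl,
      lintegral_smul_scale hr ((by fun_prop : Measurable fun z => kap z ^ p).indicator
        measurableSet_ball.compl)]
    have : ∀ z : R4, (ball (0 : R4) r)ᶜ.indicator (fun z => kap z ^ p) (r • z) =
        ENNReal.ofReal (r⁻¹ ^ p) * (ball (0 : R4) 1)ᶜ.indicator (fun z => kap z ^ p) z := by
      intro z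
      have : r • z ∈ ball (0 : R4) r ↔ z ∈ ball (0 : R4) 1 := by
        simp only [mem_ball_zero_iff, norm_smul, Real.norm_eq_abs, abs_of_pos hr]
        constructor <;> intro h <;> nlinarith
      by_cases h : z ∈ ball (0 : R4) 1
      · rw [Set.indicator_of_notMem (by simpa using this.2 h),
          Set.indicator_of_notMem (by simpa using h), mul_zero]
      · rw [Set.indicator_of_mem (mt this.1 h), Set.indicator_of_mem h, kap_smul hr, mul_pow,
          ENNReal.ofReal_pow (by positivity)]
    simp only [this]
    rw [lintegral_const_mul _ ((by fun_prop : Measurable fun z => kap z ^ p).indicator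
        measurableSet_ball.compl), ← mul_assoc, ← ENNReal.ofReal_mul (by positivity), mul_comm]
    refine le_of_eq ?_
    congr 2
    rw [inv_pow, inv_pow, pow_sub₀ _ hr.ne' (by omega), mul_inv, inv_inv, mul_comm]

end Dirac4

end

/-! ### Weighted kernel integrals and composition of singular kernels. -/

noncomputable section

namespace Dirac4
open scoped ENNReal NNReal
open Metric

lemma ennreal_mul_le_sq_add_sq (a b : ℝ≥0∞) : a * b ≤ a ^ 2 + b ^ 2 := by
  rcases le_total a b with h | h
  · calc a * b ≤ b * b := by gcongr
      _ = b ^ 2 := (sq b).symm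
      _ ≤ _ := le_add_self
  · calc a * b ≤ a * a := by gcongr
      _ = a ^ 2 := (sq a).symm
      _ ≤ _ := le_self_add

/-- The larger base absorbs the other. This replaces Hölder's inequality below: a product of a power
of x - y and a power of y splits into two terms, each integrable by translation invariance. -/
lemma ennreal_rpow_mul_rpow_le (a b : ℝ≥0∞) {p q : ℝ} (hp : 0 ≤ p) (hq : 0 ≤ q) :
    a ^ p * b ^ q ≤ a ^ (p + q) + b ^ (p + q) := by
  rcases le_total a b with h | h
  · calc a ^ p * b ^ q ≤ b ^ p * b ^ q := by gcongr
      _ = b ^ (p + q) := (ENNReal.rpow_add_of_nonneg _ _ hp hq).symm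
      _ ≤ _ := le_add_self
  · calc a ^ p * b ^ q ≤ a ^ p * a ^ q := by gcongr
      _ = a ^ (p + q) := (ENNReal.rpow_add_of_nonneg _ _ hp hq).symm
      _ ≤ _ := le_self_add

/-- The singular part `1_{|z| < 1} |z|⁻³`. -/
def kapNear (z : R4) : ℝ≥0∞ := (ball (0 : R4) 1).indicator (fun z => kap z ^ 3) z

/-- The tail `1_{|z| ≥ 1} |z|^{-t}`. -/
def kapFar (t : ℝ) (z : R4) : ℝ≥0∞ := (ball (0 : R4) 1)ᶜ.indicator (fun z => kap z ^ t) z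

@[fun_prop] lemma measurable_kapNear : Measurable kapNear :=
  (by fun_prop : Measurable fun z => kap z ^ 3).indicator measurableSet_ball

@[fun_prop] lemma measurable_kapFar (t : ℝ) : Measurable (kapFar t) :=
  (by fun_prop : Measurable fun z => kap z ^ t).indicator measurableSet_ball.compl

lemma lintegral_kapNear_lt_top : ∫⁻ z, kapNear z < ∞ := by
  unfold kapNear
  rw [lintegral_indicator measurableSet_ball]
  exact setLIntegral_kap_three_lt_top

lemma lintegral_kapFar_lt_top {t : ℝ} (ht : 4 < t) : ∫⁻ z, kapFar t z < ∞ := by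
  unfold kapFar
  rw [lintegral_indicator measurableSet_ball.compl]
  exact setLIntegral_kap_far_lt_top ht

lemma kerMaj_le_of_near {z : R4} (hz : ‖z‖ < 1) : kerMaj z ≤ 2 * kapNear z := by
  have h1 := one_le_kap hz.le
  rw [kapNear, Set.indicator_of_mem (by simpa using hz), kerMaj, two_mul]
  gcongr
  norm_num

lemma kerMaj_le_of_far {z : R4} (hz : 1 ≤ ‖z‖) : kerMaj z ≤ 2 * kap z ^ 2 := by
  rw [kerMaj, two_mul]
  gcongr ?_ + _
  exact pow_le_pow_of_le_one zero_le (kap_le_one hz) (by norm_num)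

lemma kapFar_of_far {z : R4} (hz : 1 ≤ ‖z‖) (t : ℝ) : kapFar t z = kap z ^ t := by
  rw [kapFar, Set.indicator_of_mem (by simpa using hz)]

lemma om_rpow_le_one (y : R4) {s : ℝ} (hs : 0 ≤ s) : om y ^ s ≤ 1 :=
  ENNReal.rpow_le_one (om_le_one y) hs

/-- Near the diagonal the weight is at most 1; away from it the kernel is of order -2 and the two
powers combine to 2 + s, which exceeds the dimension as soon as s > 2. -/
lemma kerMaj_mul_om_le {s : ℝ} (hs : 0 ≤ s) (z y : R4) :
    kerMaj z * om y ^ s ≤ 2 * kapNear z + 2 * (kapFar (2 + s) z + om y ^ (2 + s)) := by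
  rcases lt_or_ge ‖z‖ 1 with hz | hz
  · calc kerMaj z * om y ^ s ≤ 2 * kapNear z * 1 := by
          gcongr
          · exact kerMaj_le_of_near hz
          · exact om_rpow_le_one y hs
      _ ≤ _ := by rw [mul_one]; exact le_self_add
  · calc kerMaj z * om y ^ s ≤ 2 * kap z ^ (2 : ℝ) * om y ^ s := by
          gcongr
          simpa using kerMaj_le_of_far hz
      _ ≤ 2 * (kapFar (2 + s) z + om y ^ (2 + s)) := by
          rw [mul_assoc, kapFar_of_far hz]
          gcongr
          exact ennreal_rpow_mul_rpow_le _ _ (by norm_num) hs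
      _ ≤ _ := le_add_self

lemma exists_lintegral_kerMaj_mul_om_le {s : ℝ} (hs : 2 < s) :
    ∃ M : ℝ≥0∞, M ≠ ∞ ∧ ∀ x, ∫⁻ y, kerMaj (x - y) * om y ^ s ≤ M := by
  refine ⟨2 * (∫⁻ z, kapNear z) + 2 * ((∫⁻ z, kapFar (2 + s) z) + ∫⁻ y, om y ^ (2 + s)),
    ?_, fun x => ?_⟩
  · have h1 := lintegral_kapNear_lt_top
    have h2 := lintegral_kapFar_lt_top (t := 2 + s) (by linarith)
    have h3 := lintegral_om_lt_top (s := 2 + s) (by linarith)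
    finiteness
  · calc ∫⁻ y, kerMaj (x - y) * om y ^ s
        ≤ ∫⁻ y, (2 * kapNear (x - y) + 2 * (kapFar (2 + s) (x - y) + om y ^ (2 + s))) :=
          lintegral_mono fun y => kerMaj_mul_om_le (by linarith) _ _
      _ = _ := by
          rw [lintegral_add_left (by fun_prop), lintegral_const_mul _ (by fun_prop),
            lintegral_const_mul _ (by fun_prop), lintegral_add_left (by fun_prop),
            lintegral_sub_left_eq_self kapNear, lintegral_sub_left_eq_self (kapFar (2 + s))]

lemma one_add_enorm_mul_om (y : R4) : (1 + ‖y‖ₑ) * om y = 1 :=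
  ENNReal.mul_inv_cancel (by simp) (by simp)

lemma sq_one_add_enorm_mul_om_rpow (y : R4) (t : ℝ) :
    (1 + ‖y‖ₑ) ^ 2 * om y ^ t = om y ^ (t - 2) := by
  have : om y ^ t = om y ^ (2 : ℝ) * om y ^ (t - 2) := by
    rw [← ENNReal.rpow_add _ _ (om_ne_zero y) (om_ne_top y)]; congr 1; ring
  rw [this, ← mul_assoc, ENNReal.rpow_ofNat, ← mul_pow, one_add_enorm_mul_om, one_pow, one_mul]

lemma enorm_mul_kap_le_one (z : R4) : ‖z‖ₑ * kap z ≤ 1 := ENNReal.mul_inv_le_one _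

/-- By the triangle inequality 1 + |x| ≤ (1 + |y|) + |x - y|. The first term costs two powers of `om
y`; the second is cancelled by the factor |x - y|⁻² of the kernel away from the diagonal. -/
lemma sq_mul_kerMaj_mul_om_le {t : ℝ} (ht : 4 < t) (x y : R4) :
    (1 + ‖x‖ₑ) ^ 2 * (kerMaj (x - y) * om y ^ t) ≤
      8 * kapNear (x - y) + 8 * (kapFar t (x - y) + om y ^ t) + 8 * om y ^ t := by
  set z := x - y with hz_def
  have hX : 1 + ‖x‖ₑ ≤ (1 + ‖y‖ₑ) + ‖z‖ₑ := by
    rw [add_assoc]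
    gcongr
    calc ‖x‖ₑ = ‖y + z‖ₑ := by rw [hz_def]; congr 1; abel
      _ ≤ _ := enorm_add_le _ _
  rcases lt_or_ge ‖z‖ 1 with hz | hz
  · have hz1 : ‖z‖ₑ ≤ 1 := by
      rw [← ofReal_norm]; exact ENNReal.ofReal_le_one.2 hz.le
    have hX2 : 1 + ‖x‖ₑ ≤ 2 * (1 + ‖y‖ₑ) := by
      refine hX.trans ?_
      rw [two_mul]
      gcongr
      exact hz1.trans le_self_add
    calc (1 + ‖x‖ₑ) ^ 2 * (kerMaj z * om y ^ t)
        ≤ (2 * (1 + ‖y‖ₑ)) ^ 2 * ((2 * kapNear z) * om y ^ t) := by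
          gcongr
          exact kerMaj_le_of_near hz
      _ = 8 * kapNear z * ((1 + ‖y‖ₑ) ^ 2 * om y ^ t) := by ring
      _ ≤ 8 * kapNear z * 1 := by
          gcongr
          rw [sq_one_add_enorm_mul_om_rpow]
          exact om_rpow_le_one y (by linarith)
      _ ≤ _ := by rw [mul_one, add_assoc]; exact le_self_add
  · have hsq : (1 + ‖x‖ₑ) ^ 2 ≤ 4 * (1 + ‖y‖ₑ) ^ 2 + 4 * ‖z‖ₑ ^ 2 := by
      calc (1 + ‖x‖ₑ) ^ 2 ≤ ((1 + ‖y‖ₑ) + ‖z‖ₑ) ^ 2 := by gcongr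
        _ = (1 + ‖y‖ₑ) ^ 2 + ‖z‖ₑ ^ 2 + 2 * ((1 + ‖y‖ₑ) * ‖z‖ₑ) := by ring
        _ ≤ (1 + ‖y‖ₑ) ^ 2 + ‖z‖ₑ ^ 2 + 2 * ((1 + ‖y‖ₑ) ^ 2 + ‖z‖ₑ ^ 2) := by
            gcongr; exact ennreal_mul_le_sq_add_sq _ _
        _ = 3 * (1 + ‖y‖ₑ) ^ 2 + 3 * ‖z‖ₑ ^ 2 := by ring
        _ ≤ _ := by gcongr <;> norm_num
    calc (1 + ‖x‖ₑ) ^ 2 * (kerMaj z * om y ^ t)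
        ≤ (4 * (1 + ‖y‖ₑ) ^ 2 + 4 * ‖z‖ₑ ^ 2) * ((2 * kap z ^ 2) * om y ^ t) := by
          gcongr
          exact kerMaj_le_of_far hz
      _ = 8 * (kap z ^ 2 * ((1 + ‖y‖ₑ) ^ 2 * om y ^ t)) + 8 * ((‖z‖ₑ * kap z) ^ 2 * om y ^ t) := by
          ring
      _ ≤ 8 * (kapFar t z + om y ^ t) + 8 * (1 ^ 2 * om y ^ t) := by
          gcongr
          · rw [sq_one_add_enorm_mul_om_rpow, kapFar_of_far hz]
            have := ennreal_rpow_mul_rpow_le (kap z) (om y) (p := 2) (q := t - 2) (by norm_num)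
              (by linarith)
            simpa using this
          · exact enorm_mul_kap_le_one z
      _ ≤ _ := by rw [one_pow, one_mul, add_assoc]; exact le_add_self

lemma exists_lintegral_kerMaj_mul_om_le_sq {t : ℝ} (ht : 4 < t) :
    ∃ M : ℝ≥0∞, M ≠ ∞ ∧ ∀ x, ∫⁻ y, kerMaj (x - y) * om y ^ t ≤ M * om x ^ 2 := by
  refine ⟨8 * (∫⁻ z, kapNear z) + 8 * ((∫⁻ z, kapFar t z) + ∫⁻ y, om y ^ t)
    + 8 * ∫⁻ y, om y ^ t, ?_, fun x => ?_⟩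
  · have h1 := lintegral_kapNear_lt_top
    have h2 := lintegral_kapFar_lt_top ht
    have h3 := lintegral_om_lt_top ht
    finiteness
  · rw [om, ← ENNReal.inv_pow, ← div_eq_mul_inv, ENNReal.le_div_iff_mul_le (by simp) (by simp),
      mul_comm, ← lintegral_const_mul _ (by fun_prop)]
    calc _ ≤ ∫⁻ y, (8 * kapNear (x - y) + 8 * (kapFar t (x - y) + om y ^ t) + 8 * om y ^ t) :=
          lintegral_mono fun y => sq_mul_kerMaj_mul_om_le ht _ _
      _ = _ := by
          rw [lintegral_add_left (by fun_prop), lintegral_add_left (by fun_prop),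
            lintegral_const_mul _ (by fun_prop), lintegral_const_mul _ (by fun_prop),
            lintegral_const_mul _ (by fun_prop), lintegral_add_left (by fun_prop),
            lintegral_sub_left_eq_self kapNear, lintegral_sub_left_eq_self (kapFar t)]

lemma kap_le_ofReal_inv {r : ℝ} (hr : 0 < r) {z : R4} (hz : r ≤ ‖z‖) :
    kap z ≤ ENNReal.ofReal r⁻¹ := by
  rw [kap, ENNReal.ofReal_inv_of_pos hr, ENNReal.inv_le_inv, ← ofReal_norm]
  exact ENNReal.ofReal_le_ofReal hz

/-- Orders of convolved homogeneous kernels add up to a + 3 - 4 = a - 1. Space is cut into a ball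
around x, a ball around z, and the rest, where the two factors merge into powers a + 3 that converge
at infinity. -/
lemma exists_lintegral_kap_comp_le {a : ℕ} (ha : 2 ≤ a) (ha3 : a ≤ 3) :
    ∃ C : ℝ≥0∞, C ≠ ∞ ∧ ∀ x z : R4,
      ∫⁻ y, kap (x - y) ^ a * kap (y - z) ^ 3 ≤ C * kap (x - z) ^ (a - 1) := by
  obtain ⟨C₁, hC₁, h₁⟩ := exists_setLIntegral_kap_near ha3
  obtain ⟨C₂, hC₂, h₂⟩ := exists_setLIntegral_kap_near (le_refl 3)
  obtain ⟨C₃, hC₃, h₃⟩ := exists_setLIntegral_kap_far (p := a + 3) (by omega)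
  -- The power of 2 comes from taking r to be half the distance. The added 1 keeps the constant
  -- nonzero, so that for x = z the right side is ∞ rather than 0 · ∞.
  refine ⟨(C₁ + C₂ + 2 * C₃) * 2 ^ (a - 1) + 1, by finiteness, fun x z => ?_⟩
  rcases eq_or_ne x z with rfl | hxz
  · have : kap (x - x) ^ (a - 1) = ∞ := by
      simp only [kap, sub_self, enorm_zero, ENNReal.inv_zero]
      exact ENNReal.top_pow (by omega)
    rw [this, ENNReal.mul_top (by simp)]
    exact le_top
  -- With half the distance, a point within r of one centre is at least r away from the other.
  set r := ‖x - z‖ / 2 with hr_def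
  have hd : 0 < ‖x - z‖ := norm_pos_iff.2 (sub_ne_zero.2 hxz)
  have hr : 0 < r := by positivity
  set ρ := ENNReal.ofReal r⁻¹ with hρ
  set N₁ : R4 → ℝ≥0∞ := (ball (0 : R4) r).indicator fun w => kap w ^ a with hN₁
  set N₂ : R4 → ℝ≥0∞ := (ball (0 : R4) r).indicator fun w => kap w ^ 3 with hN₂
  set F : R4 → ℝ≥0∞ := (ball (0 : R4) r)ᶜ.indicator fun w => kap w ^ (a + 3) with hF
  have mN₁ : Measurable N₁ :=
    (by fun_prop : Measurable fun w => kap w ^ a).indicator measurableSet_ball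
  have mN₂ : Measurable N₂ :=
    (by fun_prop : Measurable fun w => kap w ^ 3).indicator measurableSet_ball
  have mF : Measurable F :=
    (by fun_prop : Measurable fun w => kap w ^ (a + 3)).indicator measurableSet_ball.compl
  have iN₁ : ∫⁻ w, N₁ w ≤ C₁ * ENNReal.ofReal (r ^ (4 - a)) := by
    rw [hN₁, lintegral_indicator measurableSet_ball]; exact h₁ r hr
  have iN₂ : ∫⁻ w, N₂ w ≤ C₂ * ENNReal.ofReal (r ^ (4 - 3)) := by
    rw [hN₂, lintegral_indicator measurableSet_ball]; exact h₂ r hr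
  have iF : ∫⁻ w, F w ≤ C₃ * ENNReal.ofReal (r⁻¹ ^ (a + 3 - 4)) := by
    rw [hF, lintegral_indicator measurableSet_ball.compl]; exact h₃ r hr
  have key : ∀ y, kap (x - y) ^ a * kap (y - z) ^ 3 ≤
      N₁ (x - y) * ρ ^ 3 + N₂ (y - z) * ρ ^ a + (F (x - y) + F (y - z)) := by
    intro y
    have tri : ‖x - z‖ ≤ ‖x - y‖ + ‖y - z‖ := norm_sub_le_norm_sub_add_norm_sub _ _ _
    by_cases c1 : ‖x - y‖ < r
    · have : N₁ (x - y) = kap (x - y) ^ a := Set.indicator_of_mem (by simpa using c1) _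
      rw [this, add_assoc]
      refine le_trans ?_ le_self_add
      gcongr
      exact kap_le_ofReal_inv hr (by linarith)
    · by_cases c2 : ‖y - z‖ < r
      · have : N₂ (y - z) = kap (y - z) ^ 3 := Set.indicator_of_mem (by simpa using c2) _
        rw [this, mul_comm]
        refine le_trans ?_ (le_add_right le_add_self)
        gcongr
        exact kap_le_ofReal_inv hr (by linarith)
      · have e1 : F (x - y) = kap (x - y) ^ (a + 3) := Set.indicator_of_mem (by simpa using c1) _
        have e2 : F (y - z) = kap (y - z) ^ (a + 3) := Set.indicator_of_mem (by simpa using c2) _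
        rw [e1, e2]
        refine le_trans ?_ le_add_self
        have := ennreal_rpow_mul_rpow_le (kap (x - y)) (kap (y - z)) (p := a) (q := (3 : ℕ))
          (by positivity) (by positivity)
        rw [← Nat.cast_add] at this
        simpa only [ENNReal.rpow_natCast] using this
  have e1 : ENNReal.ofReal (r ^ (4 - a)) * ρ ^ 3 = ρ ^ (a - 1) := by
    rw [hρ, ← ENNReal.ofReal_pow (by positivity), ← ENNReal.ofReal_pow (by positivity),
      ← ENNReal.ofReal_mul (by positivity)]
    congr 1
    obtain rfl | rfl : a = 2 ∨ a = 3 := by omega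
    all_goals norm_num; field_simp
  have e2 : ENNReal.ofReal (r ^ (4 - 3)) * ρ ^ a = ρ ^ (a - 1) := by
    rw [hρ, ← ENNReal.ofReal_pow (by positivity), ← ENNReal.ofReal_pow (by positivity),
      ← ENNReal.ofReal_mul (by positivity)]
    congr 1
    obtain rfl | rfl : a = 2 ∨ a = 3 := by omega
    all_goals norm_num; field_simp
  have e3 : ENNReal.ofReal (r⁻¹ ^ (a + 3 - 4)) = ρ ^ (a - 1) := by
    rw [hρ, ← ENNReal.ofReal_pow (by positivity)]
    congr 1
  have e4 : ρ = 2 * kap (x - z) := by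
    rw [hρ, hr_def, inv_div, kap, ← ofReal_norm, ENNReal.ofReal_div_of_pos hd,
      ENNReal.ofReal_ofNat, div_eq_mul_inv]
  calc ∫⁻ y, kap (x - y) ^ a * kap (y - z) ^ 3
      ≤ ∫⁻ y, (N₁ (x - y) * ρ ^ 3 + N₂ (y - z) * ρ ^ a + (F (x - y) + F (y - z))) :=
        lintegral_mono key
    _ = (∫⁻ w, N₁ w) * ρ ^ 3 + (∫⁻ w, N₂ w) * ρ ^ a + ((∫⁻ w, F w) + ∫⁻ w, F w) := by
        rw [lintegral_add_left (by fun_prop), lintegral_add_left (by fun_prop),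
          lintegral_mul_const _ (by fun_prop), lintegral_mul_const _ (by fun_prop),
          lintegral_add_left (by fun_prop), lintegral_sub_left_eq_self N₁,
          lintegral_sub_left_eq_self F, lintegral_sub_right_eq_self N₂,
          lintegral_sub_right_eq_self F]
    _ ≤ C₁ * ENNReal.ofReal (r ^ (4 - a)) * ρ ^ 3 + C₂ * ENNReal.ofReal (r ^ (4 - 3)) * ρ ^ a
        + (C₃ * ENNReal.ofReal (r⁻¹ ^ (a + 3 - 4)) + C₃ * ENNReal.ofReal (r⁻¹ ^ (a + 3 - 4))) := by
        gcongr
    _ = (C₁ + C₂ + 2 * C₃) * 2 ^ (a - 1) * kap (x - z) ^ (a - 1) := by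
        rw [mul_assoc, mul_assoc, e1, e2, e3, e4, mul_pow]
        ring
    _ ≤ _ := by gcongr; exact le_self_add

end Dirac4

end

/-! ### Potentials: bootstrap, Schur's test, local integrability. -/

noncomputable section

namespace Dirac4
open scoped ENNReal NNReal
open Metric

lemma kerMaj_le (z : R4) : kerMaj z ≤ 2 * kap z ^ 3 + 2 := by
  rcases lt_or_ge ‖z‖ 1 with hz | hz
  · refine (kerMaj_le_of_near hz).trans ?_
    rw [kapNear, Set.indicator_of_mem (by simpa using hz)]
    exact le_self_add
  · refine (kerMaj_le_of_far hz).trans ?_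
    calc 2 * kap z ^ 2 ≤ 2 * 1 := by gcongr; exact pow_le_one₀ zero_le (kap_le_one hz)
      _ ≤ _ := by rw [mul_one]; exact le_add_self

/-- The Riesz-type potential `∫ |x-y|^{-a} h(y) dy`. -/
def riesz (a : ℕ) (h : R4 → ℝ≥0∞) (x : R4) : ℝ≥0∞ := ∫⁻ y, kap (x - y) ^ a * h y

/-- The potential `∫ (|x-y|⁻³ + |x-y|⁻²) h(y) dy`. -/
def majPot (h : R4 → ℝ≥0∞) (x : R4) : ℝ≥0∞ := ∫⁻ y, kerMaj (x - y) * h y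

lemma measurable_riesz (a : ℕ) {h : R4 → ℝ≥0∞} (hh : Measurable h) : Measurable (riesz a h) :=
  Measurable.lintegral_prod_right' (f := fun p : R4 × R4 => kap (p.1 - p.2) ^ a * h p.2)
    (by fun_prop)

lemma measurable_majPot {h : R4 → ℝ≥0∞} (hh : Measurable h) : Measurable (majPot h) :=
  Measurable.lintegral_prod_right' (f := fun p : R4 × R4 => kerMaj (p.1 - p.2) * h p.2)
    (by fun_prop)

lemma majPot_congr {h h' : R4 → ℝ≥0∞} (e : h =ᵐ[volume] h') : majPot h = majPot h' := by
  funext x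
  refine lintegral_congr_ae ?_
  filter_upwards [e] with y hy
  rw [hy]

lemma majPot_le (h : R4 → ℝ≥0∞) (hh : Measurable h) (x : R4) :
    majPot h x ≤ 2 * riesz 3 h x + 2 * ∫⁻ y, h y := by
  unfold majPot riesz
  rw [← lintegral_const_mul _ (by fun_prop), ← lintegral_const_mul _ hh,
    ← lintegral_add_left (by fun_prop)]
  refine lintegral_mono fun y => ?_
  calc kerMaj (x - y) * h y ≤ (2 * kap (x - y) ^ 3 + 2) * h y := by gcongr; exact kerMaj_le _
    _ = _ := by ring

/-- In the unit ball around x the product is at most the sum of squares, and |z|⁻² is locally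
integrable on ℝ⁴; outside, the kernel is at most 1. The bound is uniform in x, which is where the
bootstrap ends. -/
lemma riesz_one_le (h : R4 → ℝ≥0∞) (hh : Measurable h) (x : R4) :
    riesz 1 h x ≤ (∫⁻ z in ball (0 : R4) 1, kap z ^ 2) + (∫⁻ y, h y ^ 2) + ∫⁻ y, h y := by
  set N : R4 → ℝ≥0∞ := (ball (0 : R4) 1).indicator fun z => kap z ^ 2 with hN
  have mN : Measurable N :=
    (by fun_prop : Measurable fun w => kap w ^ 2).indicator measurableSet_ball
  rw [← lintegral_indicator measurableSet_ball, ← hN, ← lintegral_sub_left_eq_self N x,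
    ← lintegral_add_left (by fun_prop), ← lintegral_add_left (by fun_prop)]
  refine lintegral_mono fun y => ?_
  simp only [pow_one]
  rcases lt_or_ge ‖x - y‖ 1 with hz | hz
  · refine le_trans ?_ le_self_add
    rw [hN, Set.indicator_of_mem (by simpa using hz)]
    exact ennreal_mul_le_sq_add_sq _ _
  · refine le_trans ?_ le_add_self
    calc kap (x - y) * h y ≤ 1 * h y := by gcongr; exact kap_le_one hz
      _ = h y := one_mul _

/-- Tonelli's theorem turns the iterated potential into one with the composed kernel of
`exists_lintegral_kap_comp_le`. -/
lemma riesz_riesz_le {a : ℕ} (ha : 2 ≤ a) (ha3 : a ≤ 3) :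
    ∃ C : ℝ≥0∞, C ≠ ∞ ∧ ∀ h : R4 → ℝ≥0∞, Measurable h → ∀ x,
      riesz a (riesz 3 h) x ≤ C * riesz (a - 1) h x := by
  obtain ⟨C, hC, hle⟩ := exists_lintegral_kap_comp_le ha ha3
  refine ⟨C, hC, fun h hh x => ?_⟩
  calc riesz a (riesz 3 h) x
      = ∫⁻ y, ∫⁻ z, kap (x - y) ^ a * (kap (y - z) ^ 3 * h z) := by
        refine lintegral_congr fun y => ?_
        rw [riesz, lintegral_const_mul _ (by fun_prop)]
    _ = ∫⁻ z, ∫⁻ y, kap (x - y) ^ a * (kap (y - z) ^ 3 * h z) :=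
        lintegral_lintegral_swap (by fun_prop)
    _ = ∫⁻ z, (∫⁻ y, kap (x - y) ^ a * kap (y - z) ^ 3) * h z := by
        refine lintegral_congr fun z => ?_
        rw [← lintegral_mul_const _ (by fun_prop)]
        simp only [mul_assoc]
    _ ≤ ∫⁻ z, C * (kap (x - z) ^ (a - 1) * h z) := by
        refine lintegral_mono fun z => ?_
        rw [← mul_assoc]
        gcongr
        exact hle x z
    _ = _ := lintegral_const_mul _ (by fun_prop)

lemma kap_pow_le_kerMaj {a : ℕ} (ha : 2 ≤ a) (ha3 : a ≤ 3) (z : R4) : kap z ^ a ≤ kerMaj z := by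
  obtain rfl | rfl : a = 2 ∨ a = 3 := by omega
  · exact le_add_self
  · exact le_self_add

/-- Pointwise decay by bootstrapping: a function dominated by its own weighted potential, with
integrable and square integrable source, is bounded and decays like `|x|⁻²`. -/
theorem exists_le_om_sq_of_le_majPot {g h : R4 → ℝ≥0∞} (hh : Measurable h) {C : ℝ≥0∞}
    (hC : C ≠ ∞) {t : ℝ} (ht : 4 < t) (hg : ∀ᵐ x, g x ≤ C * majPot h x)
    (hhg : ∀ᵐ y, h y ≤ C * (om y ^ t * g y))
    (h1 : ∫⁻ y, h y ≠ ∞) (h2 : ∫⁻ y, h y ^ 2 ≠ ∞) :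
    ∃ C' : ℝ≥0∞, C' ≠ ∞ ∧ ∀ᵐ x, g x ≤ C' * om x ^ 2 := by
  obtain ⟨M, hM, hMle⟩ := exists_lintegral_kerMaj_mul_om_le (s := t) (by linarith)
  -- Eliminating g: only the most singular part of the kernel remains as a potential, the rest being
  -- bounded by the L¹ norm of h.
  have crude : ∃ A : ℝ≥0∞, A ≠ ∞ ∧ ∀ᵐ y, h y ≤ A * om y ^ t * (1 + riesz 3 h y) := by
    refine ⟨C * (C * (2 + 2 * ∫⁻ y, h y)), by finiteness, ?_⟩
    filter_upwards [hg, hhg] with y hy hy2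
    calc h y ≤ C * (om y ^ t * g y) := hy2
      _ ≤ C * (om y ^ t * (C * (2 * riesz 3 h y + 2 * ∫⁻ y, h y))) := by
          gcongr
          exact hy.trans (by gcongr; exact majPot_le h hh y)
      _ = C * C * om y ^ t * (2 * riesz 3 h y + (2 * ∫⁻ y, h y) * 1) := by ring
      _ ≤ C * C * om y ^ t * ((2 + 2 * ∫⁻ y, h y) * riesz 3 h y + (2 + 2 * ∫⁻ y, h y) * 1) := by
          gcongr
          · exact le_self_add
          · exact le_add_self
      _ = _ := by ring
  obtain ⟨A, hA, hAle⟩ := crude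
  -- Substituting the crude bound inside the potential of order a gains one order; the weight is
  -- used only on the constant term and dropped on the other.
  have improve : ∀ a : ℕ, 2 ≤ a → a ≤ 3 → ∃ A' : ℝ≥0∞, A' ≠ ∞ ∧ ∀ x,
      riesz a h x ≤ A' * (1 + riesz (a - 1) h x) := by
    intro a ha ha3
    obtain ⟨K, hK, hKle⟩ := riesz_riesz_le ha ha3
    refine ⟨A * (M + K), by finiteness, fun x => ?_⟩
    have mr : Measurable (riesz 3 h) := measurable_riesz 3 hh
    calc riesz a h x ≤ ∫⁻ y, (A * (kerMaj (x - y) * om y ^ t)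
            + A * (kap (x - y) ^ a * riesz 3 h y)) := by
          refine lintegral_mono_ae ?_
          filter_upwards [hAle] with y hy
          calc kap (x - y) ^ a * h y
              ≤ kap (x - y) ^ a * (A * om y ^ t * (1 + riesz 3 h y)) := by gcongr
            _ = A * (kap (x - y) ^ a * om y ^ t)
                + A * (kap (x - y) ^ a * (om y ^ t * riesz 3 h y)) := by ring
            _ ≤ _ := by
                gcongr
                · exact kap_pow_le_kerMaj ha ha3 _
                · exact mul_le_of_le_one_left zero_le (om_rpow_le_one y (by linarith))
      _ = A * (∫⁻ y, kerMaj (x - y) * om y ^ t) + A * riesz a (riesz 3 h) x := by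
          rw [lintegral_add_left (by fun_prop), lintegral_const_mul _ (by fun_prop),
            lintegral_const_mul _ (by fun_prop), riesz]
      _ ≤ A * M + A * (K * riesz (a - 1) h x) := by
          gcongr
          · exact hMle x
          · exact hKle h hh x
      _ = A * (M * 1 + K * riesz (a - 1) h x) := by ring
      _ ≤ A * ((M + K) * 1 + (M + K) * riesz (a - 1) h x) := by
          gcongr
          · exact le_self_add
          · exact le_add_self
      _ = _ := by ring
  obtain ⟨A₃, hA₃, le₃⟩ := improve 3 (by norm_num) le_rfl
  obtain ⟨A₂, hA₂, le₂⟩ := improve 2 le_rfl (by norm_num)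
  have hball : ∫⁻ z in ball (0 : R4) 1, kap z ^ 2 ≠ ∞ := by
    obtain ⟨K, hK, hKle⟩ := exists_setLIntegral_kap_near (a := 2) (by norm_num)
    exact ((hKle 1 one_pos).trans_lt (by finiteness)).ne
  set R := (∫⁻ z in ball (0 : R4) 1, kap z ^ 2) + (∫⁻ y, h y ^ 2) + ∫⁻ y, h y with hR
  have hRtop : R ≠ ∞ := by finiteness
  -- Two gains take the order from 3 through 2 to 1, where the L¹ and L² bounds apply.
  have hriesz : ∀ x, riesz 3 h x ≤ A₃ * (1 + A₂ * (1 + R)) := fun x =>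
    (le₃ x).trans (by gcongr; exact (le₂ x).trans (by gcongr; exact riesz_one_le h hh x))
  obtain ⟨P, hP, hPle⟩ := exists_lintegral_kerMaj_mul_om_le_sq ht
  set Q := A * (1 + A₃ * (1 + A₂ * (1 + R))) with hQ
  refine ⟨C * (Q * P), by finiteness, ?_⟩
  -- The source is now bounded by Q `om`^t pointwise, so the weighted integral estimate converts its
  -- potential into `om`² decay.
  filter_upwards [hg] with x hx
  calc g x ≤ C * majPot h x := hx
    _ ≤ C * ∫⁻ y, Q * (kerMaj (x - y) * om y ^ t) := by
        gcongr
        refine lintegral_mono_ae ?_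
        filter_upwards [hAle] with y hy
        calc kerMaj (x - y) * h y
            ≤ kerMaj (x - y) * (A * om y ^ t * (1 + A₃ * (1 + A₂ * (1 + R)))) := by
              gcongr
              exact hy.trans (by gcongr; exact hriesz y)
          _ = _ := by rw [hQ]; ring
    _ ≤ C * (Q * (P * om x ^ 2)) := by
        rw [lintegral_const_mul _ (by fun_prop)]
        gcongr
        exact hPle x
    _ = _ := by ring

/-- Cauchy–Schwarz for the measure w dy, applied to 1 and f. -/
lemma sq_lintegral_mul_le {w f : R4 → ℝ≥0∞} (hw : Measurable w) (hf : Measurable f) :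
    (∫⁻ y, w y * f y) ^ 2 ≤ (∫⁻ y, w y) * ∫⁻ y, w y * f y ^ 2 := by
  have h := ENNReal.lintegral_mul_le_Lp_mul_Lq (volume.withDensity w) Real.HolderConjugate.two_two
    (f := fun _ => 1) (g := f) (by fun_prop) (by fun_prop)
  rw [lintegral_withDensity_eq_lintegral_mul _ hw (by fun_prop),
    lintegral_withDensity_eq_lintegral_mul _ hw (by fun_prop),
    lintegral_withDensity_eq_lintegral_mul _ hw (by fun_prop)] at h
  simp only [Pi.mul_apply, one_mul, ENNReal.rpow_ofNat, one_pow, mul_one] at h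
  calc (∫⁻ y, w y * f y) ^ 2
      ≤ ((∫⁻ y, w y) ^ (1 / 2 : ℝ) * (∫⁻ y, w y * f y ^ 2) ^ (1 / 2 : ℝ)) ^ 2 := by gcongr
    _ = _ := by
        rw [mul_pow, ← ENNReal.rpow_natCast, ← ENNReal.rpow_natCast, ← ENNReal.rpow_mul,
          ← ENNReal.rpow_mul]
        norm_num

/-- Schur's test for the kernel `⟨x⟩^{-s} (|x-y|⁻³ + |x-y|⁻²) ⟨y⟩^{-s}`, `s > 2`. -/
theorem exists_lintegral_om_majPot_sq_le {s : ℝ} (hs : 2 < s) :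
    ∃ M : ℝ≥0∞, M ≠ ∞ ∧ ∀ f : R4 → ℝ≥0∞, Measurable f →
      ∫⁻ x, (om x ^ s * majPot (fun y => om y ^ s * f y) x) ^ 2 ≤ M * ∫⁻ y, f y ^ 2 := by
  obtain ⟨M, hM, hMle⟩ := exists_lintegral_kerMaj_mul_om_le hs
  refine ⟨M * M, by finiteness, fun f hf => ?_⟩
  -- The weight in y makes the first factor of Cauchy–Schwarz uniformly bounded. One power of the
  -- weight in x is kept so that, after exchanging integrals, the same bound applies with x and y
  -- interchanged.
  have hpt : ∀ x, (om x ^ s * majPot (fun y => om y ^ s * f y) x) ^ 2 ≤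
      M * ∫⁻ y, om x ^ s * (kerMaj (x - y) * om y ^ s * f y ^ 2) := by
    intro x
    have e : majPot (fun y => om y ^ s * f y) x = ∫⁻ y, (kerMaj (x - y) * om y ^ s) * f y := by
      simp only [majPot, mul_assoc]
    rw [mul_pow, e, lintegral_const_mul _ (by fun_prop), mul_left_comm]
    gcongr
    · calc (om x ^ s) ^ 2 ≤ (om x ^ s) ^ 1 :=
            pow_le_pow_of_le_one zero_le (om_rpow_le_one x (by linarith)) (by norm_num)
        _ = _ := pow_one _
    · refine (sq_lintegral_mul_le (by fun_prop) hf).trans ?_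
      gcongr
      exact hMle x
  calc ∫⁻ x, (om x ^ s * majPot (fun y => om y ^ s * f y) x) ^ 2
      ≤ ∫⁻ x, M * ∫⁻ y, om x ^ s * (kerMaj (x - y) * om y ^ s * f y ^ 2) := lintegral_mono hpt
    _ = M * ∫⁻ x, ∫⁻ y, om x ^ s * (kerMaj (x - y) * om y ^ s * f y ^ 2) :=
        lintegral_const_mul' _ _ hM
    _ = M * ∫⁻ y, ∫⁻ x, om x ^ s * (kerMaj (x - y) * om y ^ s * f y ^ 2) := by
        rw [lintegral_lintegral_swap (by fun_prop)]
    _ ≤ M * ∫⁻ y, M * f y ^ 2 := by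
        gcongr with y
        calc ∫⁻ x, om x ^ s * (kerMaj (x - y) * om y ^ s * f y ^ 2)
            ≤ ∫⁻ x, (kerMaj (y - x) * om x ^ s) * f y ^ 2 := by
              refine lintegral_mono fun x => ?_
              calc om x ^ s * (kerMaj (x - y) * om y ^ s * f y ^ 2)
                  ≤ om x ^ s * (kerMaj (x - y) * 1 * f y ^ 2) := by
                    gcongr; exact om_rpow_le_one y (by linarith)
                _ = _ := by rw [kerMaj_sub_comm]; ring
          _ = (∫⁻ x, kerMaj (y - x) * om x ^ s) * f y ^ 2 := lintegral_mul_const _ (by fun_prop)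
          _ ≤ _ := by gcongr; exact hMle y
    _ = _ := by rw [lintegral_const_mul _ (by fun_prop), mul_assoc]

/-- The singularity is integrable and the tail is at most 2, so the bound depends on K only through
its volume, and not on y. -/
lemma setLIntegral_kerMaj_sub_le (K : Set R4) (y : R4) :
    ∫⁻ x in K, kerMaj (x - y) ≤ 2 * (∫⁻ z, kapNear z) + 2 * volume K := by
  calc ∫⁻ x in K, kerMaj (x - y) ≤ ∫⁻ x in K, (2 * kapNear (x - y) + 2) := by
        refine lintegral_mono fun x => ?_
        rcases lt_or_ge ‖x - y‖ 1 with hz | hz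
        · exact (kerMaj_le_of_near hz).trans le_self_add
        · refine (kerMaj_le_of_far hz).trans ?_
          calc 2 * kap (x - y) ^ 2 ≤ 2 * 1 := by
                gcongr; exact pow_le_one₀ zero_le (kap_le_one hz)
            _ ≤ _ := by rw [mul_one]; exact le_add_self
    _ = (∫⁻ x in K, 2 * kapNear (x - y)) + 2 * volume K := by
        rw [lintegral_add_left (by fun_prop), setLIntegral_const]
    _ ≤ (∫⁻ x, 2 * kapNear (x - y)) + 2 * volume K := by
        gcongr; exact Measure.restrict_le_self
    _ = _ := by
        rw [lintegral_const_mul _ (by fun_prop), lintegral_sub_right_eq_self kapNear]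

/-- Potentials of integrable functions are locally integrable. -/
lemma setLIntegral_majPot_lt_top {h : R4 → ℝ≥0∞} (hh : Measurable h) (h1 : ∫⁻ y, h y ≠ ∞)
    {K : Set R4} (hK : IsCompact K) : ∫⁻ x in K, majPot h x < ∞ := by
  have hvol : volume K < ∞ := hK.measure_lt_top
  have hn := lintegral_kapNear_lt_top
  calc ∫⁻ x in K, majPot h x = ∫⁻ y, ∫⁻ x in K, kerMaj (x - y) * h y := by
        unfold majPot
        rw [lintegral_lintegral_swap (by fun_prop)]
    _ ≤ ∫⁻ y, (2 * (∫⁻ z, kapNear z) + 2 * volume K) * h y := by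
        refine lintegral_mono fun y => ?_
        rw [lintegral_mul_const _ (by fun_prop)]
        gcongr
        exact setLIntegral_kerMaj_sub_le K y
    _ = (2 * (∫⁻ z, kapNear z) + 2 * volume K) * ∫⁻ y, h y := lintegral_const_mul _ hh
    _ < ∞ := by finiteness

end Dirac4

end

/-! ### Partial derivatives and the regularized fundamental solution. -/

noncomputable section

namespace Dirac4
open scoped ENNReal NNReal ContDiff Topology
open Metric Filter

/-- The partial derivative `∂ₖ θ`. -/
def pd (k : Fin 4) (θ : R4 → ℝ) (x : R4) : ℝ := fderiv ℝ θ x (EuclideanSpace.single k 1)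

/-- The Laplacian `∑ₖ ∂ₖ ∂ₖ θ`. -/
def lap (θ : R4 → ℝ) (x : R4) : ℝ := ∑ k, pd k (pd k θ) x

lemma contDiff_pd {θ : R4 → ℝ} (hθ : ContDiff ℝ ∞ θ) (k : Fin 4) : ContDiff ℝ ∞ (pd k θ) :=
  (hθ.fderiv_right (m := ∞) le_rfl).clm_apply contDiff_const

lemma hasCompactSupport_pd {θ : R4 → ℝ} (hc : HasCompactSupport θ) (k : Fin 4) :
    HasCompactSupport (pd k θ) := hc.fderiv_apply ℝ _

lemma integral_mul_pd {f η : R4 → ℝ} (hf : ContDiff ℝ ∞ f) (hη : ContDiff ℝ ∞ η)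
    (hc : HasCompactSupport η) (k : Fin 4) : ∫ x, f x * pd k η x = -∫ x, pd k f x * η x := by
  refine integral_mul_fderiv_eq_neg_fderiv_mul_of_integrable ?_ ?_ ?_ ?_ ?_
  · exact ((contDiff_pd hf k).continuous.mul hη.continuous).integrable_of_hasCompactSupport
      hc.mul_left
  · exact (hf.continuous.mul (contDiff_pd hη k).continuous).integrable_of_hasCompactSupport
      (hasCompactSupport_pd hc k).mul_left
  · exact (hf.continuous.mul hη.continuous).integrable_of_hasCompactSupport hc.mul_left
  · exact fun x _ => (hf.differentiable (by simp)).differentiableAt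
  · exact fun x _ => (hη.differentiable (by simp)).differentiableAt

/-! ### The Newtonian kernel and its regularization -/

/-- The fundamental solution `1 / (4π²|z|²)` of `-Δ` on `ℝ⁴`. -/
def newt (z : R4) : ℝ := (4 * Real.pi ^ 2 * ‖z‖ ^ 2)⁻¹

/-- The `k`-th derivative `-zₖ / (2π²|z|⁴)` of the fundamental solution. -/
def dnewt (k : Fin 4) (z : R4) : ℝ := -(z k) / (2 * Real.pi ^ 2 * ‖z‖ ^ 4)

/-- The regularized kernel `1 / (4π²(|z|² + δ²))`. -/
def newtReg (δ : ℝ) (z : R4) : ℝ := (4 * Real.pi ^ 2)⁻¹ * (‖z‖ ^ 2 + δ ^ 2)⁻¹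

/-- The derivative of the regularized kernel. -/
def dnewtReg (δ : ℝ) (k : Fin 4) (z : R4) : ℝ :=
  -(2 * Real.pi ^ 2)⁻¹ * (z k * ((‖z‖ ^ 2 + δ ^ 2)⁻¹) ^ 2)

lemma contDiff_inv_reg {δ : ℝ} (hδ : 0 < δ) :
    ContDiff ℝ ∞ fun z : R4 => (‖z‖ ^ 2 + δ ^ 2)⁻¹ :=
  ((contDiff_norm_sq ℝ).add contDiff_const).inv fun z => by positivity

lemma contDiff_newtReg {δ : ℝ} (hδ : 0 < δ) : ContDiff ℝ ∞ (newtReg δ) :=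
  contDiff_const.mul (contDiff_inv_reg hδ)

lemma contDiff_coord (k : Fin 4) : ContDiff ℝ ∞ fun z : R4 => z k := by fun_prop

lemma contDiff_dnewtReg {δ : ℝ} (hδ : 0 < δ) (k : Fin 4) : ContDiff ℝ ∞ (dnewtReg δ k) :=
  contDiff_const.mul ((contDiff_coord k).mul ((contDiff_inv_reg hδ).pow 2))

lemma hasFDerivAt_inv_reg {δ : ℝ} (hδ : 0 < δ) (z : R4) :
    HasFDerivAt (fun z : R4 => (‖z‖ ^ 2 + δ ^ 2)⁻¹)
      (-((‖z‖ ^ 2 + δ ^ 2)⁻¹ ^ 2) • (2 • innerSL ℝ z)) z := by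
  have h1 : HasFDerivAt (fun z : R4 => ‖z‖ ^ 2 + δ ^ 2) (2 • innerSL ℝ z) z :=
    (hasStrictFDerivAt_norm_sq z).hasFDerivAt.add_const _
  have h2 := (hasDerivAt_inv (x := ‖z‖ ^ 2 + δ ^ 2) (by positivity)).comp_hasFDerivAt z h1
  rw [inv_pow]
  exact h2

lemma pd_newtReg {δ : ℝ} (hδ : 0 < δ) (k : Fin 4) : pd k (newtReg δ) = dnewtReg δ k := by
  funext z
  have h := (hasFDerivAt_inv_reg hδ z).const_mul ((4 * Real.pi ^ 2)⁻¹)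
  rw [pd, show newtReg δ = fun z => (4 * Real.pi ^ 2)⁻¹ * (‖z‖ ^ 2 + δ ^ 2)⁻¹ from rfl, h.fderiv]
  simp [dnewtReg, EuclideanSpace.inner_single_right]
  field_simp
  norm_num

lemma pd_dnewtReg {δ : ℝ} (hδ : 0 < δ) (k : Fin 4) (z : R4) :
    pd k (dnewtReg δ k) z = -(2 * Real.pi ^ 2)⁻¹ *
      (((‖z‖ ^ 2 + δ ^ 2)⁻¹) ^ 2 - 4 * z k ^ 2 * ((‖z‖ ^ 2 + δ ^ 2)⁻¹) ^ 3) := by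
  have hk : HasFDerivAt (fun z : R4 => z k) (EuclideanSpace.proj k : R4 →L[ℝ] ℝ) z :=
    (EuclideanSpace.proj k : R4 →L[ℝ] ℝ).hasFDerivAt
  have h := (hk.mul ((hasFDerivAt_inv_reg hδ z).pow 2)).const_mul (-(2 * Real.pi ^ 2)⁻¹)
  rw [pd, show fderiv ℝ (dnewtReg δ k) z = _ from h.fderiv]
  have h0 : ‖z‖ ^ 2 + δ ^ 2 ≠ 0 := by positivity
  simp [EuclideanSpace.inner_single_right]
  field_simp
  ring

/-- With q = (|z|² + δ²)⁻¹, the sum of the brackets is 4q² - 4|z|²q³ = 4δ²q³. Dimension four makes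
the |z|² terms cancel, leaving an approximate identity as δ → 0. -/
lemma sum_pd_dnewtReg {δ : ℝ} (hδ : 0 < δ) (z : R4) :
    ∑ k, pd k (dnewtReg δ k) z =
      -(2 / Real.pi ^ 2 * (δ ^ 2 * ((‖z‖ ^ 2 + δ ^ 2)⁻¹) ^ 3)) := by
  simp only [pd_dnewtReg hδ]
  have hn : ‖z‖ ^ 2 = ∑ k, z k ^ 2 := EuclideanSpace.real_norm_sq_eq z
  have h0 : ‖z‖ ^ 2 + δ ^ 2 ≠ 0 := by positivity
  rw [← Finset.mul_sum, Finset.sum_sub_distrib, ← Finset.sum_mul, ← Finset.mul_sum, ← hn]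
  simp
  field_simp
  ring

/-- `∫ Γ_δ Δη = -∫ (2/π²) δ²/(|z|²+δ²)³ η`. -/
lemma integral_newtReg_mul_lap {δ : ℝ} (hδ : 0 < δ) {η : R4 → ℝ} (hη : ContDiff ℝ ∞ η)
    (hc : HasCompactSupport η) :
    ∫ z, newtReg δ z * lap η z =
      -∫ z, 2 / Real.pi ^ 2 * (δ ^ 2 * ((‖z‖ ^ 2 + δ ^ 2)⁻¹) ^ 3) * η z := by
  have h1 : ∀ k, ∫ z, newtReg δ z * pd k (pd k η) z = ∫ z, pd k (dnewtReg δ k) z * η z := by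
    intro k
    rw [integral_mul_pd (contDiff_newtReg hδ) (contDiff_pd hη k) (hasCompactSupport_pd hc k),
      pd_newtReg hδ, integral_mul_pd (contDiff_dnewtReg hδ k) hη hc, neg_neg]
  simp only [lap, Finset.mul_sum]
  rw [integral_finsetSum]
  · simp only [h1]
    rw [← integral_finsetSum]
    · rw [← integral_neg]
      refine integral_congr_ae (Eventually.of_forall fun z => ?_)
      simp only
      rw [← Finset.sum_mul, sum_pd_dnewtReg hδ, neg_mul]
    · intro k _
      exact ((contDiff_pd (contDiff_dnewtReg hδ k) k).continuous.mul
        hη.continuous).integrable_of_hasCompactSupport hc.mul_left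
  · intro k _
    exact ((contDiff_newtReg hδ).continuous.mul
      (contDiff_pd (contDiff_pd hη k) k).continuous).integrable_of_hasCompactSupport
      (hasCompactSupport_pd (hasCompactSupport_pd hc k) k).mul_left

end Dirac4

end

/-! ### The limit δ → 0 and the fundamental solution of -Δ. -/

noncomputable section

namespace Dirac4
open scoped ENNReal NNReal ContDiff Topology
open Metric Filter

lemma kap_eq_ofReal {z : R4} (hz : z ≠ 0) : kap z = ENNReal.ofReal ‖z‖⁻¹ := by
  rw [kap, ← ofReal_norm, ENNReal.ofReal_inv_of_pos (norm_pos_iff.2 hz)]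

lemma abs_coord_le_norm (z : R4) (k : Fin 4) : |z k| ≤ ‖z‖ := PiLp.norm_apply_le z k

lemma abs_newt (z : R4) : |newt z| = (4 * Real.pi ^ 2)⁻¹ * ‖z‖⁻¹ ^ 2 := by
  rw [newt, abs_of_nonneg (by positivity), mul_inv, inv_pow]

lemma abs_dnewt_le (k : Fin 4) (z : R4) : |dnewt k z| ≤ (2 * Real.pi ^ 2)⁻¹ * ‖z‖⁻¹ ^ 3 := by
  rcases eq_or_ne z 0 with rfl | hz
  · simp [dnewt]
  have h0 : 0 < ‖z‖ := norm_pos_iff.2 hz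
  rw [dnewt, abs_div, abs_neg, abs_of_nonneg (by positivity : 0 ≤ 2 * Real.pi ^ 2 * ‖z‖ ^ 4),
    div_le_iff₀ (by positivity)]
  refine (abs_coord_le_norm z k).trans (le_of_eq ?_)
  field_simp

@[fun_prop] lemma measurable_newt : Measurable newt := by unfold newt; fun_prop
@[fun_prop] lemma measurable_dnewt (k : Fin 4) : Measurable (dnewt k) := by
  unfold dnewt; fun_prop

lemma two_pi_sq_inv_le_one : (2 * Real.pi ^ 2)⁻¹ ≤ 1 := by
  have := Real.pi_gt_three
  exact inv_le_one_of_one_le₀ (by nlinarith)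

lemma four_pi_sq_inv_le_one : (4 * Real.pi ^ 2)⁻¹ ≤ 1 := by
  have := Real.pi_gt_three
  exact inv_le_one_of_one_le₀ (by nlinarith)

lemma enorm_newt_le (z : R4) : ‖newt z‖ₑ ≤ kap z ^ 2 := by
  rcases eq_or_ne z 0 with rfl | hz
  · simp [newt]
  rw [kap_eq_ofReal hz, ← ENNReal.ofReal_pow (by positivity), ← ofReal_norm]
  refine ENNReal.ofReal_le_ofReal ?_
  rw [Real.norm_eq_abs, abs_newt]
  exact mul_le_of_le_one_left (by positivity) four_pi_sq_inv_le_one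

lemma enorm_dnewt_le (k : Fin 4) (z : R4) : ‖dnewt k z‖ₑ ≤ kap z ^ 3 := by
  rcases eq_or_ne z 0 with rfl | hz
  · simp [dnewt]
  rw [kap_eq_ofReal hz, ← ENNReal.ofReal_pow (by positivity), ← ofReal_norm]
  refine ENNReal.ofReal_le_ofReal ((abs_dnewt_le k z).trans ?_)
  exact mul_le_of_le_one_left (by positivity) two_pi_sq_inv_le_one

lemma locallyIntegrable_of_enorm_le_kerMaj {f : R4 → ℝ} (hf : Measurable f)
    (h : ∀ z, ‖f z‖ₑ ≤ kerMaj z) : LocallyIntegrable f volume := by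
  refine locallyIntegrable_iff.2 fun K hK => ⟨hf.aestronglyMeasurable, ?_⟩
  have hvol : volume K < ⊤ := hK.measure_lt_top
  have hn := lintegral_kapNear_lt_top
  have := setLIntegral_kerMaj_sub_le K 0
  simp only [sub_zero] at this
  exact (lintegral_mono h).trans_lt (this.trans_lt (by finiteness))

lemma locallyIntegrable_newt : LocallyIntegrable newt volume :=
  locallyIntegrable_of_enorm_le_kerMaj (by fun_prop) fun z =>
    (enorm_newt_le z).trans le_add_self

lemma locallyIntegrable_dnewt (k : Fin 4) : LocallyIntegrable (dnewt k) volume :=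
  locallyIntegrable_of_enorm_le_kerMaj (by fun_prop) fun z =>
    (enorm_dnewt_le k z).trans le_self_add

lemma integrable_mul_of_locallyIntegrable {f η : R4 → ℝ} (hf : LocallyIntegrable f volume)
    (hη : Continuous η) (hc : HasCompactSupport η) : Integrable (fun z => f z * η z) := by
  simpa only [smul_eq_mul, mul_comm] using hf.integrable_smul_left_of_hasCompactSupport hη hc

/-- Regularization only shrinks the kernel, so the singular kernel, which is locally integrable,
dominates in the limit δ → 0. -/
lemma abs_newtReg_le (δ : ℝ) {z : R4} (hz : z ≠ 0) : |newtReg δ z| ≤ |newt z| := by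
  have h0 : 0 < ‖z‖ := norm_pos_iff.2 hz
  rw [abs_newt, newtReg, abs_of_nonneg (by positivity)]
  gcongr
  rw [inv_pow]
  exact inv_anti₀ (by positivity) (le_add_of_nonneg_right (sq_nonneg δ))

lemma abs_dnewtReg_le (δ : ℝ) (k : Fin 4) {z : R4} (hz : z ≠ 0) :
    |dnewtReg δ k z| ≤ |dnewt k z| := by
  have h0 : 0 < ‖z‖ := norm_pos_iff.2 hz
  have e : dnewt k z = -(2 * Real.pi ^ 2)⁻¹ * (z k * ((‖z‖ ^ 2)⁻¹) ^ 2) := by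
    rw [dnewt]; field_simp
  rw [e, dnewtReg, abs_mul, abs_mul, abs_mul, abs_mul, abs_of_nonneg (by positivity :
    0 ≤ ((‖z‖ ^ 2 + δ ^ 2)⁻¹) ^ 2), abs_of_nonneg (by positivity : 0 ≤ ((‖z‖ ^ 2)⁻¹) ^ 2)]
  gcongr
  exact le_add_of_nonneg_right (sq_nonneg δ)

lemma tendsto_inv_reg {z : R4} (hz : z ≠ 0) :
    Tendsto (fun δ : ℝ => (‖z‖ ^ 2 + δ ^ 2)⁻¹) (𝓝[>] 0) (𝓝 (‖z‖ ^ 2)⁻¹) := by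
  have h0 : 0 < ‖z‖ := norm_pos_iff.2 hz
  have : ContinuousAt (fun δ : ℝ => (‖z‖ ^ 2 + δ ^ 2)⁻¹) 0 :=
    ContinuousAt.inv₀ (by fun_prop) (by positivity)
  have h := this.tendsto
  simp only [ne_eq, OfNat.ofNat_ne_zero, not_false_eq_true, zero_pow, add_zero] at h
  exact h.mono_left nhdsWithin_le_nhds

lemma tendsto_newtReg {z : R4} (hz : z ≠ 0) :
    Tendsto (fun δ : ℝ => newtReg δ z) (𝓝[>] 0) (𝓝 (newt z)) := by
  have := (tendsto_inv_reg hz).const_mul (4 * Real.pi ^ 2)⁻¹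
  rwa [← mul_inv] at this

lemma tendsto_dnewtReg (k : Fin 4) {z : R4} (hz : z ≠ 0) :
    Tendsto (fun δ : ℝ => dnewtReg δ k z) (𝓝[>] 0) (𝓝 (dnewt k z)) := by
  have h0 : 0 < ‖z‖ := norm_pos_iff.2 hz
  have e : dnewt k z = -(2 * Real.pi ^ 2)⁻¹ * (z k * ((‖z‖ ^ 2)⁻¹) ^ 2) := by
    rw [dnewt]; field_simp
  rw [e]
  exact (((tendsto_inv_reg hz).pow 2).const_mul _).const_mul _

lemma ae_ne_zero : ∀ᵐ z : R4, z ≠ 0 := by simp [ae_iff]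

lemma tendsto_integral_newtReg_mul {η : R4 → ℝ} (hη : Continuous η) (hc : HasCompactSupport η) :
    Tendsto (fun δ : ℝ => ∫ z, newtReg δ z * η z) (𝓝[>] 0) (𝓝 (∫ z, newt z * η z)) := by
  refine tendsto_integral_filter_of_dominated_convergence (fun z => ‖newt z * η z‖) ?_ ?_
    (integrable_mul_of_locallyIntegrable locallyIntegrable_newt hη hc).norm ?_
  · filter_upwards [self_mem_nhdsWithin] with δ hδ
    exact ((contDiff_newtReg hδ).continuous.mul hη).aestronglyMeasurable
  · refine Eventually.of_forall fun δ => ?_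
    filter_upwards [ae_ne_zero] with z hz
    rw [norm_mul, norm_mul]
    gcongr
    exact abs_newtReg_le δ hz
  · filter_upwards [ae_ne_zero] with z hz
    exact (tendsto_newtReg hz).mul_const _

lemma tendsto_integral_dnewtReg_mul (k : Fin 4) {η : R4 → ℝ} (hη : Continuous η)
    (hc : HasCompactSupport η) :
    Tendsto (fun δ : ℝ => ∫ z, dnewtReg δ k z * η z) (𝓝[>] 0) (𝓝 (∫ z, dnewt k z * η z)) := by
  refine tendsto_integral_filter_of_dominated_convergence (fun z => ‖dnewt k z * η z‖) ?_ ?_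
    (integrable_mul_of_locallyIntegrable (locallyIntegrable_dnewt k) hη hc).norm ?_
  · filter_upwards [self_mem_nhdsWithin] with δ hδ
    exact ((contDiff_dnewtReg hδ k).continuous.mul hη).aestronglyMeasurable
  · refine Eventually.of_forall fun δ => ?_
    filter_upwards [ae_ne_zero] with z hz
    rw [norm_mul, norm_mul]
    gcongr
    exact abs_dnewtReg_le δ k hz
  · filter_upwards [ae_ne_zero] with z hz
    exact (tendsto_dnewtReg k hz).mul_const _

/-- Integration by parts is legitimate for the smooth kernels, and both sides converge as δ → 0; no
boundary term at the origin has to be estimated. -/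
lemma integral_newt_mul_pd {η : R4 → ℝ} (hη : ContDiff ℝ ∞ η) (hc : HasCompactSupport η)
    (k : Fin 4) : ∫ z, newt z * pd k η z = -∫ z, dnewt k z * η z := by
  refine tendsto_nhds_unique
    (tendsto_integral_newtReg_mul (contDiff_pd hη k).continuous (hasCompactSupport_pd hc k)) ?_
  refine ((tendsto_integral_dnewtReg_mul k hη.continuous hc).neg).congr' ?_
  filter_upwards [self_mem_nhdsWithin] with δ hδ
  rw [integral_mul_pd (contDiff_newtReg hδ) hη hc, pd_newtReg hδ]

lemma integrable_inv_cube : Integrable fun w : R4 => ((1 + ‖w‖ ^ 2)⁻¹) ^ 3 := by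
  have h := integrable_rpow_neg_one_add_norm_sq (μ := (volume : Measure R4)) (r := 6)
    (by simp; norm_num)
  refine h.congr (Eventually.of_forall fun w => ?_)
  simp only
  rw [show (-6 / 2 : ℝ) = -((3 : ℕ) : ℝ) by norm_num, Real.rpow_neg (by positivity),
    Real.rpow_natCast, inv_pow]

lemma volume_real_ball : (volume : Measure R4).real (ball 0 1) = Real.pi ^ 2 / 2 := by
  rw [Measure.real, InnerProductSpace.volume_ball_of_dim_even (k := 2) (by simp)]
  simp [Nat.factorial]
  positivity

lemma integral_Ioi_radial :
    ∫ r in Set.Ioi (0 : ℝ), r ^ 3 * ((1 + r ^ 2)⁻¹) ^ 3 = 1 / 4 := by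
  -- The antiderivative is r⁴ / (4(1 + r²)²), which vanishes at 0 and tends to 1/4.
  have hd : ∀ r ∈ Set.Ici (0 : ℝ), HasDerivAt (fun r : ℝ => (1 - (1 + r ^ 2)⁻¹) ^ 2 / 4)
      (r ^ 3 * ((1 + r ^ 2)⁻¹) ^ 3) r := by
    intro r _
    have h1 : HasDerivAt (fun r : ℝ => 1 + r ^ 2) (2 * r) r := by
      simpa using (hasDerivAt_pow 2 r).const_add 1
    have h2 := (((h1.inv (by positivity)).const_sub 1).pow 2).div_const 4
    refine HasDerivAt.congr_deriv (f := fun r : ℝ => (1 - (1 + r ^ 2)⁻¹) ^ 2 / 4) h2 ?_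
    have : (1 + r ^ 2 : ℝ) ≠ 0 := by positivity
    simp only [Pi.inv_apply, Nat.cast_ofNat, Nat.add_one_sub_one, pow_one]
    field_simp
    ring
  have ht : Tendsto (fun r : ℝ => (1 - (1 + r ^ 2)⁻¹) ^ 2 / 4) atTop (𝓝 ((1 - 0) ^ 2 / 4)) := by
    refine ((tendsto_const_nhds.sub ?_).pow 2).div_const 4
    exact tendsto_inv_atTop_zero.comp
      (tendsto_atTop_add_const_left _ _ (tendsto_pow_atTop two_ne_zero))
  rw [integral_Ioi_of_hasDerivAt_of_nonneg' hd (fun r hr => ?_) ht]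
  · norm_num
  · have : (0 : ℝ) < r := hr
    positivity

/-- The polar formula contributes the dimension 4 and the ball volume π²/2, so the mass is (2/π²) ·
4 · (π²/2) · (1/4) = 1. -/
lemma integral_approx_kernel :
    ∫ w : R4, 2 / Real.pi ^ 2 * ((1 + ‖w‖ ^ 2)⁻¹) ^ 3 = 1 := by
  rw [integral_const_mul, integral_fun_norm_addHaar volume (fun r => ((1 + r ^ 2)⁻¹) ^ 3),
    volume_real_ball]
  simp only [finrank_euclideanSpace, Fintype.card_fin, smul_eq_mul, nsmul_eq_mul,
    show 4 - 1 = 3 from rfl]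
  rw [integral_Ioi_radial]
  have := Real.pi_ne_zero
  field_simp
  norm_num

/-- The substitution z = δw moves all dependence on δ into η(δw), which tends boundedly to η(0)
against a fixed kernel of mass 1. -/
lemma tendsto_integral_approx {η : R4 → ℝ} (hη : Continuous η) (hc : HasCompactSupport η) :
    Tendsto (fun δ : ℝ => ∫ z, 2 / Real.pi ^ 2 * (δ ^ 2 * ((‖z‖ ^ 2 + δ ^ 2)⁻¹) ^ 3) * η z)
      (𝓝[>] 0) (𝓝 (η 0)) := by
  have e : ∀ δ : ℝ, 0 < δ →
      ∫ z, 2 / Real.pi ^ 2 * (δ ^ 2 * ((‖z‖ ^ 2 + δ ^ 2)⁻¹) ^ 3) * η z =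
        ∫ w : R4, 2 / Real.pi ^ 2 * ((1 + ‖w‖ ^ 2)⁻¹) ^ 3 * η (δ • w) := by
    intro δ hδ
    have h := Measure.integral_comp_smul (volume : Measure R4)
      (fun z => 2 / Real.pi ^ 2 * (δ ^ 2 * ((‖z‖ ^ 2 + δ ^ 2)⁻¹) ^ 3) * η z) δ
    simp only [finrank_euclideanSpace, Fintype.card_fin, smul_eq_mul] at h
    rw [abs_of_pos (by positivity)] at h
    rw [← mul_right_inj' (by positivity : (δ ^ 4)⁻¹ ≠ 0), ← h, ← integral_const_mul]
    refine integral_congr_ae (Eventually.of_forall fun w => ?_)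
    simp only [norm_smul, Real.norm_eq_abs, abs_of_pos hδ]
    have h1 : (δ * ‖w‖) ^ 2 + δ ^ 2 = δ ^ 2 * (1 + ‖w‖ ^ 2) := by ring
    rw [h1]
    have : (1 + ‖w‖ ^ 2 : ℝ) ≠ 0 := by positivity
    field_simp
  have hlim : Tendsto (fun δ : ℝ => ∫ w : R4, 2 / Real.pi ^ 2 * ((1 + ‖w‖ ^ 2)⁻¹) ^ 3 * η (δ • w))
      (𝓝[>] 0) (𝓝 (∫ w : R4, 2 / Real.pi ^ 2 * ((1 + ‖w‖ ^ 2)⁻¹) ^ 3 * η 0)) := by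
    obtain ⟨C, hC⟩ := hη.bounded_above_of_compact_support hc
    refine tendsto_integral_filter_of_dominated_convergence
      (fun w => 2 / Real.pi ^ 2 * ((1 + ‖w‖ ^ 2)⁻¹) ^ 3 * C) ?_ ?_
      ((integrable_inv_cube.const_mul _).mul_const C) ?_
    · refine Eventually.of_forall fun δ => Measurable.aestronglyMeasurable ?_
      have := hη.measurable
      fun_prop
    · refine Eventually.of_forall fun δ => Eventually.of_forall fun w => ?_
      rw [norm_mul, Real.norm_of_nonneg (by positivity :
        0 ≤ 2 / Real.pi ^ 2 * ((1 + ‖w‖ ^ 2)⁻¹) ^ 3)]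
      gcongr
      exact hC _
    · refine Eventually.of_forall fun w => Tendsto.const_mul _ ?_
      have h1 : ContinuousAt (fun δ : ℝ => η (δ • w)) 0 :=
        (hη.comp (continuous_id.smul continuous_const)).continuousAt
      have h := h1.tendsto
      simp only [zero_smul] at h
      exact h.mono_left nhdsWithin_le_nhds
  rw [integral_mul_const, integral_approx_kernel, one_mul] at hlim
  refine hlim.congr' ?_
  filter_upwards [self_mem_nhdsWithin] with δ hδ
  exact (e δ hδ).symm

lemma contDiff_lap {η : R4 → ℝ} (hη : ContDiff ℝ ∞ η) : ContDiff ℝ ∞ (lap η) :=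
  ContDiff.sum fun k _ => contDiff_pd (contDiff_pd hη k) k

lemma hasCompactSupport_lap {η : R4 → ℝ} (hc : HasCompactSupport η) :
    HasCompactSupport (lap η) := by
  refine hc.mono' fun x hx => ?_
  by_contra h
  refine hx (Finset.sum_eq_zero fun k _ => ?_)
  have h1 : tsupport (pd k (pd k η)) ⊆ tsupport η :=
    (tsupport_fderiv_apply_subset ℝ _).trans (tsupport_fderiv_apply_subset ℝ _)
  exact image_eq_zero_of_notMem_tsupport fun h' => h (h1 h')

/-- `Γ = 1 / (4π²|z|²)` is a fundamental solution of `-Δ`. -/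
theorem integral_newt_mul_lap {η : R4 → ℝ} (hη : ContDiff ℝ ∞ η) (hc : HasCompactSupport η) :
    ∫ z, newt z * lap η z = -η 0 := by
  refine tendsto_nhds_unique
    (tendsto_integral_newtReg_mul (contDiff_lap hη).continuous (hasCompactSupport_lap hc)) ?_
  refine ((tendsto_integral_approx hη.continuous hc).neg).congr' ?_
  filter_upwards [self_mem_nhdsWithin] with δ hδ
  rw [integral_newtReg_mul_lap hδ hη hc]

end Dirac4

end

noncomputable section

namespace Dirac4
open scoped NNReal ContDiff Topology
open Metric Filter

/-! ### The Newtonian potential of a test function -/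

/-- The Newtonian potential `Γ * θ`. -/
def newtPot (θ : R4 → ℝ) (x : R4) : ℝ := ∫ t, newt t * θ (x - t)

lemma newtPot_eq_convolution (θ : R4 → ℝ) :
    newtPot θ = convolution newt θ (ContinuousLinearMap.mul ℝ ℝ) volume := rfl

lemma contDiff_newtPot {θ : R4 → ℝ} (hθ : ContDiff ℝ ∞ θ) (hc : HasCompactSupport θ) :
    ContDiff ℝ ∞ (newtPot θ) := by
  rw [newtPot_eq_convolution]
  exact hc.contDiff_convolution_right _ locallyIntegrable_newt hθ

lemma pd_newtPot {θ : R4 → ℝ} (hθ : ContDiff ℝ ∞ θ) (hc : HasCompactSupport θ) (k : Fin 4) :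
    pd k (newtPot θ) = newtPot (pd k θ) := by
  funext x
  have h1 : ContDiff ℝ 1 θ := hθ.of_le (by simp)
  rw [pd, newtPot_eq_convolution,
    (hc.hasFDerivAt_convolution_right _ locallyIntegrable_newt h1 x).fderiv,
    convolution_precompR_apply _ locallyIntegrable_newt (hc.fderiv ℝ)
      (h1.continuous_fderiv one_ne_zero)]
  rfl

lemma pd_comp_sub_left {θ : R4 → ℝ} (hθ : ContDiff ℝ ∞ θ) (x : R4) (k : Fin 4) :
    pd k (fun t => θ (x - t)) = fun t => -pd k θ (x - t) := by
  funext t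
  have h1 : HasFDerivAt θ (fderiv ℝ θ (x - t)) (x - t) :=
    (hθ.differentiable (by simp)).differentiableAt.hasFDerivAt
  have h2 : HasFDerivAt (fun t : R4 => x - t) (-ContinuousLinearMap.id ℝ R4) t :=
    (hasFDerivAt_id t).const_sub x
  rw [pd, show fderiv ℝ (fun t => θ (x - t)) t = _ from (h1.comp t h2).fderiv]
  simp [pd]

lemma contDiff_comp_sub_left {θ : R4 → ℝ} (hθ : ContDiff ℝ ∞ θ) (x : R4) :
    ContDiff ℝ ∞ fun t => θ (x - t) := hθ.comp (contDiff_const.sub contDiff_id)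

lemma hasCompactSupport_comp_sub_left {θ : R4 → ℝ} (hc : HasCompactSupport θ) (x : R4) :
    HasCompactSupport fun t => θ (x - t) :=
  hc.comp_homeomorph (Homeomorph.subLeft x)

/-- Integration by parts against t ↦ θ(x - t); the sign from the reflection cancels the sign from
the integration by parts. -/
lemma newtPot_pd {θ : R4 → ℝ} (hθ : ContDiff ℝ ∞ θ) (hc : HasCompactSupport θ) (k : Fin 4)
    (x : R4) : newtPot (pd k θ) x = ∫ t, dnewt k t * θ (x - t) := by
  have h := integral_newt_mul_pd (contDiff_comp_sub_left hθ x)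
    (hasCompactSupport_comp_sub_left hc x) k
  rw [pd_comp_sub_left hθ] at h
  simp only [mul_neg, integral_neg, neg_inj] at h
  exact h

lemma newtPot_lap {θ : R4 → ℝ} (hθ : ContDiff ℝ ∞ θ) (hc : HasCompactSupport θ) (x : R4) :
    newtPot (lap θ) x = -θ x := by
  have h := integral_newt_mul_lap (contDiff_comp_sub_left hθ x)
    (hasCompactSupport_comp_sub_left hc x)
  have e : lap (fun t => θ (x - t)) = fun t => lap θ (x - t) := by
    funext t
    refine Finset.sum_congr rfl fun k _ => ?_
    rw [pd_comp_sub_left hθ]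
    have h2 := congrFun (pd_comp_sub_left (contDiff_pd hθ k) x k) t
    have h3 : pd k (fun t => -pd k θ (x - t)) t = -pd k (fun t => pd k θ (x - t)) t := by
      simp [pd]
    rw [h3, h2, neg_neg]
  rw [e, sub_zero] at h
  exact h

lemma newtPot_sum {ι : Type*} (s : Finset ι) {θ : ι → R4 → ℝ} (hθ : ∀ i ∈ s, ContDiff ℝ ∞ (θ i))
    (hc : ∀ i ∈ s, HasCompactSupport (θ i)) (x : R4) :
    newtPot (fun y => ∑ i ∈ s, θ i y) x = ∑ i ∈ s, newtPot (θ i) x := by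
  simp only [newtPot, Finset.mul_sum]
  exact integral_finsetSum _ fun i hi => integrable_mul_of_locallyIntegrable
    locallyIntegrable_newt (contDiff_comp_sub_left (hθ i hi) x).continuous
    (hasCompactSupport_comp_sub_left (hc i hi) x)

/-- Derivatives of the convolution may all be placed on θ, which reduces the claim to `newtPot_lap`.
-/
lemma lap_newtPot {θ : R4 → ℝ} (hθ : ContDiff ℝ ∞ θ) (hc : HasCompactSupport θ) (x : R4) :
    lap (newtPot θ) x = -θ x := by
  rw [← newtPot_lap hθ hc]
  have : lap θ = fun y => ∑ k, pd k (pd k θ) y := rfl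
  rw [this, newtPot_sum _ (fun k _ => contDiff_pd (contDiff_pd hθ k) k)
    (fun k _ => hasCompactSupport_pd (hasCompactSupport_pd hc k) k)]
  refine Finset.sum_congr rfl fun k _ => ?_
  rw [pd_newtPot hθ hc, pd_newtPot (contDiff_pd hθ k) (hasCompactSupport_pd hc k)]

/-- If θ lives in a ball of radius ρ and |x| ≥ 2ρ, every t that contributes has |t| ≥ |x|/2, so the
kernel can be replaced by its size at x up to 2^a. -/
lemma exists_decay_of_abs_le {κ : R4 → ℝ} {a : ℕ} (hκ : ∀ z, |κ z| ≤ ‖z‖⁻¹ ^ a) {θ : R4 → ℝ}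
    (hθ : Continuous θ) (hc : HasCompactSupport θ) :
    ∃ C R : ℝ, 0 ≤ C ∧ 0 < R ∧ ∀ x, R ≤ ‖x‖ → |∫ t, κ t * θ (x - t)| ≤ C * ‖x‖⁻¹ ^ a := by
  obtain ⟨ρ, hρ, hρ'⟩ := hc.isCompact.isBounded.subset_closedBall_lt 0 0
  have hint : Integrable θ := hθ.integrable_of_hasCompactSupport hc
  refine ⟨2 ^ a * ∫ t, |θ t|, 2 * ρ, by positivity, by positivity, fun x hx => ?_⟩
  have hx0 : 0 < ‖x‖ := by linarith
  rw [mul_right_comm, ← integral_sub_left_eq_self (fun t => |θ t|) volume x, ← integral_const_mul,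
    ← Real.norm_eq_abs]
  refine norm_integral_le_of_norm_le (((hint.comp_sub_left x).abs).const_mul _)
    (Eventually.of_forall fun t => ?_)
  rw [norm_mul, Real.norm_eq_abs, Real.norm_eq_abs]
  by_cases h : θ (x - t) = 0
  · simp [h]
  gcongr
  have h1 : ‖x - t‖ ≤ ρ := by
    simpa using hρ' (subset_tsupport _ h)
  have h2 : ‖x‖ ≤ ‖x - t‖ + ‖t‖ := by simpa using norm_add_le (x - t) t
  have h3 : ‖x‖ / 2 ≤ ‖t‖ := by linarith
  refine (hκ t).trans ?_
  rw [← mul_pow]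
  gcongr
  calc ‖t‖⁻¹ ≤ (‖x‖ / 2)⁻¹ := inv_anti₀ (by positivity) h3
    _ = 2 * ‖x‖⁻¹ := by rw [inv_div]; ring

lemma exists_decay_newtPot {θ : R4 → ℝ} (hθ : ContDiff ℝ ∞ θ) (hc : HasCompactSupport θ) :
    ∃ C R : ℝ, 0 ≤ C ∧ 0 < R ∧ ∀ x, R ≤ ‖x‖ → |newtPot θ x| ≤ C * ‖x‖⁻¹ ^ 2 :=
  exists_decay_of_abs_le (fun z => by
    rw [abs_newt]; exact mul_le_of_le_one_left (by positivity) four_pi_sq_inv_le_one)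
    hθ.continuous hc

lemma exists_decay_pd_newtPot {θ : R4 → ℝ} (hθ : ContDiff ℝ ∞ θ) (hc : HasCompactSupport θ)
    (k : Fin 4) :
    ∃ C R : ℝ, 0 ≤ C ∧ 0 < R ∧ ∀ x, R ≤ ‖x‖ → |pd k (newtPot θ) x| ≤ C * ‖x‖⁻¹ ^ 3 := by
  simp only [pd_newtPot hθ hc, newtPot_pd hθ hc]
  exact exists_decay_of_abs_le (fun z => (abs_dnewt_le k z).trans
    (mul_le_of_le_one_left (by positivity) two_pi_sq_inv_le_one)) hθ.continuous hc

lemma exists_bound_of_decay {u : R4 → ℝ} (hu : Continuous u) {C R : ℝ} {a : ℕ} (hC : 0 ≤ C)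
    (hR : 0 < R) (h : ∀ x, R ≤ ‖x‖ → |u x| ≤ C * ‖x‖⁻¹ ^ a) : ∃ M : ℝ, ∀ x, ‖u x‖ ≤ M := by
  obtain ⟨M, hM⟩ := (isCompact_closedBall (0 : R4) R).exists_bound_of_continuousOn hu.continuousOn
  refine ⟨max M (C * R⁻¹ ^ a), fun x => ?_⟩
  rcases le_total ‖x‖ R with hx | hx
  · exact (hM x (by simpa using hx)).trans (le_max_left _ _)
  · refine (h x hx).trans (le_trans ?_ (le_max_right _ _))
    gcongr

lemma exists_bound_newtPot {θ : R4 → ℝ} (hθ : ContDiff ℝ ∞ θ) (hc : HasCompactSupport θ) :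
    ∃ M : ℝ, ∀ x, ‖newtPot θ x‖ ≤ M := by
  obtain ⟨C, R, hC, hR, h⟩ := exists_decay_newtPot hθ hc
  exact exists_bound_of_decay (contDiff_newtPot hθ hc).continuous hC hR h

lemma integrable_newtPot_smul {θ : R4 → ℝ} (hθ : ContDiff ℝ ∞ θ) (hc : HasCompactSupport θ)
    {f : R4 → C4} (hf : Integrable f) : Integrable fun y => newtPot θ y • f y := by
  obtain ⟨M, hM⟩ := exists_bound_newtPot hθ hc
  exact hf.bdd_smul M (contDiff_newtPot hθ hc).continuous.aestronglyMeasurable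
    (Eventually.of_forall hM)

lemma integrable_pd_newtPot_smul {θ : R4 → ℝ} (hθ : ContDiff ℝ ∞ θ) (hc : HasCompactSupport θ)
    {f : R4 → C4} (hf : Integrable f) (k : Fin 4) :
    Integrable fun y => pd k (newtPot θ) y • f y := by
  rw [pd_newtPot hθ hc]
  exact integrable_newtPot_smul (contDiff_pd hθ k) (hasCompactSupport_pd hc k) hf

/-! ### The kernel of `𝒢₀` in terms of the Newtonian kernel -/

/-- A matrix as a continuous operator on spinors. -/
def actL (A : M4) : C4 →L[ℂ] C4 := (Matrix.toEuclideanLin A).toContinuousLinearMap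

lemma act_matrix_add (A B : M4) (w : C4) : act (A + B) w = act A w + act B w := by
  simp [act]

lemma act_matrix_smul (c : ℂ) (A : M4) (w : C4) : act (c • A) w = c • act A w := by
  simp [act]

lemma act_matrix_rsmul (c : ℝ) (A : M4) (w : C4) : act (c • A) w = c • act A w := by
  rw [← Complex.coe_smul, act_matrix_smul, Complex.coe_smul]

lemma act_matrix_sum {ι : Type*} (s : Finset ι) (A : ι → M4) (w : C4) :
    act (∑ i ∈ s, A i) w = ∑ i ∈ s, act (A i) w := by
  simp [act]

lemma act_real_smul (A : M4) (c : ℝ) (w : C4) : act A (c • w) = c • act A w :=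
  (actL A).map_smul_of_tower c w

lemma act_act (A B : M4) (w : C4) : act A (act B w) = act (A * B) w := by
  simp [act, Matrix.toLpLin_apply]

lemma act_one (w : C4) : act 1 w = w := by simp [act]

lemma act_integral (A : M4) {f : R4 → C4} (hf : Integrable f) :
    act A (∫ x, f x) = ∫ x, act A (f x) := ((actL A).integral_comp_comm hf).symm

/-- The derivative of the Newtonian kernel is odd, and evaluating it at y - x instead of x - y
supplies the sign. In this form integration in x against θ produces potentials of θ evaluated at y.
-/
lemma G0kernel_eq (m : ℝ) (x y : R4) :
    G0kernel m x y = (∑ k, (dnewt k (y - x) : ℂ) • (Complex.I • alpha k))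
      + ((newt (y - x) : ℝ) : ℂ) • ((2 * m : ℂ) • Iuc) := by
  have hn : ‖y - x‖ = ‖x - y‖ := norm_sub_rev _ _
  rw [G0kernel, Finset.smul_sum]
  congr 1
  · refine Finset.sum_congr rfl fun k _ => ?_
    rw [smul_smul, smul_smul, dnewt, hn]
    congr 1
    simp only [PiLp.sub_apply]
    push_cast
    ring
  · rw [smul_smul, newt, hn]
    congr 1
    -- On the diagonal both sides vanish because division by zero yields 0.
    rcases eq_or_ne ‖x - y‖ 0 with h | h
    · simp [h]
    · have := Real.pi_ne_zero
      rw [← Complex.ofReal_ofNat, ← Complex.ofReal_mul, ← Complex.ofReal_mul]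
      congr 1
      field_simp
      norm_num

lemma act_G0kernel (m : ℝ) (x y : R4) (w : C4) :
    act (G0kernel m x y) w = (∑ k, dnewt k (y - x) • act (Complex.I • alpha k) w)
      + newt (y - x) • act ((2 * m : ℂ) • Iuc) w := by
  rw [G0kernel_eq, act_matrix_add, act_matrix_sum]
  simp only [Complex.coe_smul, act_matrix_rsmul]

end Dirac4

end

/-! ### Absolute convergence and local integrability of 𝒢₀f for integrable f. -/

noncomputable section

namespace Dirac4
open scoped ENNReal NNReal Topology
open Metric Filter

lemma enorm_act_le (A : M4) (w : C4) : ‖act A w‖ₑ ≤ ‖actL A‖ₑ * ‖w‖ₑ :=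
  (actL A).le_opENorm w

/-- A constant with `|𝒢₀(x, y) w| ≤ const · (|x-y|⁻³ + |x-y|⁻²) |w|`. -/
def G0const (m : ℝ) : ℝ≥0∞ :=
  (∑ k, ‖actL (Complex.I • alpha k)‖ₑ) + ‖actL ((2 * m : ℂ) • Iuc)‖ₑ

lemma G0const_ne_top (m : ℝ) : G0const m ≠ ∞ := by
  unfold G0const
  exact ENNReal.add_ne_top.2 ⟨ENNReal.sum_ne_top.2 fun k _ => enorm_ne_top, enorm_ne_top⟩

lemma enorm_act_G0kernel_le (m : ℝ) (x y : R4) (w : C4) :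
    ‖act (G0kernel m x y) w‖ₑ ≤ G0const m * (kerMaj (x - y) * ‖w‖ₑ) := by
  have h3 : ∀ k, ‖dnewt k (y - x)‖ₑ ≤ kerMaj (x - y) := fun k => by
    rw [kerMaj_sub_comm]; exact (enorm_dnewt_le k _).trans le_self_add
  have h2 : ‖newt (y - x)‖ₑ ≤ kerMaj (x - y) := by
    rw [kerMaj_sub_comm]; exact (enorm_newt_le _).trans le_add_self
  rw [act_G0kernel]
  calc _ ≤ (∑ k, ‖dnewt k (y - x) • act (Complex.I • alpha k) w‖ₑ)
        + ‖newt (y - x) • act ((2 * m : ℂ) • Iuc) w‖ₑ := by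
        refine (enorm_add_le _ _).trans ?_
        gcongr
        exact enorm_sum_le _ _
    _ ≤ (∑ k, kerMaj (x - y) * (‖actL (Complex.I • alpha k)‖ₑ * ‖w‖ₑ))
        + kerMaj (x - y) * (‖actL ((2 * m : ℂ) • Iuc)‖ₑ * ‖w‖ₑ) := by
        gcongr with k
        · rw [enorm_smul]
          gcongr
          · exact h3 k
          · exact enorm_act_le _ _
        · rw [enorm_smul]
          gcongr
          exact enorm_act_le _ _
    _ = _ := by
        rw [← Finset.mul_sum, ← Finset.sum_mul, G0const]
        ring

lemma aestronglyMeasurable_act (A : M4) {α : Type*} [MeasurableSpace α] {μ : Measure α}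
    {f : α → C4} (hf : AEStronglyMeasurable f μ) :
    AEStronglyMeasurable (fun x => act A (f x)) μ :=
  (actL A).continuous.comp_aestronglyMeasurable hf

lemma aestronglyMeasurable_G0_integrand (m : ℝ) {f : R4 → C4}
    (hf : AEStronglyMeasurable f volume) :
    AEStronglyMeasurable (fun p : R4 × R4 => act (G0kernel m p.1 p.2) (f p.2))
      ((volume : Measure R4).prod volume) := by
  have h2 : AEStronglyMeasurable (fun p : R4 × R4 => f p.2)
      ((volume : Measure R4).prod volume) := hf.comp_snd
  simp only [act_G0kernel]
  refine AEStronglyMeasurable.add (Finset.aestronglyMeasurable_fun_sum _ fun k _ => ?_) ?_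
  · exact (by fun_prop : Measurable fun p : R4 × R4 => dnewt k (p.2 - p.1)).aestronglyMeasurable.smul
      (aestronglyMeasurable_act _ h2)
  · exact (by fun_prop : Measurable fun p : R4 × R4 => newt (p.2 - p.1)).aestronglyMeasurable.smul
      (aestronglyMeasurable_act _ h2)

lemma aestronglyMeasurable_G0_section (m : ℝ) {f : R4 → C4}
    (hf : AEStronglyMeasurable f volume) (x : R4) :
    AEStronglyMeasurable (fun y => act (G0kernel m x y) (f y)) volume := by
  simp only [act_G0kernel]
  refine AEStronglyMeasurable.add (Finset.aestronglyMeasurable_fun_sum _ fun k _ => ?_) ?_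
  · exact (by fun_prop : Measurable fun y : R4 => dnewt k (y - x)).aestronglyMeasurable.smul
      (aestronglyMeasurable_act _ hf)
  · exact (by fun_prop : Measurable fun y : R4 => newt (y - x)).aestronglyMeasurable.smul
      (aestronglyMeasurable_act _ hf)

lemma aestronglyMeasurable_G0 (m : ℝ) {f : R4 → C4} (hf : AEStronglyMeasurable f volume) :
    AEStronglyMeasurable (G0 m f) volume :=
  (aestronglyMeasurable_G0_integrand m hf).integral_prod_right'

lemma lintegral_enorm_G0_section_le (m : ℝ) (f : R4 → C4) (x : R4) :
    ∫⁻ y, ‖act (G0kernel m x y) (f y)‖ₑ ≤ G0const m * majPot (fun y => ‖f y‖ₑ) x := by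
  rw [majPot, ← lintegral_const_mul' _ _ (G0const_ne_top m)]
  exact lintegral_mono fun y => enorm_act_G0kernel_le m x y _

lemma enorm_G0_le (m : ℝ) (f : R4 → C4) (x : R4) :
    ‖G0 m f x‖ₑ ≤ G0const m * majPot (fun y => ‖f y‖ₑ) x :=
  (enorm_integral_le_lintegral_enorm _).trans (lintegral_enorm_G0_section_le m f x)

lemma setLIntegral_majPot_enorm_lt_top {f : R4 → C4} (hf : Integrable f) {K : Set R4}
    (hK : IsCompact K) : ∫⁻ x in K, majPot (fun y => ‖f y‖ₑ) x < ∞ := by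
  have hm : AEMeasurable (fun y => ‖f y‖ₑ) volume := hf.1.enorm
  rw [majPot_congr hm.ae_eq_mk]
  refine setLIntegral_majPot_lt_top hm.measurable_mk ?_ hK
  rw [← lintegral_congr_ae hm.ae_eq_mk]
  exact hf.2.ne

/-- Local integrability gives finiteness almost everywhere on each ball of integer radius, and these
balls exhaust ℝ⁴. -/
lemma ae_majPot_enorm_lt_top {f : R4 → C4} (hf : Integrable f) :
    ∀ᵐ x, majPot (fun y => ‖f y‖ₑ) x < ∞ := by
  have hm : AEMeasurable (fun y => ‖f y‖ₑ) volume := hf.1.enorm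
  have hmeas : Measurable (majPot fun y => ‖f y‖ₑ) := by
    rw [majPot_congr hm.ae_eq_mk]; exact measurable_majPot hm.measurable_mk
  have h : ∀ n : ℕ, ∀ᵐ x ∂(volume.restrict (closedBall (0 : R4) n)),
      majPot (fun y => ‖f y‖ₑ) x < ∞ := fun n =>
    ae_lt_top hmeas (setLIntegral_majPot_enorm_lt_top hf (isCompact_closedBall _ _)).ne
  rw [← ae_restrict_iUnion_iff, iUnion_closedBall_nat, Measure.restrict_univ] at h
  exact h

lemma G0Converges_of_integrable (m : ℝ) {f : R4 → C4} (hf : Integrable f) : G0Converges m f := by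
  filter_upwards [ae_majPot_enorm_lt_top hf] with x hx
  refine ⟨aestronglyMeasurable_G0_section m hf.1 x, ?_⟩
  exact (lintegral_enorm_G0_section_le m f x).trans_lt
    (ENNReal.mul_lt_top (G0const_ne_top m).lt_top hx)

lemma locallyIntegrable_G0 (m : ℝ) {f : R4 → C4} (hf : Integrable f) :
    LocallyIntegrable (G0 m f) volume := by
  refine locallyIntegrable_iff.2 fun K hK => ⟨(aestronglyMeasurable_G0 m hf.1).restrict, ?_⟩
  calc ∫⁻ x in K, ‖G0 m f x‖ₑ ≤ ∫⁻ x in K, G0const m * majPot (fun y => ‖f y‖ₑ) x :=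
        lintegral_mono fun x => enorm_G0_le m f x
    _ = G0const m * ∫⁻ x in K, majPot (fun y => ‖f y‖ₑ) x :=
        lintegral_const_mul' _ _ (G0const_ne_top m)
    _ < ∞ := ENNReal.mul_lt_top (G0const_ne_top m).lt_top
        (setLIntegral_majPot_enorm_lt_top hf hK)

end Dirac4

/-! ### Transposition of 𝒢₀ onto test functions. -/

namespace Dirac4
open scoped ContDiff Topology
open Metric Filter

/-- This justifies Fubini's theorem in `integral_smul_G0`: θ is bounded and confines x to a compact
set, where the majorant potential of |f| is integrable. -/
lemma integrable_smul_G0_integrand (m : ℝ) {f : R4 → C4} (hf : Integrable f) {θ : R4 → ℝ}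
    (hθ : Continuous θ) (hc : HasCompactSupport θ) :
    Integrable (fun p : R4 × R4 => θ p.1 • act (G0kernel m p.1 p.2) (f p.2))
      ((volume : Measure R4).prod volume) := by
  have hmeas : AEStronglyMeasurable
      (fun p : R4 × R4 => θ p.1 • act (G0kernel m p.1 p.2) (f p.2))
      ((volume : Measure R4).prod volume) :=
    (hθ.comp continuous_fst).aestronglyMeasurable.smul (aestronglyMeasurable_G0_integrand m hf.1)
  refine ⟨hmeas, ?_⟩
  obtain ⟨M, hM⟩ := hθ.bounded_above_of_compact_support hc
  rw [HasFiniteIntegral, lintegral_prod _ hmeas.enorm]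
  have hC : G0const m ≠ ⊤ := G0const_ne_top m
  calc ∫⁻ x, ∫⁻ y, ‖θ x • act (G0kernel m x y) (f y)‖ₑ
      ≤ ∫⁻ x, (tsupport θ).indicator
          (fun x => ENNReal.ofReal M * (G0const m * majPot (fun y => ‖f y‖ₑ) x)) x := by
        refine lintegral_mono fun x => ?_
        by_cases hx : x ∈ tsupport θ
        · rw [Set.indicator_of_mem hx]
          simp only [enorm_smul]
          rw [lintegral_const_mul' _ _ enorm_ne_top]
          gcongr
          · rw [← ofReal_norm]
            exact ENNReal.ofReal_le_ofReal (hM x)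
          · exact lintegral_enorm_G0_section_le m f x
        · simp [image_eq_zero_of_notMem_tsupport hx]
    _ = ENNReal.ofReal M * (G0const m * ∫⁻ x in tsupport θ, majPot (fun y => ‖f y‖ₑ) x) := by
        rw [lintegral_indicator (isClosed_tsupport θ).measurableSet,
          lintegral_const_mul' _ _ ENNReal.ofReal_ne_top, lintegral_const_mul' _ _ hC]
    _ < ⊤ := ENNReal.mul_lt_top ENNReal.ofReal_lt_top
        (ENNReal.mul_lt_top hC.lt_top (setLIntegral_majPot_enorm_lt_top hf hc))

lemma integral_mul_comp_sub (κ θ : R4 → ℝ) (y : R4) :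
    ∫ x, θ x * κ (y - x) = ∫ t, κ t * θ (y - t) := by
  rw [← integral_sub_left_eq_self (fun x => θ x * κ (y - x)) volume y]
  simp only [sub_sub_cancel, mul_comm]

lemma integrable_mul_comp_sub {κ θ : R4 → ℝ} (hκ : LocallyIntegrable κ volume)
    (hθ : Continuous θ) (hc : HasCompactSupport θ) (y : R4) :
    Integrable fun x => θ x * κ (y - x) := by
  have h : Integrable fun t => κ t * θ (y - t) :=
    integrable_mul_of_locallyIntegrable hκ (hθ.comp (continuous_const.sub continuous_id))
      (hc.comp_homeomorph (Homeomorph.subLeft y))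
  have h2 := h.comp_sub_left y
  simpa only [sub_sub_cancel, mul_comm] using h2

/-- Transposition of `𝒢₀`: testing `𝒢₀ f` against `θ` amounts to testing `f` against the Newtonian
potential of `θ` and its derivatives. -/
theorem integral_smul_G0 (m : ℝ) {f : R4 → C4} (hf : Integrable f) {θ : R4 → ℝ}
    (hθ : ContDiff ℝ ∞ θ) (hc : HasCompactSupport θ) :
    ∫ x, θ x • G0 m f x =
      (∑ k, act (Complex.I • alpha k) (∫ y, pd k (newtPot θ) y • f y))
        + act ((2 * m : ℂ) • Iuc) (∫ y, newtPot θ y • f y) := by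
  have hint := integrable_smul_G0_integrand m hf hθ.continuous hc
  have h1 : ∀ y, ∫ x, θ x • act (G0kernel m x y) (f y) =
      (∑ k, pd k (newtPot θ) y • act (Complex.I • alpha k) (f y))
        + newtPot θ y • act ((2 * m : ℂ) • Iuc) (f y) := by
    intro y
    have hi : ∀ k, Integrable fun x => (θ x * dnewt k (y - x)) • act (Complex.I • alpha k) (f y) :=
      fun k => (integrable_mul_comp_sub (locallyIntegrable_dnewt k) hθ.continuous hc y).smul_const _
    have hi2 : Integrable fun x => (θ x * newt (y - x)) • act ((2 * m : ℂ) • Iuc) (f y) :=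
      (integrable_mul_comp_sub locallyIntegrable_newt hθ.continuous hc y).smul_const _
    simp only [act_G0kernel, smul_add, Finset.smul_sum, smul_smul]
    rw [integral_add (integrable_finsetSum _ fun k _ => hi k) hi2,
      integral_finsetSum _ fun k _ => hi k]
    have e1 : ∀ k, ∫ x, θ x * dnewt k (y - x) = pd k (newtPot θ) y := fun k => by
      rw [integral_mul_comp_sub (dnewt k), pd_newtPot hθ hc, newtPot_pd hθ hc]
    have e2 : ∫ x, θ x * newt (y - x) = newtPot θ y := integral_mul_comp_sub newt θ y
    simp only [integral_smul_const, e1, e2]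
  simp only [G0, ← integral_smul]
  rw [integral_integral_swap hint]
  simp only [h1]
  have hi : ∀ k, Integrable fun y => pd k (newtPot θ) y • act (Complex.I • alpha k) (f y) :=
    fun k => integrable_pd_newtPot_smul hθ hc ((actL _).integrable_comp hf) k
  have hi2 : Integrable fun y => newtPot θ y • act ((2 * m : ℂ) • Iuc) (f y) :=
    integrable_newtPot_smul hθ hc ((actL _).integrable_comp hf)
  rw [integral_add (integrable_finsetSum _ fun k _ => hi k) hi2,
    integral_finsetSum _ fun k _ => hi k, act_integral _ (integrable_newtPot_smul hθ hc hf)]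
  congr 1
  · refine Finset.sum_congr rfl fun k _ => ?_
    rw [act_integral _ (integrable_pd_newtPot_smul hθ hc hf k)]
    simp only [act_real_smul]
  · simp only [act_real_smul]

end Dirac4

end

noncomputable section

namespace Dirac4
open scoped NNReal ContDiff Topology
open Metric Filter

/-! ### Clifford relations -/

lemma one_eq_fin_four : (1 : M4) = !![1, 0, 0, 0; 0, 1, 0, 0; 0, 0, 1, 0; 0, 0, 0, 1] := by
  ext a b; fin_cases a <;> fin_cases b <;> rfl

lemma zero_eq_fin_four : (0 : M4) = !![0, 0, 0, 0; 0, 0, 0, 0; 0, 0, 0, 0; 0, 0, 0, 0] := by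
  ext a b; fin_cases a <;> fin_cases b <;> rfl

lemma alpha_anticomm (j k : Fin 4) :
    alpha j * alpha k + alpha k * alpha j = if j = k then (2 : ℂ) • 1 else 0 := by
  rw [one_eq_fin_four, zero_eq_fin_four]
  fin_cases j <;> fin_cases k <;> simp [alpha] <;> norm_num

lemma alpha_beta_anticomm (k : Fin 4) : alpha k * beta + beta * alpha k = 0 := by
  rw [zero_eq_fin_four]
  fin_cases k <;> simp [alpha, beta]

lemma beta_mul_beta : beta * beta = 1 := by
  rw [one_eq_fin_four]
  simp [beta]

lemma two_mul_Iuc (m : ℝ) : ((2 * m : ℂ) • Iuc : M4) = (m : ℂ) • beta + (m : ℂ) • 1 := by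
  ext a b
  fin_cases a <;> fin_cases b <;> simp [beta, Iuc] <;> ring

/-- The matrix `i αₖ`. -/
def ialpha (k : Fin 4) : M4 := Complex.I • alpha k

lemma ialpha_anticomm (j k : Fin 4) :
    ialpha j * ialpha k + ialpha k * ialpha j = if j = k then (-2 : ℂ) • 1 else 0 := by
  simp only [ialpha, smul_mul_smul_comm, Complex.I_mul_I, ← smul_add, alpha_anticomm]
  split_ifs <;> simp

lemma ialpha_beta (k : Fin 4) : beta * ialpha k = -(ialpha k * beta) := by
  rw [eq_neg_iff_add_eq_zero, add_comm, ialpha, smul_mul_assoc, mul_smul_comm, ← smul_add,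
    alpha_beta_anticomm, smul_zero]

lemma act_matrix_neg (A : M4) (w : C4) : act (-A) w = -act A w := by simp [act]
lemma act_matrix_sub (A B : M4) (w : C4) : act (A - B) w = act A w - act B w := by simp [act]
lemma act_neg (A : M4) (w : C4) : act A (-w) = -act A w := map_neg (actL A) w
lemma act_sum (A : M4) {ι : Type*} (s : Finset ι) (w : ι → C4) :
    act A (∑ i ∈ s, w i) = ∑ i ∈ s, act A (w i) := map_sum (actL A) w s

/-- Contracting a symmetric family against `(i αⱼ)(i αₖ)` yields minus its trace. -/
lemma sum_ialpha_ialpha {a : Fin 4 → Fin 4 → C4} (ha : ∀ j k, a j k = a k j) :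
    ∑ j, ∑ k, act (ialpha j) (act (ialpha k) (a j k)) = -∑ k, a k k := by
  set S := ∑ j, ∑ k, act (ialpha j) (act (ialpha k) (a j k)) with hS
  have h1 : S = ∑ j, ∑ k, act (ialpha k) (act (ialpha j) (a j k)) := by
    -- Renaming the indices and using the symmetry of the family reverses the order of the matrices,
    -- so S + S involves only anticommutators.
    rw [hS, Finset.sum_comm]
    simp only [ha]
  have h2 : S + S = (2 : ℂ) • -∑ k, a k k := by
    nth_rewrite 2 [h1]
    rw [hS, ← Finset.sum_add_distrib]
    simp only [← Finset.sum_add_distrib, act_act, ← act_matrix_add, ialpha_anticomm]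
    have : ∀ j k, act (if j = k then (-2 : ℂ) • (1 : M4) else 0) (a j k) =
        if j = k then (-2 : ℂ) • a j k else 0 := by
      intro j k
      split_ifs
      · rw [act_matrix_smul, act_one]
      · simp [act]
    simp only [this]
    simp [← Finset.smul_sum]
  rw [← two_smul ℂ] at h2
  exact smul_right_injective _ (two_ne_zero' ℂ) h2

/-! ### The weak form of the equation -/

lemma pd_comm {u : R4 → ℝ} (hu : ContDiff ℝ ∞ u) (j k : Fin 4) (x : R4) :
    pd j (pd k u) x = pd k (pd j u) x := by
  have hs : IsSymmSndFDerivAt ℝ u x := hu.contDiffAt.isSymmSndFDerivAt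
    (by simpa using WithTop.coe_le_coe.2 (le_top : (2 : ℕ∞) ≤ ⊤))
  have hd : DifferentiableAt ℝ (fderiv ℝ u) x :=
    ((hu.fderiv_right (m := ∞) le_rfl).differentiable (by simp)).differentiableAt
  have h : ∀ v w : R4, fderiv ℝ (fun y => fderiv ℝ u y v) x w = fderiv ℝ (fderiv ℝ u) x w v := by
    intro v w
    rw [fderiv_clm_apply hd (differentiableAt_const v)]
    simp
  unfold pd
  rw [h, h]
  exact hs _ _

/-- The weak form of `(D_m - m) ψ + f = 0`. -/
def DiracWeak (m : ℝ) (ψ f : R4 → C4) : Prop :=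
  ∀ θ : R4 → ℝ, ContDiff ℝ ∞ θ → HasCompactSupport θ →
    (∑ k, act (ialpha k) (∫ x, pd k θ x • ψ x)) + act ((m : ℂ) • beta) (∫ x, θ x • ψ x)
      + (∫ x, θ x • f x) - m • ∫ x, θ x • ψ x = 0

lemma integrable_test_smul {θ : R4 → ℝ} (hθ : ContDiff ℝ ∞ θ) (hc : HasCompactSupport θ)
    {ψ : R4 → C4} (hψ : LocallyIntegrable ψ volume) : Integrable fun x => θ x • ψ x :=
  hψ.integrable_smul_left_of_hasCompactSupport hθ.continuous hc

/-- This and the next three identities are the algebra behind D_m² - m² = -Δ: β² = 1 removes the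
zeroth-order terms, and anticommutation of β with each αₖ removes the first-order ones. -/
lemma dirac_square (m : ℝ) : ((m : ℂ) • beta + (m : ℂ) • 1) * ((m : ℂ) • beta - (m : ℂ) • 1) =
    (0 : M4) := by
  simp only [add_mul, mul_sub, smul_mul_smul_comm, beta_mul_beta, mul_one, one_mul]
  abel

lemma dirac_square' (m : ℝ) : ((m : ℂ) • beta - (m : ℂ) • 1) * ((m : ℂ) • beta + (m : ℂ) • 1) =
    (0 : M4) := by
  simp only [sub_mul, mul_add, smul_mul_smul_comm, beta_mul_beta, mul_one, one_mul]
  abel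

lemma dirac_cross (m : ℝ) (k : Fin 4) : ialpha k * ((m : ℂ) • beta - (m : ℂ) • 1)
    + ((m : ℂ) • beta + (m : ℂ) • 1) * ialpha k = 0 := by
  simp only [add_mul, mul_sub, smul_mul_assoc, mul_smul_comm, mul_one, one_mul, ialpha_beta]
  rw [smul_neg]
  abel

lemma dirac_cross' (m : ℝ) (k : Fin 4) : ialpha k * ((m : ℂ) • beta + (m : ℂ) • 1)
    + ((m : ℂ) • beta - (m : ℂ) • 1) * ialpha k = 0 := by
  simp only [sub_mul, mul_add, smul_mul_assoc, mul_smul_comm, mul_one, one_mul, ialpha_beta]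
  rw [smul_neg]
  abel

lemma diracWeak_iff (m : ℝ) (ψ f : R4 → C4) : DiracWeak m ψ f ↔
    ∀ θ : R4 → ℝ, ContDiff ℝ ∞ θ → HasCompactSupport θ →
      (∑ k, act (ialpha k) (∫ x, pd k θ x • ψ x))
        + act ((m : ℂ) • beta - (m : ℂ) • 1) (∫ x, θ x • ψ x) + (∫ x, θ x • f x) = 0 := by
  refine forall₃_congr fun θ _ _ => ?_
  rw [act_matrix_sub, act_matrix_smul _ 1, act_one, Complex.coe_smul m (∫ x, θ x • ψ x)]
  constructor <;> intro h <;> rw [← h] <;> abel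

/-- Applying `D_m + m` to `(D_m - m) ψ + f = 0`. -/
lemma DiracWeak.laplace {m : ℝ} {ψ f : R4 → C4} (h : DiracWeak m ψ f)
    (hψ : LocallyIntegrable ψ volume) {θ : R4 → ℝ} (hθ : ContDiff ℝ ∞ θ)
    (hc : HasCompactSupport θ) :
    ∫ x, lap θ x • ψ x = (∑ k, act (ialpha k) (∫ x, pd k θ x • f x))
      + act ((2 * m : ℂ) • Iuc) (∫ x, θ x • f x) := by
  rw [diracWeak_iff] at h
  set N : M4 := (m : ℂ) • beta - (m : ℂ) • 1 with hN
  set P : M4 := (m : ℂ) • beta + (m : ℂ) • 1 with hP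
  -- Testing with each ∂ⱼθ and with θ, and contracting with i αⱼ and with P, is the transposed form
  -- of applying D_m + m.
  have h1 := fun j => h _ (contDiff_pd hθ j) (hasCompactSupport_pd hc j)
  have h2 : (∑ j, act (ialpha j) ((∑ k, act (ialpha k) (∫ x, pd k (pd j θ) x • ψ x))
        + act N (∫ x, pd j θ x • ψ x) + (∫ x, pd j θ x • f x)))
      + act P ((∑ k, act (ialpha k) (∫ x, pd k θ x • ψ x))
        + act N (∫ x, θ x • ψ x) + (∫ x, θ x • f x)) = 0 := by
    simp only [h1, h θ hθ hc, act_zero, Finset.sum_const_zero, add_zero]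
  simp only [act_add, act_sum, Finset.sum_add_distrib] at h2
  rw [sum_ialpha_ialpha (a := fun j k => ∫ x, pd k (pd j θ) x • ψ x)
    (fun j k => by simp only [pd_comm hθ j k])] at h2
  have hlap : ∑ k, ∫ x, pd k (pd k θ) x • ψ x = ∫ x, lap θ x • ψ x := by
    simp only [lap, Finset.sum_smul]
    rw [integral_finsetSum]
    exact fun k _ => integrable_test_smul (contDiff_pd (contDiff_pd hθ k) k)
      (hasCompactSupport_pd (hasCompactSupport_pd hc k) k) hψ
  have hcross : (∑ k, act (ialpha k) (act N (∫ x, pd k θ x • ψ x)))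
      + ∑ k, act P (act (ialpha k) (∫ x, pd k θ x • ψ x)) = 0 := by
    rw [← Finset.sum_add_distrib]
    refine Finset.sum_eq_zero fun k _ => ?_
    rw [act_act, act_act, ← act_matrix_add, dirac_cross]
    simp [act]
  have hsq : act P (act N (∫ x, θ x • ψ x)) = 0 := by
    rw [act_act, dirac_square]
    simp [act]
  rw [hlap, hsq, add_zero] at h2
  rw [two_mul_Iuc, ← hP, ← sub_eq_zero, ← neg_eq_zero, ← h2, ← sub_eq_zero, ← neg_eq_zero, ← hcross]
  abel

/-- `-𝒢₀ f` solves `(D_m - m) ψ + f = 0` weakly. -/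
lemma diracWeak_neg_G0 (m : ℝ) {f : R4 → C4} (hf : Integrable f) :
    DiracWeak m (fun x => -G0 m f x) f := by
  rw [diracWeak_iff]
  intro θ hθ hc
  have hG : ∀ {θ : R4 → ℝ}, ContDiff ℝ ∞ θ → HasCompactSupport θ → ∫ x, θ x • -G0 m f x =
      -((∑ k, act (ialpha k) (∫ y, pd k (newtPot θ) y • f y))
        + act ((2 * m : ℂ) • Iuc) (∫ y, newtPot θ y • f y)) := by
    intro θ hθ hc
    simp only [smul_neg]
    rw [integral_neg, integral_smul_G0 m hf hθ hc]
    rfl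
  rw [hG hθ hc]
  simp only [fun k => hG (contDiff_pd hθ k) (hasCompactSupport_pd hc k), ← pd_newtPot hθ hc,
    two_mul_Iuc]
  set N : M4 := (m : ℂ) • beta - (m : ℂ) • 1 with hN
  set P : M4 := (m : ℂ) • beta + (m : ℂ) • 1 with hP
  set u := newtPot θ with hu
  have hus : ContDiff ℝ ∞ u := contDiff_newtPot hθ hc
  simp only [act_neg, act_add, act_sum, Finset.sum_neg_distrib, Finset.sum_add_distrib]
  rw [sum_ialpha_ialpha (a := fun j k => ∫ x, pd k (pd j u) x • f x)
    (fun j k => by simp only [pd_comm hus j k])]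
  -- The second-order term is the Laplacian of the Newtonian potential of θ, and this is what
  -- recovers the source.
  have hlap : ∑ k, ∫ x, pd k (pd k u) x • f x = -∫ x, θ x • f x := by
    rw [← integral_finsetSum, ← integral_neg]
    · refine integral_congr_ae (Eventually.of_forall fun x => ?_)
      simp only [← Finset.sum_smul]
      rw [← neg_smul, ← lap_newtPot hθ hc]
      rfl
    · intro k _
      rw [hu, pd_newtPot hθ hc]
      exact integrable_pd_newtPot_smul (contDiff_pd hθ k) (hasCompactSupport_pd hc k) hf k
  have hcross : (∑ k, act (ialpha k) (act P (∫ x, pd k u x • f x)))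
      + ∑ k, act N (act (ialpha k) (∫ x, pd k u x • f x)) = 0 := by
    rw [← Finset.sum_add_distrib]
    refine Finset.sum_eq_zero fun k _ => ?_
    rw [act_act, act_act, ← act_matrix_add, dirac_cross']
    simp [act]
  have hsq : act N (act P (∫ x, u x • f x)) = 0 := by
    rw [act_act, dirac_square']
    simp [act]
  rw [hlap, hsq, add_zero, ← neg_eq_zero, ← hcross]
  abel

/-! ### Distributional solutions -/

lemma toDistr_apply {f : R4 → C4} (hf : LocallyIntegrable f volume)
    (η : 𝓓((⊤ : TopologicalSpace.Opens R4), ℝ)) : toDistr f η = ∫ x, η x • f x :=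
  TestFunction.integralAgainstBilinCLM_eq_integral (hf.locallyIntegrableOn _)

lemma lineDeriv_testFunction_apply (η : 𝓓((⊤ : TopologicalSpace.Opens R4), ℝ)) (k : Fin 4)
    (x : R4) : (∂_{(EuclideanSpace.single k (1 : ℝ) : R4)} η) x = pd k η x := by
  have h : DifferentiableAt ℝ (η : R4 → ℝ) x :=
    (η.contDiff.differentiable (by simp)).differentiableAt
  rw [pd, ← h.lineDeriv_eq_fderiv]
  exact TestFunction.lineDerivCLM_apply_of_le (by simp)

/-- The sign from the definition of a distributional derivative turns -i αₖ into i αₖ, as in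
`DiracWeak`. -/
lemma freeDirac_toDistr_apply (m : ℝ) {ψ : R4 → C4} (hψ : LocallyIntegrable ψ volume)
    (η : 𝓓((⊤ : TopologicalSpace.Opens R4), ℝ)) :
    freeDirac m (toDistr ψ) η = (∑ k, act (ialpha k) (∫ x, pd k η x • ψ x))
      + act ((m : ℂ) • beta) (∫ x, η x • ψ x) := by
  have h1 : ∀ (A : M4) (T : Distr), actDistr A T η = act A (T η) := fun A T => rfl
  have h2 : freeDirac m (toDistr ψ) η =
      (∑ k, actDistr ((-Complex.I) • alpha k)
        (∂_{(EuclideanSpace.single k (1 : ℝ) : R4)} (toDistr ψ)) η)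
      + actDistr ((m : ℂ) • beta) (toDistr ψ) η := by
    rw [freeDirac, _root_.add_apply]
    congr 1
  have h3 : ∀ k : Fin 4, (∂_{(EuclideanSpace.single k (1 : ℝ) : R4)} (toDistr ψ)) η =
      -∫ x, pd k η x • ψ x := by
    intro k
    rw [Distribution.lineDerivOp_apply_apply, map_neg, toDistr_apply hψ]
    simp only [lineDeriv_testFunction_apply]
  rw [h2]
  simp only [h1, h3, toDistr_apply hψ, act_neg, ialpha, neg_smul, act_matrix_neg, neg_neg]

lemma isDistributionalSolution_iff (m : ℝ) (V : R4 → M4) (ψ : R4 → C4) :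
    IsDistributionalSolution m V ψ ↔ LocallyIntegrable ψ volume ∧
      LocallyIntegrable (fun x => act (V x) (ψ x)) volume ∧
      DiracWeak m ψ (fun x => act (V x) (ψ x)) := by
  refine and_congr_right fun h1 => and_congr_right fun h2 => ?_
  have key : ∀ η : 𝓓((⊤ : TopologicalSpace.Opens R4), ℝ),
      (freeDirac m (toDistr ψ) + toDistr (fun x => act (V x) (ψ x)) - m • toDistr ψ) η =
      (∑ k, act (ialpha k) (∫ x, pd k η x • ψ x)) + act ((m : ℂ) • beta) (∫ x, η x • ψ x)
      + (∫ x, η x • act (V x) (ψ x)) - m • ∫ x, η x • ψ x := by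
    intro η
    rw [← freeDirac_toDistr_apply m h1, ← toDistr_apply h1, ← toDistr_apply h2]
    rfl
  constructor
  · intro h θ hθ hc
    have := key ⟨θ, hθ, hc, by simp⟩
    rw [h] at this
    exact this.symm
  · intro h
    ext1 η
    rw [key η]
    exact h η η.contDiff η.hasCompactSupport

end Dirac4

end

/-! ### Cut-offs and Liouville uniqueness in L^{2,-σ}. -/

noncomputable section

namespace Dirac4
open scoped NNReal ContDiff Topology
open Metric Filter

lemma pd_mul {χ u : R4 → ℝ} (hχ : ContDiff ℝ ∞ χ) (hu : ContDiff ℝ ∞ u) (k : Fin 4) :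
    pd k (fun x => χ x * u x) = fun x => χ x * pd k u x + pd k χ x * u x := by
  funext x
  have h1 := (hχ.differentiable (by simp)).differentiableAt (x := x)
  have h2 := (hu.differentiable (by simp)).differentiableAt (x := x)
  simp only [pd]
  rw [fderiv_fun_mul h1 h2]
  simp
  ring

lemma pd_add {χ u : R4 → ℝ} (hχ : ContDiff ℝ ∞ χ) (hu : ContDiff ℝ ∞ u) (k : Fin 4) :
    pd k (fun x => χ x + u x) = fun x => pd k χ x + pd k u x := by
  funext x
  have h1 := (hχ.differentiable (by simp)).differentiableAt (x := x)
  have h2 := (hu.differentiable (by simp)).differentiableAt (x := x)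
  simp only [pd]
  rw [fderiv_fun_add h1 h2]
  simp

lemma lap_mul {χ u : R4 → ℝ} (hχ : ContDiff ℝ ∞ χ) (hu : ContDiff ℝ ∞ u) (x : R4) :
    lap (fun x => χ x * u x) x =
      χ x * lap u x + (2 * ∑ k, pd k χ x * pd k u x + lap χ x * u x) := by
  have h : ∀ k, pd k (pd k (fun x => χ x * u x)) x =
      χ x * pd k (pd k u) x + (2 * (pd k χ x * pd k u x) + pd k (pd k χ) x * u x) := by
    intro k
    rw [pd_mul hχ hu, pd_add (hχ.mul (contDiff_pd hu k)) ((contDiff_pd hχ k).mul hu),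
      pd_mul hχ (contDiff_pd hu k), pd_mul (contDiff_pd hχ k) hu]
    ring
  simp only [lap, h, Finset.sum_add_distrib, Finset.mul_sum, Finset.sum_mul]

lemma contDiff_comp_smul {χ : R4 → ℝ} (hχ : ContDiff ℝ ∞ χ) (c : ℝ) :
    ContDiff ℝ ∞ fun x => χ (c • x) := hχ.comp (contDiff_const_smul c)

lemma pd_comp_smul {χ : R4 → ℝ} (hχ : ContDiff ℝ ∞ χ) (c : ℝ) (k : Fin 4) :
    pd k (fun x => χ (c • x)) = fun x => c * pd k χ (c • x) := by
  funext x
  have h1 : HasFDerivAt χ (fderiv ℝ χ (c • x)) (c • x) :=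
    (hχ.differentiable (by simp)).differentiableAt.hasFDerivAt
  have h2 : HasFDerivAt (fun x : R4 => c • x) (c • ContinuousLinearMap.id ℝ R4) x :=
    (hasFDerivAt_id x).const_smul c
  rw [pd, show fderiv ℝ (fun x => χ (c • x)) x = _ from (h1.comp x h2).fderiv]
  simp [pd]

lemma lap_comp_smul {χ : R4 → ℝ} (hχ : ContDiff ℝ ∞ χ) (c : ℝ) (x : R4) :
    lap (fun x => χ (c • x)) x = c ^ 2 * lap χ (c • x) := by
  simp only [lap, Finset.mul_sum]
  refine Finset.sum_congr rfl fun k _ => ?_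
  rw [pd_comp_smul hχ, pd_mul contDiff_const (contDiff_comp_smul (contDiff_pd hχ k) c),
    pd_comp_smul (contDiff_pd hχ k)]
  simp [pd]
  ring

/-- A smooth cut-off function, equal to `1` on the unit ball and supported in the ball of
radius `2`. -/
def cutoff : R4 → ℝ := (⟨1, 2, by norm_num, by norm_num⟩ : ContDiffBump (0 : R4))

lemma contDiff_cutoff : ContDiff ℝ ∞ cutoff := ContDiffBump.contDiff _

lemma hasCompactSupport_cutoff : HasCompactSupport cutoff := ContDiffBump.hasCompactSupport _

lemma cutoff_eq_one {x : R4} (hx : ‖x‖ ≤ 1) : cutoff x = 1 :=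
  ContDiffBump.one_of_mem_closedBall _ (by simpa using hx)

lemma cutoff_eq_zero {x : R4} (hx : 2 ≤ ‖x‖) : cutoff x = 0 :=
  ContDiffBump.zero_of_le_dist _ (by simpa using hx)

lemma abs_cutoff_le_one (x : R4) : |cutoff x| ≤ 1 :=
  abs_le.2 ⟨neg_one_lt_zero.le.trans (ContDiffBump.nonneg _), ContDiffBump.le_one _⟩

lemma pd_eq_zero_of_eqOn {χ : R4 → ℝ} {c : ℝ} {U : Set R4} (hU : IsOpen U)
    (h : ∀ x ∈ U, χ x = c) (k : Fin 4) {x : R4} (hx : x ∈ U) : pd k χ x = 0 := by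
  have : χ =ᶠ[𝓝 x] fun _ => c := by
    filter_upwards [hU.mem_nhds hx] with y hy using h y hy
  rw [pd, this.fderiv_eq]
  simp

lemma isOpen_norm_gt_two : IsOpen {x : R4 | 2 < ‖x‖} := isOpen_lt continuous_const continuous_norm

lemma isOpen_norm_lt_one : IsOpen {x : R4 | ‖x‖ < 1} := isOpen_lt continuous_norm continuous_const

lemma pd_cutoff_eq_zero (k : Fin 4) {x : R4} (hx : ‖x‖ < 1 ∨ 2 < ‖x‖) : pd k cutoff x = 0 := by
  rcases hx with hx | hx
  · exact pd_eq_zero_of_eqOn (c := 1) isOpen_norm_lt_one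
      (fun y (hy : ‖y‖ < 1) => cutoff_eq_one hy.le) k hx
  · exact pd_eq_zero_of_eqOn (c := 0) isOpen_norm_gt_two
      (fun y (hy : 2 < ‖y‖) => cutoff_eq_zero hy.le) k hx

lemma lap_cutoff_eq_zero {x : R4} (hx : ‖x‖ < 1 ∨ 2 < ‖x‖) : lap cutoff x = 0 := by
  refine Finset.sum_eq_zero fun k _ => ?_
  rcases hx with hx | hx
  · exact pd_eq_zero_of_eqOn (c := 0) isOpen_norm_lt_one
      (fun y hy => pd_cutoff_eq_zero k (Or.inl hy)) k hx
  · exact pd_eq_zero_of_eqOn (c := 0) isOpen_norm_gt_two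
      (fun y hy => pd_cutoff_eq_zero k (Or.inr hy)) k hx

lemma exists_bound_pd_cutoff (k : Fin 4) : ∃ M : ℝ, ∀ x, ‖pd k cutoff x‖ ≤ M :=
  (contDiff_pd contDiff_cutoff k).continuous.bounded_above_of_compact_support
    (hasCompactSupport_pd hasCompactSupport_cutoff k)

lemma exists_bound_lap_cutoff : ∃ M : ℝ, ∀ x, ‖lap cutoff x‖ ≤ M :=
  (contDiff_lap contDiff_cutoff).continuous.bounded_above_of_compact_support
    (hasCompactSupport_lap hasCompactSupport_cutoff)

/-- The commutator of the Laplacian with the cut-off at scale `R`, applied to `u`. -/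
def cutoffError (u : R4 → ℝ) (R : ℝ) (x : R4) : ℝ :=
  2 * ∑ k, (R⁻¹ * pd k cutoff (R⁻¹ • x)) * pd k u x + R⁻¹ ^ 2 * lap cutoff (R⁻¹ • x) * u x

lemma lap_cutoff_mul {u : R4 → ℝ} (hu : ContDiff ℝ ∞ u) (R : ℝ) (x : R4) :
    lap (fun x => cutoff (R⁻¹ • x) * u x) x =
      cutoff (R⁻¹ • x) * lap u x + cutoffError u R x := by
  rw [lap_mul (contDiff_comp_smul contDiff_cutoff _) hu, lap_comp_smul contDiff_cutoff,
    cutoffError]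
  simp only [pd_comp_smul contDiff_cutoff]

/-- Derivatives of the cut-off live on R ≤ |x| ≤ 2R. There R⁻¹ times the R⁻³ decay of the gradient,
and R⁻² times the R⁻² decay of the potential, are both R⁻⁴. -/
lemma exists_abs_cutoffError_le {η : R4 → ℝ} (hη : ContDiff ℝ ∞ η) (hc : HasCompactSupport η) :
    ∃ K R₀ : ℝ, 0 ≤ K ∧ 0 < R₀ ∧ ∀ R, R₀ ≤ R → ∀ x,
      |cutoffError (newtPot η) R x| ≤ (closedBall (0 : R4) (2 * R)).indicator
        (fun _ => K * R⁻¹ ^ 4) x := by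
  obtain ⟨C, R₁, hC, hR₁, hd⟩ := exists_decay_newtPot hη hc
  choose C' R' hC' hR' hd' using fun k => exists_decay_pd_newtPot hη hc k
  choose M hM using exists_bound_pd_cutoff
  obtain ⟨L, hL⟩ := exists_bound_lap_cutoff
  have hM0 : ∀ k, 0 ≤ M k := fun k => (norm_nonneg _).trans (hM k 0)
  have hL0 : 0 ≤ L := (norm_nonneg _).trans (hL 0)
  -- The sum of the radii exceeds each of them, so all the decay estimates hold beyond it.
  refine ⟨2 * ∑ k, M k * C' k + L * C, R₁ + ∑ k, R' k,
    add_nonneg (mul_nonneg zero_le_two (Finset.sum_nonneg fun k _ => mul_nonneg (hM0 k) (hC' k)))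
      (mul_nonneg hL0 hC),
    add_pos_of_pos_of_nonneg hR₁ (Finset.sum_nonneg fun k _ => (hR' k).le), fun R hR x => ?_⟩
  have hR'R : ∀ k, R' k ≤ R := fun k =>
    (Finset.single_le_sum (fun i _ => (hR' i).le) (Finset.mem_univ k)).trans (by linarith)
  have hR₁R : R₁ ≤ R := le_trans (le_add_of_nonneg_right
    (Finset.sum_nonneg fun k _ => (hR' k).le)) hR
  have hR0 : 0 < R := by linarith
  have hnorm : ‖R⁻¹ • x‖ = ‖x‖ / R := by
    rw [norm_smul, Real.norm_of_nonneg (by positivity)]; ring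
  by_cases hx : ‖x‖ < R ∨ 2 * R < ‖x‖
  · have h : ‖R⁻¹ • x‖ < 1 ∨ 2 < ‖R⁻¹ • x‖ := by
      rw [hnorm, div_lt_one hR0, lt_div_iff₀ hR0]; exact hx
    have : cutoffError (newtPot η) R x = 0 := by
      simp [cutoffError, pd_cutoff_eq_zero _ h, lap_cutoff_eq_zero h]
    rw [this, abs_zero]
    refine Set.indicator_nonneg (fun _ _ => ?_) _
    exact mul_nonneg (add_nonneg (mul_nonneg zero_le_two (Finset.sum_nonneg fun k _ =>
      mul_nonneg (hM0 k) (hC' k))) (mul_nonneg hL0 hC)) (by positivity)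
  · push Not at hx
    rw [Set.indicator_of_mem (by simpa using hx.2)]
    have hinv : ‖x‖⁻¹ ≤ R⁻¹ := inv_anti₀ hR0 hx.1
    have h1 : ∀ k, |(R⁻¹ * pd k cutoff (R⁻¹ • x)) * pd k (newtPot η) x| ≤
        M k * C' k * R⁻¹ ^ 4 := by
      intro k
      rw [abs_mul, abs_mul, abs_of_nonneg (by positivity : 0 ≤ R⁻¹)]
      calc R⁻¹ * |pd k cutoff (R⁻¹ • x)| * |pd k (newtPot η) x|
          ≤ R⁻¹ * M k * (C' k * R⁻¹ ^ 3) := by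
            gcongr
            · exact mul_nonneg (by positivity) (hM0 k)
            · exact hM k _
            · refine (hd' k x ((hR'R k).trans hx.1)).trans ?_
              have := hC' k
              gcongr
        _ = _ := by ring
    have h2 : |R⁻¹ ^ 2 * lap cutoff (R⁻¹ • x) * newtPot η x| ≤ L * C * R⁻¹ ^ 4 := by
      rw [abs_mul, abs_mul, abs_of_nonneg (by positivity : 0 ≤ R⁻¹ ^ 2)]
      calc R⁻¹ ^ 2 * |lap cutoff (R⁻¹ • x)| * |newtPot η x|
          ≤ R⁻¹ ^ 2 * L * (C * R⁻¹ ^ 2) := by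
            gcongr
            · exact hL _
            · refine (hd x (hR₁R.trans hx.1)).trans ?_
              gcongr
        _ = _ := by ring
    calc |cutoffError (newtPot η) R x|
        ≤ 2 * ∑ k, M k * C' k * R⁻¹ ^ 4 + L * C * R⁻¹ ^ 4 := by
          refine (abs_add_le _ _).trans (add_le_add ?_ h2)
          rw [abs_mul, abs_two]
          gcongr
          exact (Finset.abs_sum_le_sum_abs _ _).trans (Finset.sum_le_sum fun k _ => h1 k)
      _ = _ := by rw [← Finset.sum_mul]; ring

lemma lintegral_sq_lt_top_of_memLp {F : R4 → C4} (h : MemLp F 2 volume) :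
    ∫⁻ x, ‖F x‖ₑ ^ 2 < ⊤ := by
  have := (eLpNorm_lt_top_iff_lintegral_rpow_enorm_lt_top (by norm_num) (by norm_num)).1 h.2
  simpa using this

lemma bracket_pos (x : R4) : 0 < bracket x := Real.sqrt_pos.2 (by positivity)

lemma bracket_le {R : ℝ} (hR : 1 ≤ R) {x : R4} (hx : ‖x‖ ≤ 2 * R) : bracket x ≤ 3 * R := by
  rw [bracket, Real.sqrt_le_left (by positivity)]
  nlinarith [norm_nonneg x]

/-- A function in `L^{2,-σ}` has `L¹` norm at most of order `R^{σ+2}` on the ball of radius `2R`. -/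
lemma setLIntegral_enorm_le_of_memWeightedL2 {σ : ℝ} (hσ : 0 < σ) {ψ : R4 → C4} {R : ℝ}
    (hR : 1 ≤ R) :
    ∫⁻ x in closedBall (0 : R4) (2 * R), ‖ψ x‖ₑ ≤
      ENNReal.ofReal (3 ^ σ * R ^ (σ + 2)) * (16 * volume (ball (0 : R4) 1)
        + ∫⁻ x, ‖(bracket x ^ (-σ)) • ψ x‖ₑ ^ 2) := by
  have hR0 : 0 < R := by linarith
  set A := ∫⁻ x, ‖(bracket x ^ (-σ)) • ψ x‖ₑ ^ 2
  have hpt : ∀ x ∈ closedBall (0 : R4) (2 * R), ‖ψ x‖ₑ ≤ ENNReal.ofReal ((3 * R) ^ σ) *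
      (ENNReal.ofReal (R⁻¹ ^ 2) + ENNReal.ofReal (R ^ 2) * ‖(bracket x ^ (-σ)) • ψ x‖ₑ ^ 2) := by
    intro x hx
    have hb := bracket_le hR (x := x) (by simpa using hx)
    have hb0 := bracket_pos x
    set F := (bracket x ^ (-σ)) • ψ x with hF
    have e : ψ x = bracket x ^ σ • F := by
      rw [hF, smul_smul, ← Real.rpow_add hb0]; simp
    rw [e, enorm_smul, Real.enorm_of_nonneg (by positivity)]
    gcongr
    -- This splitting balances the two squares: R⁻² times a volume of order R⁴ matches R² times the
    -- L² norm squared.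
    calc ‖F‖ₑ = ENNReal.ofReal R⁻¹ * (ENNReal.ofReal R * ‖F‖ₑ) := by
          rw [← mul_assoc, ← ENNReal.ofReal_mul (by positivity), inv_mul_cancel₀ hR0.ne',
            ENNReal.ofReal_one, one_mul]
      _ ≤ (ENNReal.ofReal R⁻¹) ^ 2 + (ENNReal.ofReal R * ‖F‖ₑ) ^ 2 := ennreal_mul_le_sq_add_sq _ _
      _ = _ := by
          rw [mul_pow, ← ENNReal.ofReal_pow (by positivity), ← ENNReal.ofReal_pow hR0.le]
  have hvol : volume (closedBall (0 : R4) (2 * R)) =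
      ENNReal.ofReal (R ^ 4) * (16 * volume (ball (0 : R4) 1)) := by
    rw [Measure.addHaar_closedBall _ _ (by positivity)]
    simp only [finrank_euclideanSpace, Fintype.card_fin, mul_pow]
    rw [mul_comm (2 ^ 4 : ℝ), ENNReal.ofReal_mul (by positivity), mul_assoc]
    norm_num
  calc ∫⁻ x in closedBall (0 : R4) (2 * R), ‖ψ x‖ₑ
      ≤ ∫⁻ x in closedBall (0 : R4) (2 * R), ENNReal.ofReal ((3 * R) ^ σ) *
          (ENNReal.ofReal (R⁻¹ ^ 2)
            + ENNReal.ofReal (R ^ 2) * ‖(bracket x ^ (-σ)) • ψ x‖ₑ ^ 2) :=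
        setLIntegral_mono' measurableSet_closedBall hpt
    _ = ENNReal.ofReal ((3 * R) ^ σ) * (ENNReal.ofReal (R⁻¹ ^ 2) *
          volume (closedBall (0 : R4) (2 * R)) + ENNReal.ofReal (R ^ 2) *
            ∫⁻ x in closedBall (0 : R4) (2 * R), ‖(bracket x ^ (-σ)) • ψ x‖ₑ ^ 2) := by
        rw [lintegral_const_mul' _ _ ENNReal.ofReal_ne_top, lintegral_add_left measurable_const,
          setLIntegral_const, lintegral_const_mul' _ _ ENNReal.ofReal_ne_top]
    _ ≤ ENNReal.ofReal ((3 * R) ^ σ) * (ENNReal.ofReal (R⁻¹ ^ 2) *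
          volume (closedBall (0 : R4) (2 * R)) + ENNReal.ofReal (R ^ 2) * A) := by
        gcongr
        exact setLIntegral_le_lintegral _ _
    _ = ENNReal.ofReal ((3 * R) ^ σ) * (ENNReal.ofReal (R ^ 2) *
          (16 * volume (ball (0 : R4) 1) + A)) := by
        have e : ENNReal.ofReal (R⁻¹ ^ 2) * ENNReal.ofReal (R ^ 4) = ENNReal.ofReal (R ^ 2) := by
          rw [← ENNReal.ofReal_mul (by positivity)]
          congr 1
          field_simp
        rw [hvol, ← mul_assoc (ENNReal.ofReal (R⁻¹ ^ 2)), e, ← mul_add]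
    _ = _ := by
        rw [← mul_assoc, ← ENNReal.ofReal_mul (by positivity),
          Real.mul_rpow (by norm_num) hR0.le, Real.rpow_add hR0]
        congr 2
        norm_num
        ring

/-- An error of size R⁻⁴ meets an L¹ norm of size R^{σ+2}, leaving R^{σ-2}; this is the one place
where σ < 2 is needed. -/
lemma tendsto_integral_cutoffError {σ : ℝ} (hσ : 0 < σ) (hσ2 : σ < 2) {ψ : R4 → C4}
    (hψ : MemWeightedL2 (-σ) ψ) {η : R4 → ℝ} (hη : ContDiff ℝ ∞ η) (hc : HasCompactSupport η) :
    Tendsto (fun R : ℝ => ∫ x, cutoffError (newtPot η) R x • ψ x) atTop (𝓝 0) := by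
  obtain ⟨K, R₀, hK, hR₀, hE⟩ := exists_abs_cutoffError_le hη hc
  set B := 16 * volume (ball (0 : R4) 1) + ∫⁻ x, ‖(bracket x ^ (-σ)) • ψ x‖ₑ ^ 2 with hB
  have hBtop : B ≠ ⊤ := by
    have h1 := lintegral_sq_lt_top_of_memLp hψ
    have h2 : volume (ball (0 : R4) 1) < ⊤ := measure_ball_lt_top
    finiteness
  have hbound : ∀ R, max R₀ 1 ≤ R → ‖∫ x, cutoffError (newtPot η) R x • ψ x‖ₑ ≤
      ENNReal.ofReal (K * 3 ^ σ * R ^ (-(2 - σ))) * B := by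
    intro R hR
    have hR1 : 1 ≤ R := (le_max_right _ _).trans hR
    have hR0 : 0 < R := by linarith
    calc ‖∫ x, cutoffError (newtPot η) R x • ψ x‖ₑ
        ≤ ∫⁻ x, ‖cutoffError (newtPot η) R x • ψ x‖ₑ := enorm_integral_le_lintegral_enorm _
      _ ≤ ∫⁻ x, (closedBall (0 : R4) (2 * R)).indicator
            (fun x => ENNReal.ofReal (K * R⁻¹ ^ 4) * ‖ψ x‖ₑ) x := by
          refine lintegral_mono fun x => ?_
          have h := hE R ((le_max_left _ _).trans hR) x
          by_cases hx : x ∈ closedBall (0 : R4) (2 * R)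
          · rw [Set.indicator_of_mem hx] at h ⊢
            rw [enorm_smul, ← ofReal_norm (cutoffError _ _ _)]
            gcongr
            exact h
          · rw [Set.indicator_of_notMem hx] at h
            have : cutoffError (newtPot η) R x = 0 := abs_nonpos_iff.1 h
            simp [this]
      _ = ENNReal.ofReal (K * R⁻¹ ^ 4) * ∫⁻ x in closedBall (0 : R4) (2 * R), ‖ψ x‖ₑ := by
          rw [lintegral_indicator measurableSet_closedBall,
            lintegral_const_mul' _ _ ENNReal.ofReal_ne_top]
      _ ≤ ENNReal.ofReal (K * R⁻¹ ^ 4) * (ENNReal.ofReal (3 ^ σ * R ^ (σ + 2)) * B) := by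
          gcongr
          exact setLIntegral_enorm_le_of_memWeightedL2 hσ hR1
      _ = _ := by
          rw [← mul_assoc, ← ENNReal.ofReal_mul (by positivity)]
          congr 2
          have : R ^ (-(2 - σ)) = R⁻¹ ^ 4 * R ^ (σ + 2) := by
            rw [← Real.rpow_natCast, Real.inv_rpow hR0.le, ← Real.rpow_neg hR0.le,
              ← Real.rpow_add hR0]
            congr 1
            push_cast
            ring
          rw [this]
          ring
  rw [tendsto_iff_enorm_sub_tendsto_zero]
  simp only [sub_zero]
  refine tendsto_of_tendsto_of_tendsto_of_le_of_le' tendsto_const_nhds ?_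
    (Eventually.of_forall fun _ => zero_le) (eventually_atTop.2 ⟨max R₀ 1, hbound⟩)
  have h1 : Tendsto (fun R : ℝ => K * 3 ^ σ * R ^ (-(2 - σ))) atTop (𝓝 0) := by
    simpa using (tendsto_rpow_neg_atTop (by linarith : 0 < 2 - σ)).const_mul (K * 3 ^ σ)
  have h2 := ENNReal.tendsto_ofReal h1
  rw [ENNReal.ofReal_zero] at h2
  simpa using ENNReal.Tendsto.mul_const h2 (Or.inr hBtop)

lemma tendsto_cutoff (x : R4) : ∀ᶠ R : ℝ in atTop, cutoff (R⁻¹ • x) = 1 := by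
  filter_upwards [eventually_ge_atTop (max ‖x‖ 1)] with R hR
  have hR0 : 0 < R := lt_of_lt_of_le one_pos ((le_max_right _ _).trans hR)
  refine cutoff_eq_one ?_
  rw [norm_smul, Real.norm_of_nonneg (by positivity), inv_mul_le_iff₀ hR0, mul_one]
  exact (le_max_left _ _).trans hR

lemma tendsto_integral_cutoff_smul {f : R4 → C4} (hf : Integrable f) :
    Tendsto (fun R : ℝ => ∫ x, cutoff (R⁻¹ • x) • f x) atTop (𝓝 (∫ x, f x)) := by
  refine tendsto_integral_filter_of_dominated_convergence (fun x => ‖f x‖) ?_ ?_ hf.norm ?_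
  · exact Eventually.of_forall fun R =>
      (contDiff_comp_smul contDiff_cutoff _).continuous.aestronglyMeasurable.smul hf.1
  · refine Eventually.of_forall fun R => Eventually.of_forall fun x => ?_
    rw [norm_smul]
    exact mul_le_of_le_one_left (norm_nonneg _) (abs_cutoff_le_one _)
  · refine Eventually.of_forall fun x => tendsto_const_nhds.congr' ?_
    filter_upwards [tendsto_cutoff x] with R hR
    rw [hR, one_smul]

lemma tendsto_integral_pd_cutoff_smul {f : R4 → C4} (hf : Integrable f) (k : Fin 4) :
    Tendsto (fun R : ℝ => ∫ x, (R⁻¹ * pd k cutoff (R⁻¹ • x)) • f x) atTop (𝓝 0) := by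
  have h : ∀ R : ℝ, ∫ x, (R⁻¹ * pd k cutoff (R⁻¹ • x)) • f x =
      R⁻¹ • ∫ x, pd k cutoff (R⁻¹ • x) • f x := fun R => by
    simp only [mul_smul, integral_smul]
  obtain ⟨M, hM⟩ := exists_bound_pd_cutoff k
  simp only [h]
  have h0 : Tendsto (fun R : ℝ => R⁻¹ * (M * ∫ x, ‖f x‖)) atTop (𝓝 0) := by
    simpa using tendsto_inv_atTop_zero.mul_const (M * ∫ x, ‖f x‖)
  refine squeeze_zero_norm' ?_ h0
  filter_upwards [eventually_gt_atTop 0] with R hR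
  rw [norm_smul, Real.norm_of_nonneg (by positivity), ← integral_const_mul]
  gcongr
  refine norm_integral_le_of_norm_le (hf.norm.const_mul M) (Eventually.of_forall fun x => ?_)
  rw [norm_smul]
  gcongr
  exact hM _

/-- Liouville-type uniqueness: a weak solution of `(D_m - m) ψ + f = 0` in `L^{2,-σ}`, `σ < 2`,
with integrable `f`, equals `-𝒢₀ f`. -/
theorem DiracWeak.ae_eq_neg_G0 {m : ℝ} {ψ f : R4 → C4} (h : DiracWeak m ψ f)
    (hψ : LocallyIntegrable ψ volume) (hf : Integrable f) {σ : ℝ} (hσ : 0 < σ) (hσ2 : σ < 2)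
    (hw : MemWeightedL2 (-σ) ψ) : ψ =ᵐ[volume] fun x => -G0 m f x := by
  refine ae_eq_of_integral_contDiff_smul_eq hψ (locallyIntegrable_G0 m hf).neg
    fun η hη hc => ?_
  -- The natural test function is the potential of η, for which Δu = -η; it lacks compact support,
  -- hence the cut-off.
  obtain ⟨u, hu⟩ : ∃ u, u = newtPot η := ⟨_, rfl⟩
  have hus : ContDiff ℝ ∞ u := hu ▸ contDiff_newtPot hη hc
  have hcut : ∀ R : ℝ, 0 < R → HasCompactSupport fun x => cutoff (R⁻¹ • x) * u x := fun R hR =>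
    (hasCompactSupport_cutoff.comp_smul (inv_ne_zero hR.ne')).mul_right
  have hcs : ∀ R : ℝ, ContDiff ℝ ∞ fun x => cutoff (R⁻¹ • x) * u x := fun R =>
    (contDiff_comp_smul contDiff_cutoff _).mul hus
  have hlap : ∀ R x, lap (fun x => cutoff (R⁻¹ • x) * u x) x =
      cutoff (R⁻¹ • x) * -η x + cutoffError u R x := fun R x => by
    rw [lap_cutoff_mul hus, hu, lap_newtPot hη hc]
  have hpd : ∀ k R x, pd k (fun x => cutoff (R⁻¹ • x) * u x) x =
      cutoff (R⁻¹ • x) * pd k u x + R⁻¹ * pd k cutoff (R⁻¹ • x) * u x := fun k R x => by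
    rw [pd_mul (contDiff_comp_smul contDiff_cutoff R⁻¹) hus, pd_comp_smul contDiff_cutoff]
  have hηψ := integrable_test_smul hη hc hψ
  -- The error is the sum of the Laplacian of the cut-off potential and the cut-off η, both test
  -- functions, so local integrability of ψ suffices.
  have hEψ : ∀ R : ℝ, 0 < R → Integrable fun x => cutoffError u R x • ψ x := by
    intro R hR
    have h1 := integrable_test_smul (contDiff_lap (hcs R)) (hasCompactSupport_lap (hcut R hR)) hψ
    have h2 : Integrable fun x => (cutoff (R⁻¹ • x) * η x) • ψ x :=
      integrable_test_smul ((contDiff_comp_smul contDiff_cutoff _).mul hη) hc.mul_left hψ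
    refine (h1.add h2).congr (Eventually.of_forall fun x => ?_)
    simp only [Pi.add_apply, hlap]
    rw [← add_smul]
    congr 1
    ring
  have hL : Tendsto (fun R : ℝ => ∫ x, lap (fun x => cutoff (R⁻¹ • x) * u x) x • ψ x) atTop
      (𝓝 (-(∫ x, η x • ψ x) + 0)) := by
    refine ((tendsto_integral_cutoff_smul hηψ).neg.add
      (hu ▸ tendsto_integral_cutoffError hσ hσ2 hw hη hc)).congr' ?_
    filter_upwards [eventually_gt_atTop 0] with R hR
    have h2 : Integrable fun x => cutoff (R⁻¹ • x) • η x • ψ x := by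
      simp only [smul_smul]
      exact integrable_test_smul ((contDiff_comp_smul contDiff_cutoff _).mul hη) hc.mul_left hψ
    rw [← integral_neg]
    refine (integral_add h2.neg (hEψ R hR)).symm.trans
      (integral_congr_ae (Eventually.of_forall fun x => ?_))
    simp only [hlap, Pi.neg_apply]
    rw [add_smul, smul_smul, mul_neg, neg_smul]
  have hu_int : Integrable fun y => u y • f y := hu ▸ integrable_newtPot_smul hη hc hf
  have hpu_int : ∀ k, Integrable fun y => pd k u y • f y :=
    hu ▸ integrable_pd_newtPot_smul hη hc hf
  have hR1 : Tendsto (fun R : ℝ => ∫ x, (cutoff (R⁻¹ • x) * u x) • f x) atTop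
      (𝓝 (∫ x, u x • f x)) := by
    simpa only [smul_smul] using tendsto_integral_cutoff_smul hu_int
  have hR2 : ∀ k, Tendsto (fun R : ℝ => ∫ x, pd k (fun x => cutoff (R⁻¹ • x) * u x) x • f x) atTop
      (𝓝 ((∫ x, pd k u x • f x) + 0)) := by
    intro k
    refine ((tendsto_integral_cutoff_smul (hpu_int k)).add
      (tendsto_integral_pd_cutoff_smul hu_int k)).congr fun R => ?_
    have i1 : Integrable fun x => cutoff (R⁻¹ • x) • pd k u x • f x :=
      (hpu_int k).bdd_smul 1
        (contDiff_comp_smul contDiff_cutoff _).continuous.aestronglyMeasurable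
        (Eventually.of_forall fun x => abs_cutoff_le_one _)
    have i2 : Integrable fun x => (R⁻¹ * pd k cutoff (R⁻¹ • x)) • u x • f x := by
      obtain ⟨M, hM⟩ := exists_bound_pd_cutoff k
      simp only [mul_smul]
      exact (hu_int.bdd_smul M (contDiff_comp_smul (contDiff_pd contDiff_cutoff k)
        _).continuous.aestronglyMeasurable (Eventually.of_forall fun x => hM _)).smul R⁻¹
    rw [← integral_add i1 i2]
    refine integral_congr_ae (Eventually.of_forall fun x => ?_)
    simp only [hpd, smul_smul, add_smul]
  have hRHS : Tendsto (fun R : ℝ => (∑ k, act (ialpha k)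
        (∫ x, pd k (fun x => cutoff (R⁻¹ • x) * u x) x • f x))
      + act ((2 * m : ℂ) • Iuc) (∫ x, (cutoff (R⁻¹ • x) * u x) • f x)) atTop
      (𝓝 ((∑ k, act (ialpha k) ((∫ x, pd k u x • f x) + 0))
        + act ((2 * m : ℂ) • Iuc) (∫ x, u x • f x))) :=
    (tendsto_finsetSum _ fun k _ => ((actL (ialpha k)).continuous.tendsto _).comp (hR2 k)).add
      (((actL _).continuous.tendsto _).comp hR1)
  -- The limit of the second-order identity tested with the cut-off potentials; its right side is
  -- the transposed form of ∫ η 𝒢₀f.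
  have heq := tendsto_nhds_unique (hL.congr' (by
    filter_upwards [eventually_gt_atTop 0] with R hR
    exact h.laplace hψ (hcs R) (hcut R hR))) hRHS
  simp only [add_zero] at heq
  simp only [smul_neg, integral_neg]
  rw [integral_smul_G0 m hf hη hc, ← neg_eq_iff_eq_neg, ← hu]
  exact heq

end Dirac4

end

noncomputable section

namespace Dirac4
open scoped ENNReal NNReal Topology
open Metric Filter

/-! ### Bounds on the factor `v` -/

lemma act_apply (A : M4) (w : C4) (i : Fin 4) : act A w i = ∑ j, A i j * w j := by
  simp [act, Matrix.mulVec, dotProduct]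

lemma norm_act_le_of_entries {A : M4} {b : ℝ} (hb : ∀ i j, ‖A i j‖ ≤ b) (w : C4) :
    -- Each of the four components is at most 4b‖w‖, and the Euclidean norm costs a further factor
    -- 2.
    ‖act A w‖ ≤ 8 * b * ‖w‖ := by
  have hb0 : 0 ≤ b := (norm_nonneg _).trans (hb 0 0)
  have h1 : ∀ i, ‖act A w i‖ ≤ 4 * b * ‖w‖ := by
    intro i
    rw [act_apply]
    calc ‖∑ j, A i j * w j‖ ≤ ∑ j : Fin 4, b * ‖w‖ := by
          refine norm_sum_le_of_le _ fun j _ => ?_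
          rw [norm_mul]
          exact mul_le_mul (hb i j) (PiLp.norm_apply_le w j) (norm_nonneg _) hb0
      _ = _ := by simp; ring
  rw [EuclideanSpace.norm_eq, Real.sqrt_le_left (by positivity)]
  calc ∑ i, ‖act A w i‖ ^ 2 ≤ ∑ i : Fin 4, (4 * b * ‖w‖) ^ 2 := by
        gcongr with i
        exact h1 i
    _ = _ := by simp; ring

lemma enorm_act_le_of_entries {A : M4} {b : ℝ} (hb : ∀ i j, ‖A i j‖ ≤ b) (w : C4) :
    ‖act A w‖ₑ ≤ ENNReal.ofReal (8 * b) * ‖w‖ₑ := by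
  have hb0 : 0 ≤ b := (norm_nonneg _).trans (hb 0 0)
  rw [← ofReal_norm, ← ofReal_norm, ← ENNReal.ofReal_mul (by positivity)]
  exact ENNReal.ofReal_le_ofReal (norm_act_le_of_entries hb w)

lemma bracket_rpow_neg_le (x : R4) {s : ℝ} (hs : 0 ≤ s) :
    bracket x ^ (-s) ≤ 2 ^ s * (1 + ‖x‖) ^ (-s) := by
  have h : (1 + ‖x‖) / 2 ≤ bracket x := by
    rw [bracket]
    refine Real.le_sqrt_of_sq_le ?_
    nlinarith [sq_nonneg (1 - ‖x‖), norm_nonneg x]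
  calc bracket x ^ (-s) ≤ ((1 + ‖x‖) / 2) ^ (-s) :=
        Real.rpow_le_rpow_of_nonpos (by positivity) h (by linarith)
    _ = _ := by
        rw [Real.div_rpow (by positivity) (by positivity), Real.rpow_neg zero_le_two, div_inv_eq_mul,
          mul_comm]

lemma enorm_act_le_om {A : R4 → M4} {C s : ℝ} (hs : 0 ≤ s)
    (hA : ∀ x i j, ‖A x i j‖ ≤ C * bracket x ^ (-s)) (x : R4) (w : C4) :
    ‖act (A x) w‖ₑ ≤ ENNReal.ofReal (8 * |C| * 2 ^ s) * (om x ^ s * ‖w‖ₑ) := by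
  have h : ∀ i j, ‖A x i j‖ ≤ |C| * (2 ^ s * (1 + ‖x‖) ^ (-s)) := fun i j =>
    (hA x i j).trans (mul_le_mul (le_abs_self C) (bracket_rpow_neg_le x hs)
      (Real.rpow_nonneg (bracket_pos x).le _) (abs_nonneg C))
  refine (enorm_act_le_of_entries h w).trans (le_of_eq ?_)
  rw [om_rpow_eq_ofReal, ← mul_assoc (ENNReal.ofReal _) (ENNReal.ofReal _),
    ← ENNReal.ofReal_mul (by positivity)]
  congr 2
  ring

/-- The matrix field `v` together with its adjoint is bounded by `K (1+|x|)^{-s}`. -/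
structure DecayBound (v : R4 → M4) (s : ℝ) (K : ℝ≥0∞) : Prop where
  two_lt : 2 < s
  ne_top : K ≠ ∞
  aemeasurable : ∀ i j, AEMeasurable (fun x => v x i j) volume
  le : ∀ x w, ‖act (v x) w‖ₑ ≤ K * (om x ^ s * ‖w‖ₑ)
  le_adjoint : ∀ x w, ‖act (v x)ᴴ w‖ₑ ≤ K * (om x ^ s * ‖w‖ₑ)

lemma aemeasurable_vmat {V B : R4 → M4} {lam : R4 → Fin 4 → ℝ} (h : IsDiagonalization V B lam)
    (i j : Fin 4) : AEMeasurable (fun x => vmat B lam x i j) volume := by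
  simp only [vmat, Matrix.diagonal_mul]
  have h1 : AEMeasurable (fun x => √|lam x i|) volume :=
    Real.continuous_sqrt.measurable.comp_aemeasurable
      (continuous_abs.measurable.comp_aemeasurable (h.aemeasurable_lam i))
  exact (Complex.continuous_ofReal.measurable.comp_aemeasurable h1).mul (h.aemeasurable_B i j)

lemma exists_decayBound {V B : R4 → M4} {lam : R4 → Fin 4 → ℝ} (h : IsDiagonalization V B lam)
    (hdecay : ∃ ε > (0 : ℝ), ∃ C : ℝ, ∀ x i j,
      ‖vmat B lam x i j‖ ≤ C * bracket x ^ (-2 - ε)) :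
    ∃ s K, DecayBound (vmat B lam) s K := by
  obtain ⟨ε, hε, C, hC⟩ := hdecay
  have hC' : ∀ x i j, ‖vmat B lam x i j‖ ≤ C * bracket x ^ (-(2 + ε)) := by
    intro x i j
    rw [neg_add']
    exact hC x i j
  refine ⟨2 + ε, ENNReal.ofReal (8 * |C| * 2 ^ (2 + ε)), by linarith, ENNReal.ofReal_ne_top,
    aemeasurable_vmat h, enorm_act_le_om (by linarith) hC', fun x w =>
      enorm_act_le_om (A := fun x => (vmat B lam x)ᴴ) (by linarith) (fun x i j => ?_) x w⟩
  rw [Matrix.conjTranspose_apply, norm_star]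
  exact hC' x j i

lemma act_eq_sum (A : M4) (w : C4) :
    act A w = ∑ i, ∑ j, (A i j * w j) • (EuclideanSpace.single i (1 : ℂ) : C4) := by
  ext k
  simp [act_apply, ← Finset.sum_smul, Pi.single_apply]

lemma aestronglyMeasurable_act_var {A : R4 → M4} (hA : ∀ i j, AEMeasurable (fun x => A x i j) volume)
    {f : R4 → C4} (hf : AEStronglyMeasurable f volume) :
    AEStronglyMeasurable (fun x => act (A x) (f x)) volume := by
  simp only [act_eq_sum]
  refine Finset.aestronglyMeasurable_fun_sum _ fun i _ =>
    Finset.aestronglyMeasurable_fun_sum _ fun j _ => ?_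
  refine AEStronglyMeasurable.smul (AEStronglyMeasurable.mul (hA i j).aestronglyMeasurable ?_)
    aestronglyMeasurable_const
  exact (EuclideanSpace.proj j : C4 →L[ℂ] ℂ).continuous.comp_aestronglyMeasurable hf

lemma aestronglyMeasurable_vstar {v : R4 → M4} (hv : ∀ i j, AEMeasurable (fun x => v x i j) volume)
    {f : R4 → C4} (hf : AEStronglyMeasurable f volume) :
    AEStronglyMeasurable (vstar v f) volume := by
  refine aestronglyMeasurable_act_var (A := fun x => (v x)ᴴ) (fun i j => ?_) hf
  simp only [Matrix.conjTranspose_apply]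
  exact continuous_star.measurable.comp_aemeasurable (hv j i)

/-! ### The sign matrix and the factorization -/

lemma sgn_mul_self (t : ℝ) : sgn t * sgn t = 1 := by
  unfold sgn; split_ifs <;> norm_num

lemma abs_sgn (t : ℝ) : |sgn t| = 1 := by
  unfold sgn; split_ifs <;> norm_num

lemma abs_mul_sgn (t : ℝ) : |t| * sgn t = t := by
  unfold sgn; split_ifs with h
  · rw [abs_of_nonneg h, mul_one]
  · rw [abs_of_neg (not_le.1 h)]; ring

lemma Umat_mul_Umat (lam : R4 → Fin 4 → ℝ) (x : R4) : Umat lam x * Umat lam x = 1 := by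
  rw [Umat, Matrix.diagonal_mul_diagonal, ← Matrix.diagonal_one]
  congr 1
  funext i
  rw [← Complex.ofReal_mul, sgn_mul_self, Complex.ofReal_one]

lemma aemeasurable_Umat {V B : R4 → M4} {lam : R4 → Fin 4 → ℝ} (h : IsDiagonalization V B lam)
    (i j : Fin 4) : AEMeasurable (fun x => Umat lam x i j) volume := by
  have hs : Measurable sgn := Measurable.ite measurableSet_Ici measurable_const measurable_const
  by_cases hij : i = j
  · subst hij
    simp only [Umat, Matrix.diagonal_apply_eq]
    exact Complex.continuous_ofReal.measurable.comp_aemeasurable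
      (hs.comp_aemeasurable (h.aemeasurable_lam i))
  · simp only [Umat, Matrix.diagonal_apply_ne _ hij]
    exact aemeasurable_const

lemma enorm_act_Umat_le (lam : R4 → Fin 4 → ℝ) (x : R4) (w : C4) :
    ‖act (Umat lam x) w‖ₑ ≤ 8 * ‖w‖ₑ := by
  have h : ∀ i j, ‖Umat lam x i j‖ ≤ 1 := by
    intro i j
    by_cases hij : i = j
    · subst hij
      simp [Umat, abs_sgn]
    · simp [Umat, hij]
  simpa using enorm_act_le_of_entries h w

/-- The diagonal entries multiply as √|λ| · sign λ · √|λ| = λ, also for λ = 0, whatever sign is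
chosen there. -/
lemma vmat_factorization {V B : R4 → M4} {lam : R4 → Fin 4 → ℝ} (h : IsDiagonalization V B lam)
    (x : R4) : V x = (vmat B lam x)ᴴ * (Umat lam x * vmat B lam x) := by
  rw [h.eq, vmat, Matrix.conjTranspose_mul, Matrix.diagonal_conjTranspose, Matrix.mul_assoc,
    Matrix.mul_assoc, Umat, ← Matrix.mul_assoc (Matrix.diagonal _) (Matrix.diagonal _),
    Matrix.diagonal_mul_diagonal, ← Matrix.mul_assoc (Matrix.diagonal _) (Matrix.diagonal _),
    Matrix.diagonal_mul_diagonal]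
  congr 3
  funext i
  simp only [Pi.star_apply, Complex.star_def, Complex.conj_ofReal]
  rw [← Complex.ofReal_mul, ← Complex.ofReal_mul]
  congr 1
  rw [mul_right_comm, Real.mul_self_sqrt (abs_nonneg _), abs_mul_sgn]

/-! ### The operator `T₀` under the decay assumption -/

lemma lintegral_L2_lt_top (φ : L2) : ∫⁻ x, ‖φ x‖ₑ ^ 2 < ∞ :=
  lintegral_sq_lt_top_of_memLp (Lp.memLp φ)

lemma DecayBound.integrable_vstar {v : R4 → M4} {s : ℝ} {K : ℝ≥0∞} (hv : DecayBound v s K)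
    (φ : L2) : Integrable (vstar v φ) := by
  refine ⟨aestronglyMeasurable_vstar hv.aemeasurable (Lp.aestronglyMeasurable φ), ?_⟩
  have hs := hv.two_lt
  have hK := hv.ne_top
  have h1 := lintegral_om_lt_top (s := 2 * s) (by linarith)
  have h2 := lintegral_L2_lt_top φ
  calc ∫⁻ x, ‖vstar v φ x‖ₑ ≤ ∫⁻ x, K * (om x ^ (2 * s) + ‖φ x‖ₑ ^ 2) := by
        refine lintegral_mono fun x => (hv.le_adjoint x _).trans ?_
        gcongr
        refine (ennreal_mul_le_sq_add_sq _ _).trans (le_of_eq ?_)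
        rw [← ENNReal.rpow_natCast, ← ENNReal.rpow_mul]
        congr 2
        push_cast
        ring
    _ = K * ((∫⁻ x, om x ^ (2 * s)) + ∫⁻ x, ‖φ x‖ₑ ^ 2) := by
        rw [lintegral_const_mul' _ _ hK, lintegral_add_left (by fun_prop)]
    _ < ∞ := by finiteness

lemma DecayBound.lintegral_vstar_sq_lt_top {v : R4 → M4} {s : ℝ} {K : ℝ≥0∞}
    (hv : DecayBound v s K) (φ : L2) : ∫⁻ x, ‖vstar v φ x‖ₑ ^ 2 < ∞ := by
  have hs := hv.two_lt
  have hK := hv.ne_top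
  have h2 := lintegral_L2_lt_top φ
  calc ∫⁻ x, ‖vstar v φ x‖ₑ ^ 2 ≤ ∫⁻ x, K ^ 2 * ‖φ x‖ₑ ^ 2 := by
        refine lintegral_mono fun x => ?_
        rw [← mul_pow]
        gcongr
        refine (hv.le_adjoint x _).trans ?_
        gcongr
        exact mul_le_of_le_one_left zero_le (om_rpow_le_one x (by linarith))
    _ = K ^ 2 * ∫⁻ x, ‖φ x‖ₑ ^ 2 := lintegral_const_mul' _ _ (by finiteness)
    _ < ∞ := by finiteness

/-- Pointwise decay `|ψ| ≲ (1+|x|)⁻²` of `ψ = -𝒢₀ v* φ` when `φ = U v ψ`. -/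
lemma DecayBound.exists_le_om_sq {v : R4 → M4} {s : ℝ} {K : ℝ≥0∞} (hv : DecayBound v s K)
    {lam : R4 → Fin 4 → ℝ} {m : ℝ} {φ : L2} {ψ : R4 → C4}
    (hψ : ψ =ᵐ[volume] fun x => -G0 m (vstar v φ) x)
    (hφ : φ =ᵐ[volume] fun x => act (Umat lam x * v x) (ψ x)) :
    ∃ C : ℝ≥0∞, C ≠ ∞ ∧ ∀ᵐ x, ‖ψ x‖ₑ ≤ C * om x ^ 2 := by
  have hs := hv.two_lt
  have hK := hv.ne_top
  have hG := G0const_ne_top m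
  have hf := hv.integrable_vstar φ
  have hm : AEMeasurable (fun y => ‖vstar v φ y‖ₑ) volume := hf.1.enorm
  refine exists_le_om_sq_of_le_majPot (h := hm.mk _) hm.measurable_mk
    -- One constant serves both inequalities. The factors v* and v each contribute a weight of order
    -- s, so t = 2s > 4.
    (C := G0const m + K * 8 * K) (by finiteness) (t := 2 * s) (by linarith) ?_ ?_ ?_ ?_
  · filter_upwards [hψ] with x hx
    rw [hx, enorm_neg, ← majPot_congr hm.ae_eq_mk]
    refine (enorm_G0_le m _ x).trans ?_
    gcongr
    exact le_self_add
  · filter_upwards [hφ, hm.ae_eq_mk] with y hy hy2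
    rw [← hy2]
    have e : om y ^ (2 * s) = om y ^ s * om y ^ s := by
      rw [← ENNReal.rpow_add _ _ (om_ne_zero y) (om_ne_top y), two_mul]
    calc ‖vstar v φ y‖ₑ ≤ K * (om y ^ s * ‖φ y‖ₑ) := hv.le_adjoint y _
      _ ≤ K * (om y ^ s * (8 * (K * (om y ^ s * ‖ψ y‖ₑ)))) := by
          rw [hy, ← act_act]
          gcongr
          refine (enorm_act_Umat_le lam y _).trans ?_
          gcongr
          exact hv.le y _
      _ = (K * 8 * K) * (om y ^ (2 * s) * ‖ψ y‖ₑ) := by rw [e]; ring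
      _ ≤ _ := by gcongr; exact le_add_self
  · rw [← lintegral_congr_ae hm.ae_eq_mk]
    exact hf.2.ne
  · have : (fun y => (hm.mk _ y) ^ 2) =ᵐ[volume] fun y => ‖vstar v φ y‖ₑ ^ 2 := by
      filter_upwards [hm.ae_eq_mk] with y hy
      rw [hy]
    rw [lintegral_congr_ae this]
    exact (hv.lintegral_vstar_sq_lt_top φ).ne

lemma eLpNorm_two_eq (f : R4 → C4) :
    eLpNorm f 2 volume = (∫⁻ x, ‖f x‖ₑ ^ 2) ^ (1 / 2 : ℝ) := by
  rw [eLpNorm_eq_lintegral_rpow_enorm_toReal (by norm_num) (by norm_num)]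
  simp

/-- The outer v and the inner v* supply the weights on the two sides of the kernel that Schur's test
requires. -/
lemma DecayBound.exists_eLpNorm_T0fun_le {v : R4 → M4} {s : ℝ} {K : ℝ≥0∞} (hv : DecayBound v s K)
    {U : R4 → M4} (hU : ∀ x w, ‖act (U x) w‖ₑ ≤ 8 * ‖w‖ₑ)
    (hUm : ∀ i j, AEMeasurable (fun x => U x i j) volume) (m : ℝ) :
    ∃ C : ℝ≥0, ∀ φ : L2, AEStronglyMeasurable (T0fun m U v φ) volume ∧
      eLpNorm (T0fun m U v φ) 2 volume ≤ C * eLpNorm φ 2 volume := by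
  obtain ⟨M, hM, hle⟩ := exists_lintegral_om_majPot_sq_le hv.two_lt
  have hK := hv.ne_top
  have hG := G0const_ne_top m
  have hs := hv.two_lt
  set D : ℝ≥0∞ := 8 + K * G0const m * K * M ^ (1 / 2 : ℝ) with hD
  have hDtop : D ≠ ∞ := by finiteness
  refine ⟨D.toNNReal, fun φ => ?_⟩
  rw [ENNReal.coe_toNNReal hDtop]
  have m1 : AEStronglyMeasurable (fun x => act (U x) (φ x)) volume :=
    aestronglyMeasurable_act_var hUm (Lp.aestronglyMeasurable φ)
  have m2 : AEStronglyMeasurable (fun x => act (v x) (G0 m (vstar v φ) x)) volume :=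
    aestronglyMeasurable_act_var hv.aemeasurable
      (aestronglyMeasurable_G0 m (hv.integrable_vstar φ).1)
  refine ⟨m1.add m2, ?_⟩
  have b1 : eLpNorm (fun x => act (U x) (φ x)) 2 volume ≤ 8 * eLpNorm φ 2 volume := by
    rw [eLpNorm_two_eq, eLpNorm_two_eq]
    calc (∫⁻ x, ‖act (U x) (φ x)‖ₑ ^ 2) ^ (1 / 2 : ℝ)
        ≤ (∫⁻ x, 8 ^ 2 * ‖φ x‖ₑ ^ 2) ^ (1 / 2 : ℝ) := by
          gcongr with x
          rw [← mul_pow]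
          gcongr
          exact hU x _
      _ = _ := by
          rw [lintegral_const_mul' _ _ (by finiteness),
            ENNReal.mul_rpow_of_nonneg _ _ (by norm_num), ← ENNReal.rpow_natCast,
            ← ENNReal.rpow_mul]
          norm_num
  have b2 : eLpNorm (fun x => act (v x) (G0 m (vstar v φ) x)) 2 volume ≤
      K * G0const m * K * M ^ (1 / 2 : ℝ) * eLpNorm φ 2 volume := by
    rw [eLpNorm_two_eq, eLpNorm_two_eq]
    have hpt : ∀ x, ‖act (v x) (G0 m (vstar v φ) x)‖ₑ ≤
        (K * G0const m * K) * (om x ^ s * majPot (fun y => om y ^ s * ‖φ y‖ₑ) x) := by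
      intro x
      have h1 : majPot (fun y => ‖vstar v φ y‖ₑ) x ≤
          K * majPot (fun y => om y ^ s * ‖φ y‖ₑ) x := by
        unfold majPot
        rw [← lintegral_const_mul' _ _ hK]
        refine lintegral_mono fun y => ?_
        calc kerMaj (x - y) * ‖vstar v φ y‖ₑ
            ≤ kerMaj (x - y) * (K * (om y ^ s * ‖φ y‖ₑ)) := by
              gcongr; exact hv.le_adjoint y _
          _ = _ := by ring
      calc ‖act (v x) (G0 m (vstar v φ) x)‖ₑ ≤ K * (om x ^ s * ‖G0 m (vstar v φ) x‖ₑ) := hv.le x _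
        _ ≤ K * (om x ^ s * (G0const m * (K * majPot (fun y => om y ^ s * ‖φ y‖ₑ) x))) := by
            gcongr
            refine (enorm_G0_le m _ x).trans ?_
            gcongr
        _ = _ := by ring
    calc (∫⁻ x, ‖act (v x) (G0 m (vstar v φ) x)‖ₑ ^ 2) ^ (1 / 2 : ℝ)
        ≤ (∫⁻ x, (K * G0const m * K) ^ 2 *
            (om x ^ s * majPot (fun y => om y ^ s * ‖φ y‖ₑ) x) ^ 2) ^ (1 / 2 : ℝ) := by
          gcongr with x
          rw [← mul_pow]
          gcongr
          exact hpt x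
      _ = ((K * G0const m * K) ^ 2 * ∫⁻ x,
            (om x ^ s * majPot (fun y => om y ^ s * ‖φ y‖ₑ) x) ^ 2) ^ (1 / 2 : ℝ) := by
          rw [lintegral_const_mul' _ _ (by finiteness)]
      _ ≤ ((K * G0const m * K) ^ 2 * (M * ∫⁻ x, ‖φ x‖ₑ ^ 2)) ^ (1 / 2 : ℝ) := by
          gcongr
          exact hle (fun y => ‖φ y‖ₑ) (Lp.stronglyMeasurable φ).enorm
      _ = _ := by
          rw [ENNReal.mul_rpow_of_nonneg _ _ (by norm_num),
            ENNReal.mul_rpow_of_nonneg _ _ (by norm_num), ← ENNReal.rpow_natCast,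
            ← ENNReal.rpow_mul, ← mul_assoc]
          norm_num
  calc eLpNorm (T0fun m U v φ) 2 volume
      ≤ eLpNorm (fun x => act (U x) (φ x)) 2 volume
        + eLpNorm (fun x => act (v x) (G0 m (vstar v φ) x)) 2 volume :=
        eLpNorm_add_le m1 m2 (by norm_num)
    _ ≤ 8 * eLpNorm φ 2 volume
        + K * G0const m * K * M ^ (1 / 2 : ℝ) * eLpNorm φ 2 volume := add_le_add b1 b2
    _ = _ := by rw [hD]; ring

lemma mem_kerT0_iff {m : ℝ} {U v : R4 → M4} {φ : L2} :
    φ ∈ kerT0 m U v ↔ φ ∈ T0domain m U v ∧ T0fun m U v φ =ᵐ[volume] 0 := by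
  rw [kerT0, Submodule.mem_map]
  constructor
  · rintro ⟨χ, hχ, rfl⟩
    refine ⟨χ.2, ?_⟩
    have h0 : χ.2.2.toLp (T0fun m U v χ.1) = 0 := hχ
    exact (MemLp.coeFn_toLp χ.2.2).symm.trans ((Lp.eq_zero_iff_ae_eq_zero).1 h0)
  · rintro ⟨hd, h0⟩
    refine ⟨⟨φ, hd⟩, ?_, rfl⟩
    exact (Lp.eq_zero_iff_ae_eq_zero).2 ((MemLp.coeFn_toLp hd.2).trans h0)

lemma mem_T0domain {m : ℝ} {U v : R4 → M4} {C : ℝ≥0} {φ : L2} (hf : Integrable (vstar v φ))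
    (hC : AEStronglyMeasurable (T0fun m U v φ) volume ∧
      eLpNorm (T0fun m U v φ) 2 volume ≤ C * eLpNorm φ 2 volume) : φ ∈ T0domain m U v := by
  refine ⟨G0Converges_of_integrable m hf, hC.1, hC.2.trans_lt ?_⟩
  exact ENNReal.mul_lt_top ENNReal.coe_lt_top (Lp.memLp φ).2

/-- The kernel of `T₀` is closed, as `T₀` is everywhere defined and bounded. -/
lemma isClosed_kerT0 {m : ℝ} {U v : R4 → M4} (hd : ∀ φ : L2, φ ∈ T0domain m U v) {C : ℝ≥0}
    (hC : ∀ φ : L2, eLpNorm (T0fun m U v φ) 2 volume ≤ C * eLpNorm φ 2 volume) :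
    IsClosed (kerT0 m U v : Set L2) := by
  let T : L2 →ₗ[ℂ] L2 := (T0 m U v).toFun.comp (LinearMap.id.codRestrict _ hd)
  have hT : ∀ φ, T φ = (hd φ).2.toLp (T0fun m U v φ) := fun _ => rfl
  have hbound : ∀ φ, ‖T φ‖ ≤ C * ‖φ‖ := by
    intro φ
    rw [hT, Lp.norm_toLp, Lp.norm_def]
    have h := ENNReal.toReal_mono (ENNReal.mul_ne_top ENNReal.coe_ne_top (Lp.memLp φ).2.ne) (hC φ)
    rwa [ENNReal.toReal_mul, ENNReal.coe_toReal] at h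
  have hcont : Continuous T := AddMonoidHomClass.continuous_of_bound T C hbound
  have e : (kerT0 m U v : Set L2) = T ⁻¹' {0} := by
    ext φ
    rw [SetLike.mem_coe, mem_kerT0_iff, Set.mem_preimage, Set.mem_singleton_iff, hT,
      Lp.eq_zero_iff_ae_eq_zero]
    refine ⟨fun h => (MemLp.coeFn_toLp _).trans h.2,
      fun h => ⟨hd φ, (MemLp.coeFn_toLp (hd φ).2).symm.trans h⟩⟩
  rw [e]
  exact isClosed_singleton.preimage hcont

/-- For a closed kernel the closure in `S1` changes nothing. -/
lemma mem_range_S1_iff {m : ℝ} {U v : R4 → M4} (h : IsClosed (kerT0 m U v : Set L2)) {φ : L2} :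
    φ ∈ LinearMap.range (S1 m U v).toLinearMap ↔ φ ∈ kerT0 m U v := by
  have : LinearMap.range (S1 m U v).toLinearMap = kerT0 m U v := by
    rw [S1, Submodule.range_starProjection, h.submodule_topologicalClosure_eq]
  rw [this]

/-! ### Threshold solutions -/

lemma DiracWeak.congr {m : ℝ} {ψ ψ' f f' : R4 → C4} (h : DiracWeak m ψ f)
    (hψ : ψ =ᵐ[volume] ψ') (hf : f =ᵐ[volume] f') : DiracWeak m ψ' f' := by
  intro θ hθ hc
  have e1 : ∀ (κ : R4 → ℝ), ∫ x, κ x • ψ' x = ∫ x, κ x • ψ x := fun κ =>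
    integral_congr_ae (by filter_upwards [hψ] with x hx; rw [hx])
  have e2 : ∫ x, θ x • f' x = ∫ x, θ x • f x :=
    integral_congr_ae (by filter_upwards [hf] with x hx; rw [hx])
  have e3 : ∀ k, ∫ x, pd k θ x • ψ' x = ∫ x, pd k θ x • ψ x := fun k => e1 (pd k θ)
  rw [e1, e2]
  simp only [e3]
  exact h θ hθ hc

lemma measurable_bracket : Measurable bracket := by unfold bracket; fun_prop

/-- The decay `om`² alone just misses L² on ℝ⁴, logarithmically; any σ > 0 raises the exponent 2(σ +
2) above 4. -/
lemma memWeightedL2_of_le_om_sq {σ : ℝ} (hσ : 0 < σ) {ψ : R4 → C4}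
    (hm : AEStronglyMeasurable ψ volume) {C : ℝ≥0∞} (hC : C ≠ ∞)
    (h : ∀ᵐ x, ‖ψ x‖ₑ ≤ C * om x ^ 2) : MemWeightedL2 (-σ) ψ := by
  refine ⟨(measurable_bracket.pow_const _).aestronglyMeasurable.smul hm, ?_⟩
  rw [eLpNorm_lt_top_iff_lintegral_rpow_enorm_lt_top (by norm_num) (by norm_num)]
  simp only [ENNReal.toReal_ofNat, ENNReal.rpow_ofNat]
  have h1 := lintegral_om_lt_top (s := 2 * (σ + 2)) (by linarith)
  calc ∫⁻ x, ‖(bracket x ^ (-σ)) • ψ x‖ₑ ^ 2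
      ≤ ∫⁻ x, (ENNReal.ofReal (2 ^ σ) * C) ^ 2 * om x ^ (2 * (σ + 2)) := by
        refine lintegral_mono_ae ?_
        filter_upwards [h] with x hx
        have e : om x ^ (2 * (σ + 2)) = (om x ^ σ * om x ^ 2) ^ 2 := by
          rw [← ENNReal.rpow_natCast (om x) 2, ← ENNReal.rpow_add _ _ (om_ne_zero x) (om_ne_top x),
            ← ENNReal.rpow_natCast, ← ENNReal.rpow_mul]
          congr 1
          push_cast
          ring
        rw [e, ← mul_pow, enorm_smul]
        refine pow_le_pow_left' ?_ 2
        calc ‖bracket x ^ (-σ)‖ₑ * ‖ψ x‖ₑ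
            ≤ (ENNReal.ofReal (2 ^ σ) * om x ^ σ) * (C * om x ^ 2) := by
              gcongr
              rw [Real.enorm_of_nonneg (Real.rpow_nonneg (bracket_pos x).le _), om_rpow_eq_ofReal,
                ← ENNReal.ofReal_mul (by positivity)]
              exact ENNReal.ofReal_le_ofReal (bracket_rpow_neg_le x hσ.le)
          _ = _ := by ring
    _ = (ENNReal.ofReal (2 ^ σ) * C) ^ 2 * ∫⁻ x, om x ^ (2 * (σ + 2)) :=
        lintegral_const_mul _ (by fun_prop)
    _ < ∞ := by finiteness

lemma vstar_ae_eq {V B : R4 → M4} {lam : R4 → Fin 4 → ℝ} (h : IsDiagonalization V B lam)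
    {φ : L2} {ψ : R4 → C4}
    (hφ : φ =ᵐ[volume] fun x => act (Umat lam x * vmat B lam x) (ψ x)) :
    vstar (vmat B lam) φ =ᵐ[volume] fun x => act (V x) (ψ x) := by
  filter_upwards [hφ] with x hx
  rw [vstar, hx, act_act, vmat_factorization h]

/-- A threshold solution `ψ` with `φ = U v ψ ∈ L²` is `-𝒢₀ v* φ`. -/
lemma IsThresholdSolution.ae_eq_neg_G0 {m σ : ℝ} (hσ : 0 < σ) (hσ2 : σ < 2) {V B : R4 → M4}
    {lam : R4 → Fin 4 → ℝ} (h : IsDiagonalization V B lam) {s : ℝ} {K : ℝ≥0∞}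
    (hv : DecayBound (vmat B lam) s K) {φ : L2} {ψ : R4 → C4} (hψ : IsThresholdSolution m σ V ψ)
    (hφ : φ =ᵐ[volume] fun x => act (Umat lam x * vmat B lam x) (ψ x)) :
    ψ =ᵐ[volume] fun x => -G0 m (vstar (vmat B lam) φ) x := by
  obtain ⟨hw, -, hsol⟩ := hψ
  obtain ⟨h1, -, h3⟩ := (isDistributionalSolution_iff m V ψ).1 hsol
  exact (h3.congr EventuallyEq.rfl (vstar_ae_eq h hφ).symm).ae_eq_neg_G0 h1
    (hv.integrable_vstar φ) hσ hσ2 hw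

/-- From a nonzero kernel element `φ` of `T₀` one obtains the threshold solution `-𝒢₀ v* φ`. -/
lemma isThresholdSolution_neg_G0 {m σ : ℝ} (hσ : 0 < σ) {V B : R4 → M4}
    {lam : R4 → Fin 4 → ℝ} (h : IsDiagonalization V B lam) {s : ℝ} {K : ℝ≥0∞}
    (hv : DecayBound (vmat B lam) s K) {φ : L2} (hφ0 : φ ≠ 0)
    (hker : T0fun m (Umat lam) (vmat B lam) φ =ᵐ[volume] 0) :
    IsThresholdSolution m σ V (fun x => -G0 m (vstar (vmat B lam) φ) x) ∧
      φ =ᵐ[volume] fun x => act (Umat lam x * vmat B lam x)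
        (-G0 m (vstar (vmat B lam) φ) x) := by
  have hf := hv.integrable_vstar φ
  have hφ : φ =ᵐ[volume] fun x => act (Umat lam x * vmat B lam x)
      (-G0 m (vstar (vmat B lam) φ) x) := by
    filter_upwards [hker] with x hx
    have hx' : act (vmat B lam x) (G0 m (vstar (vmat B lam) φ) x) = -act (Umat lam x) (φ x) :=
      eq_neg_of_add_eq_zero_right hx
    -- Applying U to Uφ = -v𝒢₀v*φ and using U² = I.
    rw [← act_act, act_neg, hx', neg_neg, act_act, Umat_mul_Umat, act_one]
  obtain ⟨C, hC, hle⟩ := hv.exists_le_om_sq (m := m) (lam := lam) EventuallyEq.rfl hφ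
  have hVψ := vstar_ae_eq h hφ
  have hGm : AEStronglyMeasurable (fun x => -G0 m (vstar (vmat B lam) φ) x) volume :=
    (aestronglyMeasurable_G0 m hf.1).neg
  -- Since φ is recovered from the solution as Uvψ, a vanishing solution would force φ = 0.
  refine ⟨⟨memWeightedL2_of_le_om_sq hσ hGm hC hle, fun h0 => hφ0 ?_, ?_⟩, hφ⟩
  · rw [Lp.eq_zero_iff_ae_eq_zero]
    filter_upwards [hφ, h0] with x hx hx0
    rw [hx, hx0]
    exact act_zero _
  · rw [isDistributionalSolution_iff]
    exact ⟨(locallyIntegrable_G0 m hf).neg, (hf.congr hVψ).locallyIntegrable,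
      (diracWeak_neg_G0 m hf).congr EventuallyEq.rfl hVψ⟩

end Dirac4

end

/-! ### The correspondence between the kernel of T₀ and threshold solutions. -/

theorem lemma5p1
    (m : ℝ) (hm : 0 < m)
    (V : Dirac4.R4 → Dirac4.M4) (hV : ∀ x, (V x).IsHermitian)
    (B : Dirac4.R4 → Dirac4.M4) (lam : Dirac4.R4 → Fin 4 → ℝ)
    (hdiag : Dirac4.IsDiagonalization V B lam)
    (hdecay : ∃ ε > (0 : ℝ), ∃ C : ℝ, ∀ x i j,
      ‖Dirac4.vmat B lam x i j‖ ≤ C * Dirac4.bracket x ^ (-2 - ε))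
    (σ : ℝ) (hσ : 0 < σ) (hσ2 : σ < 2)
    (φ : Dirac4.L2) :
    ((φ ∈ LinearMap.range
          (Dirac4.S1 m (Dirac4.Umat lam) (Dirac4.vmat B lam)).toLinearMap ∧ φ ≠ 0) ↔
      ∃ ψ : Dirac4.R4 → Dirac4.C4, Dirac4.IsThresholdSolution m σ V ψ ∧
        φ =ᵐ[volume] fun x => Dirac4.act (Dirac4.Umat lam x * Dirac4.vmat B lam x) (ψ x)) ∧
    (∀ ψ : Dirac4.R4 → Dirac4.C4, Dirac4.IsThresholdSolution m σ V ψ →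
      (φ =ᵐ[volume] fun x => Dirac4.act (Dirac4.Umat lam x * Dirac4.vmat B lam x) (ψ x)) →
        Dirac4.G0Converges m (Dirac4.vstar (Dirac4.vmat B lam) φ) ∧
        (ψ =ᵐ[volume] fun x => -Dirac4.G0 m (Dirac4.vstar (Dirac4.vmat B lam) φ) x) ∧
        ∃ C : ℝ, ∀ᵐ x ∂(volume : Measure Dirac4.R4), ‖ψ x‖ ≤ C) := by
  obtain ⟨s, K, hv⟩ := Dirac4.exists_decayBound hdiag hdecay
  obtain ⟨C, hC⟩ := hv.exists_eLpNorm_T0fun_le (Dirac4.enorm_act_Umat_le lam)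
    (Dirac4.aemeasurable_Umat hdiag) m
  have hdom : ∀ χ : Dirac4.L2, χ ∈ Dirac4.T0domain m (Dirac4.Umat lam) (Dirac4.vmat B lam) :=
    fun χ => Dirac4.mem_T0domain (hv.integrable_vstar χ) (hC χ)
  rw [Dirac4.mem_range_S1_iff (Dirac4.isClosed_kerT0 hdom fun χ => (hC χ).2),
    Dirac4.mem_kerT0_iff]
  refine ⟨⟨fun ⟨⟨_, hker⟩, hφ0⟩ =>
    ⟨_, Dirac4.isThresholdSolution_neg_G0 hσ hdiag hv hφ0 hker⟩, ?_⟩, fun ψ hψ hφ => ?_⟩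
  · rintro ⟨ψ, hψ, hφ⟩
    have hG := hψ.ae_eq_neg_G0 hσ hσ2 hdiag hv hφ
    refine ⟨⟨hdom φ, ?_⟩, fun h0 => hψ.2.1 ?_⟩
    · filter_upwards [hφ, hG] with x hx hx2
      -- Here Uφ = U²vψ = vψ, which cancels v𝒢₀v*φ = -vψ.
      rw [Dirac4.T0fun, hx, Dirac4.act_act, ← mul_assoc, Dirac4.Umat_mul_Umat, one_mul, hx2,
        Dirac4.act_neg, neg_add_cancel]
      rfl
    -- If φ were zero, then ψ = -𝒢₀v*φ would vanish as well.
    · have hz : Dirac4.vstar (Dirac4.vmat B lam) φ =ᵐ[volume] 0 := by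
        filter_upwards [(Lp.eq_zero_iff_ae_eq_zero).1 h0] with x hx
        rw [Dirac4.vstar, hx]
        exact Dirac4.act_zero _
      filter_upwards [hG] with x hx
      have : Dirac4.G0 m (Dirac4.vstar (Dirac4.vmat B lam) φ) x = 0 := by
        refine integral_eq_zero_of_ae ?_
        filter_upwards [hz] with y hy
        rw [hy]
        exact Dirac4.act_zero _
      rw [hx, this, neg_zero]
      rfl
  · have hG := hψ.ae_eq_neg_G0 hσ hσ2 hdiag hv hφ
    obtain ⟨D, hD, hle⟩ := hv.exists_le_om_sq hG hφ
    refine ⟨Dirac4.G0Converges_of_integrable m (hv.integrable_vstar φ), hG, D.toReal, ?_⟩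
    filter_upwards [hle] with x hx
    have h1 : ‖ψ x‖ₑ ≤ D :=
      hx.trans (mul_le_of_le_one_right zero_le (pow_le_one₀ zero_le (Dirac4.om_le_one x)))
    rw [← toReal_enorm]
    exact ENNReal.toReal_mono hD h1
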